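/- Let $\mathsf{MAC}$ be the first-order theory in the language $\{\in\}$ whose axioms are Extensionality, Empty Set, Pairing, Union, Power Set, Infinity, Foundation, Choice, Transitive Containment (every set is contained in a transitive set), and Separation for bounded ($\Delta_0$) formulas with parameters; there is no Replacement. In $\mathsf{MAC}$, a simplicial set $X$ is a presheaf on the simplex category $\Delta$, given by a set $X_0$ of all its simplices, a function $X_0\to\Delta_0$ giving the object $[n]=\{0,\dots,n\}$ over which each simplex lies, and an action of the arrows of $\Delta$ satisfying the presheaf laws; simplicial maps are the natural transformations, and a simplicial map is monic if it is injective on simplices. A Kan fibration is a simplicial map with the right lifting property against all horn inclusions $\Lambda^k[n]\subseteq\Delta[n]$ ($n\ge 1$, $0\le k\le n$), and a Kan complex is a simplicial set $K$ for which every map $\Lambda^k[n]\to K$ extends to $\Delta[n]$. A simplicial map $f\colon X\to Y$ is acyclic (a weak equivalence) if for every Kan complex $K$ composition with $f$ induces a bijection $[Y,K]\to[X,K]$ of simplicial homotopy classes of maps (homotopies being maps out of $X\times\Delta[1]$, respectively $Y\times\Delta[1]$). Theorem. $\mathsf{MAC}$ proves: for every simplicial map $f\colon X\to Y$, 1. there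 are a simplicial set $Z$, an acyclic monic $j\colon X\to Z$ and a Kan fibration $p\colon Z\to Y$ with $f=p\circ j$; and 2. there are a simplicial set $Z$, a monic $j\colon X\to Z$ and an acyclic Kan fibration $p\colon Z\to Y$ with $f=p\circ j$. -/

import Mathlib

open FirstOrder FirstOrder.Language

namespace MacSet

/-! ### The first-order language of set theory -/

/-- The only relation symbol: binary membership. -/
inductive MemRel : ℕ → Type
  | mem : MemRel 2

/-- The first-order language with one binary relation symbol and no function symbols. -/
def lang : FirstOrder.Language.{0, 0} := ⟨fun _ => Empty, MemRel⟩

/-- Formulas whose free variables are indexed by `Fin n`. -/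
abbrev Form (n : ℕ) : Type := lang.BoundedFormula Empty n

/-- The `i`-th variable as a term (there are no other terms). -/
def var {n : ℕ} (i : Fin n) : lang.Term (Empty ⊕ Fin n) := Term.var (Sum.inr i)

/-- The atomic formula "variable `i` is a member of variable `j`". -/
def memForm {n : ℕ} (i j : Fin n) : Form n :=
  Relations.boundedFormula₂ (L := lang) MemRel.mem (var i) (var j)

/-- The atomic formula "variable `i` equals variable `j`". -/
def eqForm {n : ℕ} (i j : Fin n) : Form n := Term.bdEqual (var i) (var j)

/-- Bounded (i.e. `Δ₀`) formulas: all quantifiers have the shape `∀ x ∈ y` with `y` a variable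
(and hence, by negation, `∃ x ∈ y`).  Negation, conjunction and disjunction are expressed
through `⊥` and implication, as everywhere for `BoundedFormula`. -/
inductive IsDeltaZero : {n : ℕ} → Form n → Prop
  | falsum {n : ℕ} : IsDeltaZero (⊥ : Form n)
  | eq {n : ℕ} (i j : Fin n) : IsDeltaZero (eqForm i j)
  | mem {n : ℕ} (i j : Fin n) : IsDeltaZero (memForm i j)
  | imp {n : ℕ} {φ ψ : Form n} : IsDeltaZero φ → IsDeltaZero ψ → IsDeltaZero (φ.imp ψ)
  | all {n : ℕ} (j : Fin n) {φ : Form (n + 1)} : IsDeltaZero φ →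
      IsDeltaZero ((memForm (Fin.last n) j.castSucc).imp φ).all

/-! ### Writing formulas with named variables

A "schematic formula" assigns to each number `n` of variables in scope a formula in the
variables `0, …, n - 1`.  A quantifier introduces the next unused variable and hands its index to
its body, so that formulas can be written with ordinary variable binding.  An atomic formula whose
variables are out of scope is replaced by `⊥`; this does not occur in a closed formula written with
these combinators. -/

/-- Schematic formulas. -/
def Fm : Type := (n : ℕ) → Form n

namespace Fm

/-- Membership. -/
def mem (x y : ℕ) : Fm := fun n =>
  if h : x < n ∧ y < n then memForm ⟨x, h.1⟩ ⟨y, h.2⟩ else ⊥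

/-- Equality. -/
def eq (x y : ℕ) : Fm := fun n =>
  if h : x < n ∧ y < n then eqForm ⟨x, h.1⟩ ⟨y, h.2⟩ else ⊥

/-- Negation. -/
def neg (φ : Fm) : Fm := fun n => (φ n).not

/-- Conjunction. -/
def and (φ ψ : Fm) : Fm := fun n => φ n ⊓ ψ n

/-- Disjunction. -/
def or (φ ψ : Fm) : Fm := fun n => φ n ⊔ ψ n

/-- Implication. -/
def imp (φ ψ : Fm) : Fm := fun n => (φ n).imp (ψ n)

/-- Equivalence. -/
def iff (φ ψ : Fm) : Fm := fun n => (φ n).iff (ψ n)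

/-- Universal quantification over all sets. -/
def all (f : ℕ → Fm) : Fm := fun n => (f n (n + 1)).all

/-- Existential quantification over all sets. -/
def ex (f : ℕ → Fm) : Fm := fun n => (f n (n + 1)).ex

end Fm

infix:75 " ∈ₛ " => Fm.mem
infix:75 " ≐ₛ " => Fm.eq
prefix:max "¬ₛ" => Fm.neg
infixr:65 " ∧ₛ " => Fm.and
infixr:60 " ∨ₛ " => Fm.or
infixr:55 " ⟹ₛ " => Fm.imp
infix:50 " ⟺ₛ " => Fm.iff

namespace Fm

/-- `∀ x ∈ a`. -/
def allIn (a : ℕ) (f : ℕ → Fm) : Fm := all fun x => x ∈ₛ a ⟹ₛ f x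

/-- `∃ x ∈ a`. -/
def exIn (a : ℕ) (f : ℕ → Fm) : Fm := ex fun x => x ∈ₛ a ∧ₛ f x

def all2 (f : ℕ → ℕ → Fm) : Fm := all fun x => all fun y => f x y
def all3 (f : ℕ → ℕ → ℕ → Fm) : Fm := all fun x => all2 (f x)
def all4 (f : ℕ → ℕ → ℕ → ℕ → Fm) : Fm := all fun x => all3 (f x)
def ex2 (f : ℕ → ℕ → Fm) : Fm := ex fun x => ex fun y => f x y
def ex3 (f : ℕ → ℕ → ℕ → Fm) : Fm := ex fun x => ex2 (f x)
def ex4 (f : ℕ → ℕ → ℕ → ℕ → Fm) : Fm := ex fun x => ex3 (f x)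

/-- The sentence given by a schematic formula with no variable in scope. -/
def close (φ : Fm) : lang.Sentence := φ 0

end Fm

open Fm

/-! ### Elementary set theoretic vocabulary -/

/-- `x ⊆ y`. -/
def sub (x y : ℕ) : Fm := allIn x fun z => z ∈ₛ y

/-- `x = ∅`. -/
def isEmpty (x : ℕ) : Fm := all fun z => ¬ₛ(z ∈ₛ x)

/-- `x ≠ ∅`. -/
def inhabited (x : ℕ) : Fm := ex fun z => z ∈ₛ x

/-- `s = x ∪ {x}`. -/
def isSucc (s x : ℕ) : Fm := all fun z => z ∈ₛ s ⟺ₛ (z ∈ₛ x ∨ₛ z ≐ₛ x)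

/-- `x` is a transitive set. -/
def isTransitive (x : ℕ) : Fm := allIn x fun y => sub y x

/-- `∅ ∈ x`, and `y ∪ {y} ∈ x` for all `y ∈ x`. -/
def isInductive (x : ℕ) : Fm :=
  (exIn x fun e => isEmpty e) ∧ₛ (allIn x fun y => exIn x fun s => isSucc s y)

/-- `w = ω`, the least inductive set, i.e. the set of natural numbers `n = {0, …, n - 1}`. -/
def isOmega (w : ℕ) : Fm := isInductive w ∧ₛ all fun u => isInductive u ⟹ₛ sub w u

/-- `p = {a, b}`. -/
def isUPair (p a b : ℕ) : Fm := all fun z => z ∈ₛ p ⟺ₛ (z ≐ₛ a ∨ₛ z ≐ₛ b)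

/-- `p = ⟨a, b⟩ = {{a}, {a, b}}`. -/
def isPair (p a b : ℕ) : Fm :=
  ex2 fun u v => isUPair u a a ∧ₛ isUPair v a b ∧ₛ isUPair p u v

/-- `t = ⟨⟨a, b⟩, c⟩`. -/
def isTriple (t a b c : ℕ) : Fm := ex fun p => isPair p a b ∧ₛ isPair t p c

/-- `⟨a, b⟩ ∈ r`; for a function `r` this says `r a = b`. -/
def rel (r a b : ℕ) : Fm := exIn r fun p => isPair p a b

/-- `⟨⟨a, b⟩, c⟩ ∈ r`; for a function `r` of two arguments this says `r (a, b) = c`. -/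
def rel3 (r a b c : ℕ) : Fm := exIn r fun t => isTriple t a b c

/-- `f` is (the graph of) a function from `a` to `b`. -/
def isFun (f a b : ℕ) : Fm :=
  (allIn f fun p => exIn a fun x => exIn b fun y => isPair p x y) ∧ₛ
  (allIn a fun x => exIn b fun y => rel f x y ∧ₛ all fun z => rel f x z ⟹ₛ z ≐ₛ y)

/-- `h = g ∘ f` as relations. -/
def isComp (h g f : ℕ) : Fm :=
  all fun p => p ∈ₛ h ⟺ₛ ex3 fun x y z => rel f x y ∧ₛ rel g y z ∧ₛ isPair p x z

/-- `i` is the identity function on `a`. -/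
def isId (i a : ℕ) : Fm := all fun p => p ∈ₛ i ⟺ₛ exIn a fun x => isPair p x x

/-- `c` is the constant function on `a` with value `v`. -/
def isConst (c a v : ℕ) : Fm := all fun p => p ∈ₛ c ⟺ₛ exIn a fun x => isPair p x v

/-! ### The set theory MAC -/

/-- Sets with the same members are equal. -/
def extensionality : lang.Sentence := close <|
  all2 fun x y => (all fun z => z ∈ₛ x ⟺ₛ z ∈ₛ y) ⟹ₛ x ≐ₛ y

/-- There is an empty set. -/
def emptySet : lang.Sentence := close <| ex fun x => isEmpty x

/-- Unordered pairs exist. -/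
def pairing : lang.Sentence := close <| all2 fun x y => ex fun p => isUPair p x y

/-- Unions exist. -/
def union : lang.Sentence := close <|
  all fun x => ex fun u => all fun z => z ∈ₛ u ⟺ₛ exIn x fun y => z ∈ₛ y

/-- Power sets exist. -/
def powerSet : lang.Sentence := close <|
  all fun x => ex fun p => all fun z => z ∈ₛ p ⟺ₛ sub z x

/-- There is an inductive set. -/
def infinity : lang.Sentence := close <| ex fun x => isInductive x

/-- Regularity: a nonempty set `x` has a member disjoint from `x`. -/
def foundation : lang.Sentence := close <|
  all fun x => inhabited x ⟹ₛ exIn x fun y => allIn y fun z => ¬ₛ(z ∈ₛ x)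

/-- Choice: for every set `x` of nonempty pairwise disjoint sets there is a set which has exactly
one member in common with each member of `x`. -/
def choice : lang.Sentence := close <|
  all fun x =>
    ((allIn x fun y => inhabited y) ∧ₛ
      (allIn x fun y => allIn x fun z => (exIn y fun u => u ∈ₛ z) ⟹ₛ y ≐ₛ z)) ⟹ₛ
    ex fun c => allIn x fun y => exIn y fun u =>
      u ∈ₛ c ∧ₛ allIn y fun v => v ∈ₛ c ⟹ₛ v ≐ₛ u

/-- Transitive containment: every set is a subset of a transitive set. -/
def transitiveContainment : lang.Sentence := close <|
  all fun x => ex fun t => isTransitive t ∧ₛ sub x t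

/-- The separation axiom for the formula `φ (p₀, …, pₙ₋₁, x)`:
`∀ p₀ … pₙ₋₁, ∀ a, ∃ b, ∀ x, x ∈ b ↔ x ∈ a ∧ φ (p₀, …, pₙ₋₁, x)`.
Inside the quantifiers `a`, `b`, `x` are the variables `n`, `n + 1`, `n + 2`, so the last variable
of `φ` is moved from place `n` to place `n + 2`. -/
def separation (n : ℕ) (φ : Form (n + 1)) : lang.Sentence :=
  BoundedFormula.alls (n := n)
    (BoundedFormula.all (BoundedFormula.ex (BoundedFormula.all
      ((memForm (n := n + 3) ⟨n + 2, by omega⟩ ⟨n + 1, by omega⟩).iff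
        (memForm (n := n + 3) ⟨n + 2, by omega⟩ ⟨n, by omega⟩ ⊓ φ.liftAt 2 n)))))

/-- The theory MAC: the axioms of ZFC without replacement, with separation for bounded
formulas only, and with transitive containment. -/
def MAC : lang.Theory :=
  {extensionality, emptySet, pairing, union, powerSet, infinity, foundation, choice,
    transitiveContainment} ∪
  {σ | ∃ (n : ℕ) (φ : Form (n + 1)), IsDeltaZero φ ∧ σ = separation n φ}

/-! ### The simplex category

Throughout, the first argument `w` stands for the set `ω`.  The object `[n] = {0, …, n}` is the
natural number `n + 1`, i.e. a nonzero element of `ω`; the order on it is membership. -/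

/-- `m = [n]`. -/
def isOrd (m n : ℕ) : Fm := isSucc m n

/-- `m` is an object of the simplex category. -/
def isObj (w m : ℕ) : Fm := exIn w fun n => isOrd m n

/-- `a` is (the graph of) an order preserving function from `k` to `m`, objects of the simplex
category. -/
def isHom (w a k m : ℕ) : Fm :=
  isObj w k ∧ₛ isObj w m ∧ₛ isFun a k m ∧ₛ
  all4 fun i i' j j' => (rel a i i' ∧ₛ rel a j j' ∧ₛ i ∈ₛ j) ⟹ₛ (i' ∈ₛ j' ∨ₛ i' ≐ₛ j')

/-! ### Simplicial sets

As there is no replacement, a presheaf on the simplex category is given by the set of all its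
simplices, the function sending a simplex to the object of the simplex category over which it lies,
and the action function, which sends an arrow `a : k → m` and a simplex `x` over `m` to a simplex
over `k`.  Since `m` is determined by `x`, and `k` by the graph of `a`, arrows enter the
action as graphs. -/

/-- Three variables, naming the constituents of a simplicial set. -/
structure SVar where
  /-- the set of all simplices -/
  carrier : ℕ
  /-- the function giving for each simplex the object `[n]` over which it lies -/
  dim : ℕ
  /-- the action of the arrows of the simplex category -/
  act : ℕ

/-- Quantification over three sets. -/
def allS (f : SVar → Fm) : Fm := all3 fun s d g => f ⟨s, d, g⟩

/-- Existential quantification over three sets. -/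
def exS (f : SVar → Fm) : Fm := ex3 fun s d g => f ⟨s, d, g⟩

/-- `x` is a simplex of `X` over the object `m = [n]`, i.e. an `n`-simplex. -/
def simplexOver (X : SVar) (x m : ℕ) : Fm := x ∈ₛ X.carrier ∧ₛ rel X.dim x m

/-- `X` is a simplicial set. -/
def isSSet (w : ℕ) (X : SVar) : Fm :=
  -- every simplex lies over exactly one object of the simplex category
  isFun X.dim X.carrier w ∧ₛ
  (all2 fun x m => rel X.dim x m ⟹ₛ isObj w m) ∧ₛ
  -- the action is defined exactly at `(a, x)` with `a : k → m` and `x` over `m`,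
  -- and its value lies over `k`
  (allIn X.act fun t => ex3 fun a x y => ex2 fun k m =>
    isTriple t a x y ∧ₛ isHom w a k m ∧ₛ simplexOver X x m ∧ₛ simplexOver X y k) ∧ₛ
  (all4 fun a k m x => (isHom w a k m ∧ₛ simplexOver X x m) ⟹ₛ
    ex fun y => rel3 X.act a x y ∧ₛ all fun z => rel3 X.act a x z ⟹ₛ z ≐ₛ y) ∧ₛ
  -- identities
  (all3 fun x m i => (simplexOver X x m ∧ₛ isId i m) ⟹ₛ rel3 X.act i x x) ∧ₛ
  -- composites `c = a ∘ b`
  (all4 fun a b c k => all4 fun l m x y => all fun z =>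
    (isHom w a k m ∧ₛ isHom w b l k ∧ₛ isComp c a b ∧ₛ simplexOver X x m ∧ₛ
      rel3 X.act a x y ∧ₛ rel3 X.act b y z) ⟹ₛ rel3 X.act c x z)

/-- `f` is a simplicial map from `X` to `Y`. -/
def isMap (X Y : SVar) (f : ℕ) : Fm :=
  isFun f X.carrier Y.carrier ∧ₛ
  (all3 fun x y m => (rel f x y ∧ₛ rel X.dim x m) ⟹ₛ rel Y.dim y m) ∧ₛ
  (all3 fun a x x' => all2 fun y y' =>
    (rel3 X.act a x x' ∧ₛ rel f x y ∧ₛ rel f x' y') ⟹ₛ rel3 Y.act a y y')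

/-- The map `f` is monic, i.e. injective on simplices. -/
def isMonic (f : ℕ) : Fm := all3 fun x x' y => (rel f x y ∧ₛ rel f x' y) ⟹ₛ x ≐ₛ x'

/-- `D` is the simplicial subset of the standard simplex `Hom(-, m)` which consists of
the arrows satisfying `S`. -/
def isSubStd (w m : ℕ) (S : ℕ → Fm) (D : SVar) : Fm :=
  (all fun a => a ∈ₛ D.carrier ⟺ₛ ((ex fun k => isHom w a k m) ∧ₛ S a)) ∧ₛ
  (all fun p => p ∈ₛ D.dim ⟺ₛ ex2 fun a k => a ∈ₛ D.carrier ∧ₛ isHom w a k m ∧ₛ isPair p a k) ∧ₛ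
  (all fun t => t ∈ₛ D.act ⟺ₛ ex4 fun a k b l => ex fun c =>
    a ∈ₛ D.carrier ∧ₛ isHom w a k m ∧ₛ isHom w b l k ∧ₛ isComp c a b ∧ₛ isTriple t b a c)

/-- `D` is the standard simplex `Δ[n] = Hom(-, m)`, where `m = [n]`. -/
def isStd (w m : ℕ) (D : SVar) : Fm := isSubStd w m (fun a => a ≐ₛ a) D

/-- `D` is the horn `Λ^k[n] ⊆ Δ[n] = Hom(-, m)`, where `m = [n]`: the arrows to `[n]`
which omit some value `i ≠ k`. -/
def isHorn (w m k : ℕ) (D : SVar) : Fm :=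
  isSubStd w m (fun a => exIn m fun i => ¬ₛ(i ≐ₛ k) ∧ₛ all fun j => ¬ₛ(rel a j i)) D

/-- `L` is a horn `Λ^k[n]` and `D` is the simplex `Δ[n]`, for some `n ≥ 1` and some
`k ∈ [n]`. -/
def isHornInSimplex (w : ℕ) (L D : SVar) : Fm :=
  exIn w fun n => inhabited n ∧ₛ ex fun m => isOrd m n ∧ₛ isStd w m D ∧ₛ
    exIn m fun k => isHorn w m k L

/-- The map `p : Z → Y` is a Kan fibration: if `h : Λ^k[n] → Z` and `b : Δ[n] → Y`
agree in `Y` on the horn, then there is `l : Δ[n] → Z` which extends `h` and satisfies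
`p ∘ l = b`. -/
def isKanFibration (w : ℕ) (Z Y : SVar) (p : ℕ) : Fm :=
  allS fun L => allS fun D => isHornInSimplex w L D ⟹ₛ
    all2 fun h b =>
      (isMap L Z h ∧ₛ isMap D Y b ∧ₛ all3 fun a z y => (rel h a z ∧ₛ rel p z y) ⟹ₛ rel b a y) ⟹ₛ
      ex fun l => isMap D Z l ∧ₛ sub h l ∧ₛ isComp b p l

/-- The simplicial set `K` is a Kan complex: every `h : Λ^k[n] → K` extends to
`Δ[n]`. -/
def isKanComplex (w : ℕ) (K : SVar) : Fm :=
  allS fun L => allS fun D => isHornInSimplex w L D ⟹ₛ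
    all fun h => isMap L K h ⟹ₛ ex fun l => isMap D K l ∧ₛ sub h l

/-- `P` is the product `X × Y` of simplicial sets: pairs of simplices over the same object, with
the componentwise action. -/
def isProd (X Y P : SVar) : Fm :=
  (all fun p => p ∈ₛ P.carrier ⟺ₛ ex3 fun x y m =>
    simplexOver X x m ∧ₛ simplexOver Y y m ∧ₛ isPair p x y) ∧ₛ
  (all fun q => q ∈ₛ P.dim ⟺ₛ ex4 fun x y m p =>
    simplexOver X x m ∧ₛ simplexOver Y y m ∧ₛ isPair p x y ∧ₛ isPair q p m) ∧ₛ
  (all fun t => t ∈ₛ P.act ⟺ₛ ex3 fun a p p' => ex4 fun x y x' y' =>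
    p ∈ₛ P.carrier ∧ₛ isPair p x y ∧ₛ isPair p' x' y' ∧ₛ
    rel3 X.act a x x' ∧ₛ rel3 Y.act a y y' ∧ₛ isTriple t a p p')

/-- The maps `f, g : X → K` are simplicially homotopic: there is a map `H : X × Δ[1] → K`
with `H (x, 0) = f x` and `H (x, 1) = g x`, where `0` and `1` also stand for the constant arrows
to `[1] = {0, 1}`. -/
def isHomotopic (w : ℕ) (X K : SVar) (f g : ℕ) : Fm :=
  ex3 fun o i t => isEmpty o ∧ₛ isSucc i o ∧ₛ isSucc t i ∧ₛ
    exS fun I => exS fun P => isStd w t I ∧ₛ isProd X I P ∧ₛ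
      ex fun H => isMap P K H ∧ₛ
        all4 fun x m c q => (simplexOver X x m ∧ₛ isPair q x c) ⟹ₛ
          ((isConst c m o ⟹ₛ all fun y => rel f x y ⟹ₛ rel H q y) ∧ₛ
           (isConst c m i ⟹ₛ all fun y => rel g x y ⟹ₛ rel H q y))

/-- The map `f : X → Y` is acyclic, i.e. a weak equivalence: for every Kan complex `K`,
composition with `f` induces a bijection from homotopy classes of maps `Y → K` to homotopy
classes of maps `X → K`. -/
def isAcyclic (w : ℕ) (X Y : SVar) (f : ℕ) : Fm :=
  allS fun K => (isSSet w K ∧ₛ isKanComplex w K) ⟹ₛ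
    ((all fun g => isMap X K g ⟹ₛ
        ex2 fun h c => isMap Y K h ∧ₛ isComp c h f ∧ₛ isHomotopic w X K c g) ∧ₛ
     (all4 fun h h' c c' =>
        (isMap Y K h ∧ₛ isMap Y K h' ∧ₛ isComp c h f ∧ₛ isComp c' h' f ∧ₛ
          isHomotopic w X K c c') ⟹ₛ isHomotopic w Y K h h'))

/-- `Z` is a simplicial set, and `j : X → Z`, `p : Z → Y` are simplicial maps
with `p ∘ j = f`. -/
def isFactorization (w : ℕ) (X Y : SVar) (f : ℕ) (Z : SVar) (j p : ℕ) : Fm :=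
  isSSet w Z ∧ₛ isMap X Z j ∧ₛ isMap Z Y p ∧ₛ isComp f p j

/-- The sentence: every simplicial map `f : X → Y` factors as an acyclic monic
followed by a Kan fibration, and also as a monic followed by an acyclic Kan fibration. -/
def factorizationSentence : lang.Sentence := close <|
  all fun w => isOmega w ⟹ₛ allS fun X => allS fun Y => all fun f =>
    (isSSet w X ∧ₛ isSSet w Y ∧ₛ isMap X Y f) ⟹ₛ
    ((exS fun Z => ex2 fun j p => isFactorization w X Y f Z j p ∧ₛ
        isMonic j ∧ₛ isAcyclic w X Z j ∧ₛ isKanFibration w Z Y p) ∧ₛ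
     (exS fun Z => ex2 fun j p => isFactorization w X Y f Z j p ∧ₛ
        isMonic j ∧ₛ isKanFibration w Z Y p ∧ₛ isAcyclic w Z Y p))

end MacSet

/-! By completeness it suffices to argue in an arbitrary model `M` of MAC. Power sets, bounded
separation, infinity and choice make the sets of `M` a model of classical higher order type theory
with natural numbers and choice. A type whose elements are named by the members of a set of `M` is
`Coded`; a function whose graph is a set of `M` is `Internal`. Coded types are closed under
products, function types, subtypes and truth values, and quantifying over a coded type is bounded.
So simplicial sets can be handled as ordinary types and functions, provided that everything is shown
to be internal; `Rep` and `Gr` translate between such objects and the sets of the model that the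
formulas speak of.

What is missing without Replacement is iteration: the small object argument, which adds fillers step
after step and takes the union, is not available. Both factorizations are therefore constructed in
one stroke inside iterated power sets, and transfinite recursion is replaced by Zorn's lemma for
internal families (`exists_maximal`).

Acyclic monic, then fibration: `Z` is `X` with all horns over `Y` filled freely. A simplex of `Z` is
a simplex of `X` or a well-founded tree, whose root carries a horn problem and a face of its filler,
and whose branches, indexed by arrows, are the simplices forming the horn. All such trees are
subsets of one fixed set of sequences, so the least set of trees closed under filling is an
intersection of internal sets. Every horn over `Y` has a filler by construction, so the projection
is a Kan fibration. The inclusion of `X` attaches cells along horns in a well-founded way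
(`IsCellular`). Maps from `X` to a Kan complex extend cell by cell; homotopies extend because maps
from Λ^k[n] × Δ[1] ∪ Δ[n] × ∂Δ[1] to a Kan complex extend to Δ[n] × Δ[1] (`exists_cylinder_horn`).
The latter follows from the homotopy extension property (`exists_homotopy_extension`), proved by
decomposing prisms into simplices, through a retraction.

Monic, then acyclic fibration: `Z` consists of the simplices y : Δ[n] → Y together with a lift to
`X` defined on some subcomplex of Δ[n]. A simplex of `X` is a lift defined everywhere. Compatible
partial lifts on a horn are glued by taking their union, so the projection is a Kan fibration. The
nowhere defined lifts form a section of it, and shrinking the domain of a lift gives a homotopy from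
the resulting idempotent to the identity, so the projection is acyclic (`isAcyc_of_section`). -/

noncomputable section

open FirstOrder FirstOrder.Language
open scoped Classical

set_option linter.unusedSectionVars false
set_option linter.unusedSimpArgs false

namespace MacSet

/-! ### Truth of formulas, bounded formulas and models of MAC -/

section

/-! ### Semantics of schematic formulas -/

section Semantics

variable {M : Type} [lang.Structure M]

/-- The membership relation of a structure. -/
def E (x y : M) : Prop := Structure.RelMap (L := lang) MemRel.mem ![x, y]

/-- Truth of a schematic formula with `n` variables in scope. -/
def Sat (φ : Fm) (n : ℕ) (v : ℕ → M) : Prop :=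
  (φ n).Realize (default : Empty → M) fun i : Fin n => v i

variable {n : ℕ} {v : ℕ → M}

theorem snoc_eq_update (v : ℕ → M) (n : ℕ) (m : M) :
    (Fin.snoc (fun i : Fin n => v i) m : Fin (n + 1) → M) =
      fun i : Fin (n + 1) => Function.update v n m i := by
  funext i
  refine Fin.lastCases ?_ (fun j => ?_) i
  · simp
  · have : (j : ℕ) ≠ n := j.2.ne
    simp [this]

theorem realize_memForm {i j : Fin n} {w : Empty → M} {v : Fin n → M} :
    (memForm i j).Realize w v ↔ E (v i) (v j) := by
  exact BoundedFormula.realize_rel₂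

theorem realize_eqForm {i j : Fin n} {w : Empty → M} {v : Fin n → M} :
    (eqForm i j).Realize w v ↔ v i = v j := by
  simp [eqForm, var]

theorem sat_mem {x y : ℕ} (hx : x < n) (hy : y < n) :
    Sat (Fm.mem x y) n v ↔ E (v x) (v y) := by
  simp [Sat, Fm.mem, hx, hy, realize_memForm]

theorem sat_eq {x y : ℕ} (hx : x < n) (hy : y < n) :
    Sat (Fm.eq x y) n v ↔ v x = v y := by
  simp [Sat, Fm.eq, hx, hy, realize_eqForm]

theorem sat_neg {φ : Fm} : Sat φ.neg n v ↔ ¬ Sat φ n v := by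
  simp [Sat, Fm.neg]

theorem sat_and {φ ψ : Fm} : Sat (φ.and ψ) n v ↔ Sat φ n v ∧ Sat ψ n v := by
  simp [Sat, Fm.and]

theorem sat_or {φ ψ : Fm} : Sat (φ.or ψ) n v ↔ Sat φ n v ∨ Sat ψ n v := by
  simp [Sat, Fm.or]

theorem sat_imp {φ ψ : Fm} : Sat (φ.imp ψ) n v ↔ (Sat φ n v → Sat ψ n v) := by
  simp [Sat, Fm.imp]

theorem sat_iff {φ ψ : Fm} : Sat (φ.iff ψ) n v ↔ (Sat φ n v ↔ Sat ψ n v) := by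
  simp [Sat, Fm.iff, BoundedFormula.realize_iff]

theorem sat_all {f : ℕ → Fm} :
    Sat (Fm.all f) n v ↔ ∀ m, Sat (f n) (n + 1) (Function.update v n m) := by
  simp only [Sat, Fm.all]
  rw [BoundedFormula.realize_all]
  simp only [snoc_eq_update]

theorem sat_ex {f : ℕ → Fm} :
    Sat (Fm.ex f) n v ↔ ∃ m, Sat (f n) (n + 1) (Function.update v n m) := by
  simp only [Sat, Fm.ex]
  rw [BoundedFormula.realize_ex]
  simp only [snoc_eq_update]

theorem sat_allIn {a : ℕ} {f : ℕ → Fm} (ha : a < n) :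
    Sat (Fm.allIn a f) n v ↔ ∀ m, E m (v a) → Sat (f n) (n + 1) (Function.update v n m) := by
  simp (disch := omega) only [Fm.allIn, sat_all, sat_imp, sat_mem, Function.update_self,
    Function.update_of_ne]

theorem sat_exIn {a : ℕ} {f : ℕ → Fm} (ha : a < n) :
    Sat (Fm.exIn a f) n v ↔ ∃ m, E m (v a) ∧ Sat (f n) (n + 1) (Function.update v n m) := by
  simp (disch := omega) only [Fm.exIn, sat_ex, sat_and, sat_mem, Function.update_self,
    Function.update_of_ne]

theorem realize_close {φ : Fm} {v : ℕ → M} : Sentence.Realize M φ.close ↔ Sat φ 0 v := by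
  have h : (default : Fin 0 → M) = fun i : Fin 0 => v i := Subsingleton.elim _ _
  simp only [Sentence.Realize, Formula.Realize, Fm.close, Sat, h]

/-- A schematic formula that is equivalent to a bounded formula when `n` variables are in scope. -/
def Bdd (φ : Fm) (n : ℕ) : Prop :=
  ∃ ψ : Form n, IsDeltaZero ψ ∧ ∀ (M : Type) [lang.Structure M] (w : Empty → M) (v : Fin n → M),
    (φ n).Realize w v ↔ ψ.Realize w v

theorem bdd_mem {x y : ℕ} (hx : x < n) (hy : y < n) : Bdd (Fm.mem x y) n :=
  ⟨_, .mem ⟨x, hx⟩ ⟨y, hy⟩, by simp [Fm.mem, hx, hy]⟩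

theorem bdd_eq {x y : ℕ} (hx : x < n) (hy : y < n) : Bdd (Fm.eq x y) n :=
  ⟨_, .eq ⟨x, hx⟩ ⟨y, hy⟩, by simp [Fm.eq, hx, hy]⟩

theorem bdd_imp {φ ψ : Fm} : Bdd φ n → Bdd ψ n → Bdd (φ.imp ψ) n := by
  rintro ⟨a, ha, ea⟩ ⟨b, hb, eb⟩
  exact ⟨_, .imp ha hb, fun M _ w v => by simp [Fm.imp, ea, eb]⟩

theorem bdd_neg {φ : Fm} : Bdd φ n → Bdd φ.neg n := by
  rintro ⟨a, ha, ea⟩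
  exact ⟨_, .imp ha .falsum, fun M _ w v => by simp [Fm.neg, ea]⟩

theorem bdd_and {φ ψ : Fm} : Bdd φ n → Bdd ψ n → Bdd (φ.and ψ) n := by
  rintro ⟨a, ha, ea⟩ ⟨b, hb, eb⟩
  exact ⟨_, .imp (.imp ha (.imp hb .falsum)) .falsum, fun M _ w v => by simp [Fm.and, ea, eb]⟩

theorem bdd_or {φ ψ : Fm} : Bdd φ n → Bdd ψ n → Bdd (φ.or ψ) n := by
  rintro ⟨a, ha, ea⟩ ⟨b, hb, eb⟩
  refine ⟨_, .imp (.imp ha .falsum) hb, fun M _ w v => ?_⟩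
  simp only [Fm.or, BoundedFormula.realize_sup, BoundedFormula.realize_imp,
    BoundedFormula.realize_bot, ea, eb]
  tauto

theorem bdd_iff {φ ψ : Fm} (h : Bdd φ n) (h' : Bdd ψ n) : Bdd (φ.iff ψ) n := by
  obtain ⟨a, ha, ea⟩ := bdd_and (bdd_imp h h') (bdd_imp h' h)
  refine ⟨a, ha, fun M _ w v => ?_⟩
  rw [← ea]
  simp only [Fm.iff, Fm.and, Fm.imp, BoundedFormula.realize_iff, BoundedFormula.realize_inf,
    BoundedFormula.realize_imp]
  tauto

theorem bdd_allIn {a : ℕ} {f : ℕ → Fm} (ha : a < n) (h : Bdd (f n) (n + 1)) :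
    Bdd (Fm.allIn a f) n := by
  obtain ⟨b, hb, eb⟩ := h
  refine ⟨_, .all ⟨a, ha⟩ hb, fun M _ w v => ?_⟩
  have h1 : n < n + 1 ∧ a < n + 1 := ⟨by omega, by omega⟩
  simp only [Fm.allIn, Fm.all, Fm.imp, Fm.mem, h1, dif_pos, and_self, BoundedFormula.realize_all,
    BoundedFormula.realize_imp, eb, realize_memForm, BoundedFormula.realize_all]
  rfl

/-- `Fm.exIn` does not literally have a shape admitted by `IsDeltaZero`, so it is replaced by the
equivalent negated bounded universal quantifier. This is why `Bdd` asks for equivalence only. -/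
theorem bdd_exIn {a : ℕ} {f : ℕ → Fm} (ha : a < n) (h : Bdd (f n) (n + 1)) :
    Bdd (Fm.exIn a f) n := by
  obtain ⟨c, hc, ec⟩ := bdd_neg (bdd_allIn ha (f := fun x => (f x).neg) (bdd_neg h))
  refine ⟨c, hc, fun M _ w v => ?_⟩
  rw [← ec]
  simp [Fm.allIn, Fm.exIn, Fm.all, Fm.ex, Fm.imp, Fm.and, Fm.neg]

end Semantics

/-! ### Models -/

/-- A model of the theory MAC, with a choice of the set of natural numbers. Foundation and
transitive containment are left out since they are not used. -/
class MacModel (M : Type) extends lang.Structure M where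
  ext : ∀ x y : M, (∀ z, E z x ↔ E z y) → x = y
  pairing : ∀ x y : M, ∃ p, ∀ z, E z p ↔ z = x ∨ z = y
  union : ∀ x : M, ∃ u, ∀ z, E z u ↔ ∃ y, E y x ∧ E z y
  power : ∀ x : M, ∃ p, ∀ z, E z p ↔ ∀ y, E y z → E y x
  choice : ∀ x : M, (∀ y, E y x → ∃ z, E z y) →
    (∀ y, E y x → ∀ z, E z x → (∃ u, E u y ∧ E u z) → y = z) →
    ∃ c, ∀ y, E y x → ∃ u, E u y ∧ E u c ∧ ∀ v, E v y → E v c → v = u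
  sep : ∀ (φ : Fm) (n : ℕ), Bdd φ (n + 1) → ∀ (v : ℕ → M) (a : M),
    ∃ b, ∀ x, E x b ↔ E x a ∧ Sat φ (n + 1) (Function.update v n x)
  /-- the set of natural numbers -/
  om : M
  om_zero : ∃ e, E e om ∧ ∀ z, ¬ E z e
  om_succ : ∀ y, E y om → ∃ s, E s om ∧ ∀ z, E z s ↔ E z y ∨ z = y
  om_ind : ∀ u, (∃ e, E e u ∧ ∀ z, ¬ E z e) →
    (∀ y, E y u → ∃ s, E s u ∧ ∀ z, E z s ↔ E z y ∨ z = y) → ∀ z, E z om → E z u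

section Basic

variable {M : Type} [MacModel M]

theorem ext' {x y : M} (h : ∀ z, E z x ↔ E z y) : x = y := MacModel.ext x y h

def upair (x y : M) : M := (MacModel.pairing x y).choose
theorem mem_upair {x y z : M} : E z (upair x y) ↔ z = x ∨ z = y :=
  (MacModel.pairing x y).choose_spec z

def sUnion (x : M) : M := (MacModel.union x).choose
theorem mem_sUnion {x z : M} : E z (sUnion x) ↔ ∃ y, E y x ∧ E z y :=
  (MacModel.union x).choose_spec z

def pow (x : M) : M := (MacModel.power x).choose
theorem mem_pow {x z : M} : E z (pow x) ↔ ∀ y, E y z → E y x :=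
  (MacModel.power x).choose_spec z

def cup (x y : M) : M := sUnion (upair x y)
theorem mem_cup {x y z : M} : E z (cup x y) ↔ E z x ∨ E z y := by
  simp [cup, mem_sUnion, mem_upair]

def emp (M : Type) [MacModel M] : M := (MacModel.om_zero (M := M)).choose
theorem not_mem_emp {z : M} : ¬ E z (emp M) := (MacModel.om_zero (M := M)).choose_spec.2 z
theorem emp_mem_om : E (emp M) MacModel.om := (MacModel.om_zero (M := M)).choose_spec.1

/-- The Kuratowski pair. -/
def pr (x y : M) : M := upair (upair x x) (upair x y)

theorem upair_eq_upair {a b c d : M} :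
    upair a b = upair c d ↔ (a = c ∧ b = d) ∨ (a = d ∧ b = c) := by
  constructor
  · intro h
    have h' : ∀ z, (z = a ∨ z = b) ↔ (z = c ∨ z = d) := fun z => by
      rw [← mem_upair, h, mem_upair]
    have h1 := (h' a).1 (Or.inl rfl)
    have h2 := (h' b).1 (Or.inr rfl)
    have h3 := (h' c).2 (Or.inl rfl)
    have h4 := (h' d).2 (Or.inr rfl)
    grind
  · rintro (⟨rfl, rfl⟩ | ⟨rfl, rfl⟩)
    · rfl
    · exact ext' fun z => by simp [mem_upair, or_comm]

@[simp] theorem pr_inj {a b c d : M} : pr a b = pr c d ↔ a = c ∧ b = d := by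
  unfold pr
  rw [upair_eq_upair]
  simp only [upair_eq_upair]
  grind

/-- A bounded formula for `p = ⟨x, y⟩`. -/
def fPair (p x y : ℕ) : Fm :=
  Fm.exIn p fun u => Fm.exIn p fun v =>
    (Fm.allIn u fun z => Fm.eq z x).and <| (Fm.mem x u).and <|
    (Fm.allIn v fun z => (Fm.eq z x).or (Fm.eq z y)).and <| (Fm.mem x v).and <| (Fm.mem y v).and <|
    (Fm.allIn p fun q => (Fm.eq q u).or (Fm.eq q v))

theorem bdd_fPair {n p x y : ℕ} (hp : p < n) (hx : x < n) (hy : y < n) : Bdd (fPair p x y) n := by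
  unfold fPair
  refine bdd_exIn hp (bdd_exIn (by omega) (bdd_and (bdd_allIn (by omega) (bdd_eq (by omega)
    (by omega))) (bdd_and (bdd_mem (by omega) (by omega)) (bdd_and (bdd_allIn (by omega)
    (bdd_or (bdd_eq (by omega) (by omega)) (bdd_eq (by omega) (by omega))))
    (bdd_and (bdd_mem (by omega) (by omega)) (bdd_and (bdd_mem (by omega) (by omega))
    (bdd_allIn (by omega) (bdd_or (bdd_eq (by omega) (by omega))
    (bdd_eq (by omega) (by omega))))))))))

/-- Unlike in `isPair`, all quantifiers are bounded by `p` or by members of `p`; this is what allows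
pairs in instances of separation. -/
theorem pr_iff {p x y : M} : p = pr x y ↔ ∃ u, E u p ∧ ∃ v, E v p ∧
    (∀ z, E z u → z = x) ∧ E x u ∧ (∀ z, E z v → z = x ∨ z = y) ∧ E x v ∧ E y v ∧
    ∀ q, E q p → q = u ∨ q = v := by
  constructor
  · rintro rfl
    exact ⟨upair x x, by simp [pr, mem_upair], upair x y, by simp [pr, mem_upair],
      by simp [mem_upair], by simp [mem_upair], by simp [mem_upair], by simp [mem_upair],
      by simp [mem_upair], by simp [pr, mem_upair]⟩
  · rintro ⟨u, hu, v, hv, h1, h2, h3, h4, h5, h6⟩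
    have eu : u = upair x x := ext' fun z => by
      rw [mem_upair, or_self]; exact ⟨h1 z, by rintro rfl; exact h2⟩
    have ev : v = upair x y := ext' fun z => by
      rw [mem_upair]; exact ⟨h3 z, by rintro (rfl | rfl) <;> assumption⟩
    refine ext' fun z => ?_
    rw [pr, mem_upair, ← eu, ← ev]
    exact ⟨h6 z, by rintro (rfl | rfl) <;> assumption⟩

theorem sat_fPair {n p x y : ℕ} {v : ℕ → M} (hp : p < n) (hx : x < n) (hy : y < n) :
    Sat (fPair p x y) n v ↔ v p = pr (v x) (v y) := by
  rw [pr_iff]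
  simp (disch := omega) only [fPair, sat_exIn, sat_allIn, sat_and, sat_or, sat_mem, sat_eq,
    Function.update_self, Function.update_of_ne]

end Basic

end

/-! ### The type theory of a model: coded types and internal functions -/

section

/-! ### Types coded by sets of a model, and internal functions -/

/-- A type whose elements are named by the members of a set of the model. -/
class Coded (M : Type) [MacModel M] (α : Type) where
  code : α → M
  inj : Function.Injective code
  set : M
  mem_set : ∀ m, E m set ↔ ∃ a, code a = m

variable {M : Type} [MacModel M]

section Relations

variable {α β γ δ : Type} [Coded M α] [Coded M β] [Coded M γ] [Coded M δ]

variable (M) in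
/-- The name of an element of a coded type. -/
def code (a : α) : M := Coded.code a
variable (M) (α) in
/-- The set of all names of elements of a coded type. -/
def cset : M := Coded.set α

theorem mem_cset {m : M} : E m (cset M α) ↔ ∃ a : α, code M a = m := Coded.mem_set m
@[simp] theorem code_inj {a b : α} : code M a = code M b ↔ a = b := Coded.inj.eq_iff

theorem exists_cset {P : M → Prop} : (∃ m, E m (cset M α) ∧ P m) ↔ ∃ a : α, P (code M a) := by
  simp [mem_cset]
theorem forall_cset {P : M → Prop} : (∀ m, E m (cset M α) → P m) ↔ ∀ a : α, P (code M a) := by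
  simp [mem_cset]
@[simp] theorem code_mem {a : α} : E (code M a) (cset M α) := mem_cset.2 ⟨a, rfl⟩

/-- A finite list of parameters as a valuation. -/
def vs (l : List M) : ℕ → M := fun i => l.getD i (emp M)

variable (M) in
/-- A predicate whose extension is a set of the model. -/
def Rl (P : α → Prop) : Prop := ∃ s : M, ∀ a, E (code M a) s ↔ P a

theorem exists_sep (φ : Fm) (l : List M) (h : Bdd φ (l.length + 1)) (A : M) :
    ∃ b, ∀ x, E x b ↔ E x A ∧ Sat φ (l.length + 1) (Function.update (vs l) l.length x) :=
  MacModel.sep φ l.length h (vs l) A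

/-- The gateway from bounded formulas to sets: the parameters in `l` are the variables below
`l.length`, and the element under consideration is variable `l.length`. -/
theorem Rl.of_sat {P : α → Prop} (φ : Fm) (l : List M) (h : Bdd φ (l.length + 1))
    (hP : ∀ a : α, Sat φ (l.length + 1) (Function.update (vs l) l.length (code M a)) ↔ P a) :
    Rl M P := by
  obtain ⟨b, hb⟩ := exists_sep φ l h (cset M α)
  exact ⟨b, fun a => by rw [hb, hP]; simp [code_mem]⟩

theorem Rl.not {P : α → Prop} (h : Rl M P) : Rl M fun a => ¬ P a := by
  obtain ⟨s, hs⟩ := h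
  refine .of_sat (Fm.mem 1 0).neg [s] (bdd_neg (bdd_mem (by simp) (by simp))) fun a => ?_
  simp (disch := simp) [sat_neg, sat_mem, vs, hs]

theorem Rl.and {P Q : α → Prop} (h : Rl M P) (h' : Rl M Q) : Rl M fun a => P a ∧ Q a := by
  obtain ⟨s, hs⟩ := h
  obtain ⟨t, ht⟩ := h'
  refine .of_sat ((Fm.mem 2 0).and (Fm.mem 2 1)) [s, t] (bdd_and (bdd_mem (by simp) (by simp))
    (bdd_mem (by simp) (by simp))) fun a => ?_
  simp (disch := simp) [sat_and, sat_mem, vs, hs, ht]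

/-! #### Products -/

/-- A Kuratowski pair of members of `A ∪ B` is a set of subsets of `A ∪ B`, so the product can be
separated from the double power set. -/
theorem exists_prod (A B : M) : ∃ c, ∀ p, E p c ↔ ∃ x, E x A ∧ ∃ y, E y B ∧ p = pr x y := by
  obtain ⟨c, hc⟩ := exists_sep (Fm.exIn 0 fun x => Fm.exIn 1 fun y => fPair 2 x y) [A, B]
    (bdd_exIn (by simp) (bdd_exIn (by simp) (bdd_fPair (by simp) (by simp) (by simp))))
    (pow (pow (cup A B)))
  refine ⟨c, fun p => ?_⟩
  rw [hc]
  simp (disch := simp) only [sat_exIn, sat_fPair, List.length_cons, List.length_nil,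
    Function.update_self, Function.update_of_ne]
  simp only [vs, List.getD_cons_zero, List.getD_cons_succ]
  refine ⟨fun h => h.2, fun h => ⟨?_, h⟩⟩
  obtain ⟨x, hx, y, hy, rfl⟩ := h
  simp only [mem_pow, pr, mem_upair, mem_cup]
  grind [mem_upair]

instance : Coded M (α × β) where
  code p := pr (code M p.1) (code M p.2)
  inj := by
    rintro ⟨a, b⟩ ⟨c, d⟩ h
    simpa using h
  set := (exists_prod (cset M α) (cset M β)).choose
  mem_set m := by
    rw [(exists_prod (cset M α) (cset M β)).choose_spec]
    simp only [exists_cset, Prod.exists]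
    grind

theorem code_pair {a : α} {b : β} : code M (a, b) = pr (code M a) (code M b) := rfl

variable (M) in
/-- A function whose graph is a set of the model. -/
@[fun_prop]
def Internal (f : α → β) : Prop := Rl M fun p : α × β => f p.1 = p.2

/-- Since `cset M β` is a set, it serves as the bound: quantification over any coded type, however
large, stays within bounded separation. -/
theorem Rl.exists {P : α → β → Prop} (h : Rl M fun p : α × β => P p.1 p.2) :
    Rl M fun a => ∃ b, P a b := by
  obtain ⟨s, hs⟩ := h
  refine .of_sat (Fm.exIn 0 fun y => Fm.exIn 1 fun p => fPair p 2 y) [cset M β, s]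
    (bdd_exIn (by simp) (bdd_exIn (by simp) (bdd_fPair (by simp) (by simp) (by simp))))
    fun a => ?_
  simp (disch := simp) [sat_exIn, sat_fPair, vs]
  simp [exists_cset, ← code_pair, hs]

theorem Rl.diag : Rl M fun p : α × α => p.1 = p.2 := by
  refine .of_sat (Fm.exIn 0 fun x => fPair 1 x x) [cset M α] (bdd_exIn (by simp)
    (bdd_fPair (by simp) (by simp) (by simp))) fun a => ?_
  simp (disch := simp) [sat_exIn, sat_fPair, vs]
  simp [exists_cset, ← code_pair, Prod.ext_iff, eq_comm]

theorem Internal.id : Internal M fun a : α => a := Rl.diag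

theorem Internal.fst' : Internal M (Prod.fst : α × β → α) := by
  refine Rl.of_sat (Fm.exIn 0 fun x => Fm.exIn 1 fun y => Fm.exIn 2 fun p =>
    (fPair p x y).and (fPair 3 p x)) [cset M α, cset M β, cset M (α × β)] (bdd_exIn (by simp)
    (bdd_exIn (by simp) (bdd_exIn (by simp) (bdd_and (bdd_fPair (by simp) (by simp) (by simp))
    (bdd_fPair (by simp) (by simp) (by simp)))))) fun a => ?_
  simp (disch := simp) [sat_exIn, sat_fPair, vs, sat_and]
  simp only [exists_cset, ← code_pair, code_inj]
  simp [Prod.ext_iff, eq_comm]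

theorem Internal.snd' : Internal M (Prod.snd : α × β → β) := by
  refine Rl.of_sat (Fm.exIn 0 fun x => Fm.exIn 1 fun y => Fm.exIn 2 fun p =>
    (fPair p x y).and (fPair 3 p y)) [cset M α, cset M β, cset M (α × β)] (bdd_exIn (by simp)
    (bdd_exIn (by simp) (bdd_exIn (by simp) (bdd_and (bdd_fPair (by simp) (by simp) (by simp))
    (bdd_fPair (by simp) (by simp) (by simp)))))) fun a => ?_
  simp (disch := simp) [sat_exIn, sat_fPair, vs, sat_and]
  simp only [exists_cset, ← code_pair, code_inj]
  simp [Prod.ext_iff, eq_comm]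

@[fun_prop]
theorem Internal.pair {f : α → β} {g : α → γ} (hf : Internal M f) (hg : Internal M g) :
    Internal M fun a => (f a, g a) := by
  obtain ⟨s, hs⟩ := hf
  obtain ⟨t, ht⟩ := hg
  refine Rl.of_sat (Fm.exIn 0 fun x => Fm.exIn 1 fun y => Fm.exIn 2 fun z => Fm.exIn 3 fun r =>
    Fm.exIn 4 fun p => Fm.exIn 5 fun q =>
    (fPair p x y).and ((fPair q x z).and ((fPair r y z).and (fPair 6 x r))))
    [cset M α, cset M β, cset M γ, cset M (β × γ), s, t] (bdd_exIn (by simp)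
    (bdd_exIn (by simp) (bdd_exIn (by simp) (bdd_exIn (by simp) (bdd_exIn (by simp)
    (bdd_exIn (by simp) (bdd_and (bdd_fPair (by simp) (by simp) (by simp))
    (bdd_and (bdd_fPair (by simp) (by simp) (by simp))
    (bdd_and (bdd_fPair (by simp) (by simp) (by simp))
    (bdd_fPair (by simp) (by simp) (by simp)))))))))))
    fun a => ?_
  simp (disch := simp) [sat_exIn, sat_fPair, vs, sat_and]
  simp only [exists_cset, ← code_pair, code_inj, hs, ht]
  rcases a with ⟨a, b, c⟩
  simp
  grind

@[fun_prop]
theorem Internal.comp {f : β → γ} {g : α → β} (hf : Internal M f) (hg : Internal M g) :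
    Internal M fun a => f (g a) := by
  obtain ⟨s, hs⟩ := hf
  obtain ⟨t, ht⟩ := hg
  refine Rl.of_sat (Fm.exIn 0 fun x => Fm.exIn 1 fun y => Fm.exIn 2 fun z =>
    Fm.exIn 3 fun p => Fm.exIn 4 fun q => (fPair p y z).and ((fPair q x y).and (fPair 5 x z)))
    [cset M α, cset M β, cset M γ, s, t] (bdd_exIn (by simp)
    (bdd_exIn (by simp) (bdd_exIn (by simp) (bdd_exIn (by simp) (bdd_exIn (by simp)
    (bdd_and (bdd_fPair (by simp) (by simp) (by simp))
    (bdd_and (bdd_fPair (by simp) (by simp) (by simp))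
    (bdd_fPair (by simp) (by simp) (by simp))))))))) fun a => ?_
  simp (disch := simp) [sat_exIn, sat_fPair, vs, sat_and]
  simp only [exists_cset, ← code_pair, code_inj, hs, ht]
  rcases a with ⟨a, c⟩
  simp
  grind

@[fun_prop]
theorem Internal.fst {f : α → β × γ} (hf : Internal M f) : Internal M fun x => (f x).1 :=
  Internal.fst'.comp hf

@[fun_prop]
theorem Internal.snd {f : α → β × γ} (hf : Internal M f) : Internal M fun x => (f x).2 :=
  Internal.snd'.comp hf

/-! #### Propositions -/

theorem emp_ne_singleton : emp M ≠ upair (emp M) (emp M) := fun h =>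
  not_mem_emp (z := emp M) (by rw [h, mem_upair]; exact Or.inl h.symm)

/-- Logic is classical, so two truth values suffice. With them predicates become functions between
coded types, and power sets become function types. -/
instance : Coded M Prop where
  code P := if P then upair (emp M) (emp M) else emp M
  inj P Q h := by
    by_cases hP : P <;> by_cases hQ : Q <;> simp_all [emp_ne_singleton, emp_ne_singleton.symm]
  set := upair (emp M) (upair (emp M) (emp M))
  mem_set m := by
    rw [mem_upair]
    constructor
    · rintro (rfl | rfl)
      · exact ⟨False, by simp⟩
      · exact ⟨True, by simp⟩
    · rintro ⟨P, rfl⟩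
      by_cases hP : P <;> simp [hP]

theorem emp_mem_code {P : Prop} : E (emp M) (code M P) ↔ P := by
  change E (emp M) (if P then _ else _) ↔ P
  split_ifs with h <;> simp [h, mem_upair, not_mem_emp]

theorem internal_iff_rl {P : α → Prop} : Internal M P ↔ Rl M P := by
  constructor
  · rintro ⟨g, hg⟩
    refine .of_sat (Fm.exIn 0 fun y => (Fm.mem 1 y).and (Fm.exIn 2 fun p => fPair p 3 y))
      [cset M Prop, emp M, g] (bdd_exIn (by simp) (bdd_and (bdd_mem (by simp) (by simp))
      (bdd_exIn (by simp) (bdd_fPair (by simp) (by simp) (by simp))))) fun a => ?_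
    simp (disch := simp) [sat_exIn, sat_fPair, vs, sat_and, sat_mem]
    simp only [exists_cset, ← code_pair, code_inj, hg, emp_mem_code]
    exact ⟨fun ⟨_, h, e⟩ => e.symm ▸ h, fun h => ⟨_, h, rfl⟩⟩
  · rintro ⟨s, hs⟩
    refine Rl.of_sat (Fm.exIn 0 fun x => Fm.exIn 1 fun y => (fPair 4 x y).and
      ((Fm.mem x 2).iff (Fm.mem 3 y)))
      [cset M α, cset M Prop, s, emp M] (bdd_exIn (by simp) (bdd_exIn (by simp) (bdd_and
      (bdd_fPair (by simp) (by simp) (by simp)) (bdd_iff (bdd_mem (by simp) (by simp))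
      (bdd_mem (by simp) (by simp)))))) fun a => ?_
    simp (disch := simp) [sat_exIn, sat_fPair, vs, sat_and, sat_mem, sat_iff]
    simp only [exists_cset, ← code_pair, code_inj, hs, emp_mem_code]
    rcases a with ⟨a, Q⟩
    simp
    exact ⟨fun ⟨_, h, e⟩ => e.trans h.symm, fun h => ⟨_, Iff.rfl, h⟩⟩

theorem Internal.of_graph {f : α → β} (h : Internal M fun p : α × β => f p.1 = p.2) :
    Internal M f := internal_iff_rl.1 h

@[fun_prop]
theorem Internal.not {P : α → Prop} (h : Internal M P) : Internal M fun a => ¬ P a := by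
  rw [internal_iff_rl] at *
  exact h.not

@[fun_prop]
theorem Internal.and {P Q : α → Prop} (h : Internal M P) (h' : Internal M Q) :
    Internal M fun a => P a ∧ Q a := by
  rw [internal_iff_rl] at *
  exact h.and h'

@[fun_prop]
theorem Internal.or {P Q : α → Prop} (h : Internal M P) (h' : Internal M Q) :
    Internal M fun a => P a ∨ Q a := by
  have := (h.not.and h'.not).not
  simpa only [not_and_or, not_not] using this

@[fun_prop]
theorem Internal.iff {P Q : α → Prop} (h : Internal M P) (h' : Internal M Q) :
    Internal M fun a => P a ↔ Q a := by
  have : (fun a => P a ↔ Q a) = fun a => (P a ∧ Q a) ∨ (¬ P a ∧ ¬ Q a) := by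
    funext a; exact propext (by tauto)
  rw [this]
  exact (h.and h').or (h.not.and h'.not)

@[fun_prop]
theorem Internal.ex {P : α → β → Prop} (h : Internal M fun p : α × β => P p.1 p.2) :
    Internal M fun a => ∃ b, P a b := by
  rw [internal_iff_rl] at *
  exact h.exists

@[fun_prop]
theorem Internal.eq {f g : α → β} (hf : Internal M f) (hg : Internal M g) :
    Internal M fun a => f a = g a := by
  have h : Internal M fun p : β × β => p.1 = p.2 := internal_iff_rl.2 Rl.diag
  exact h.comp (hf.pair hg)

theorem exists_const_graph (b : β) : ∃ s, ∀ a : α × β, E (code M a) s ↔ b = a.2 := by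
  refine Rl.of_sat (Fm.exIn 0 fun x => fPair 2 x 1) [cset M α, code M b] (bdd_exIn (by simp)
    (bdd_fPair (by simp) (by simp) (by simp))) fun a => ?_
  simp (disch := simp) [sat_exIn, sat_fPair, vs, sat_and, sat_mem, sat_iff]
  simp only [exists_cset, ← code_pair, code_inj]
  rcases a with ⟨a, Q⟩
  simp
  grind

attribute [fun_prop] Internal.id

@[fun_prop]
theorem Internal.const (b : β) : Internal M fun _ : α => b := exists_const_graph b

/-- Universal quantification as a function on predicates. -/
def All {α : Type} (P : α → Prop) : Prop := ∀ x, P x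

theorem forall_eq_All {α : Type} (P : α → Prop) : (∀ x, P x) = All P := rfl

theorem imp_eq_or (p q : Prop) : (p → q) = (¬ p ∨ q) := propext (by tauto)

@[fun_prop]
theorem Internal.all {P : α → β → Prop} (h : Internal M fun p : α × β => P p.1 p.2) :
    Internal M fun a => All (P a) := by
  have := (Internal.ex (P := fun a b => ¬ P a b) h.not).not
  simpa [All] using this

@[fun_prop]
theorem Internal.ite {P : α → Prop} {f g : α → β} [∀ a, Decidable (P a)] (hP : Internal M P)
    (hf : Internal M f) (hg : Internal M g) : Internal M fun a => if P a then f a else g a := by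
  refine .of_graph ?_
  have : (fun p : α × β => (if P p.1 then f p.1 else g p.1) = p.2) =
      fun p => (P p.1 ∧ f p.1 = p.2) ∨ (¬ P p.1 ∧ g p.1 = p.2) := by
    funext p; split_ifs with h <;> simp [h]
  rw [this]
  fun_prop

end Relations

/-! ### Internal function types -/

/-- Proves that functions and predicates built from internal ones are internal. -/
theorem internal {α β : Type} [Coded M α] [Coded M β] {f : α → β}
    (h : Internal M f := by (try simp only [forall_eq_All, imp_eq_or]); fun_prop) :
    Internal M f := h

/-- Internal functions. -/
structure IFun (M : Type) [MacModel M] (α β : Type) [Coded M α] [Coded M β] where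
  toFun : α → β
  internal : Internal M toFun

/-- Internal subsets. -/
abbrev ISet (M : Type) [MacModel M] (α : Type) [Coded M α] : Type := IFun M α Prop

section IFun

variable {α β γ δ : Type} [Coded M α] [Coded M β] [Coded M γ] [Coded M δ]

instance : FunLike (IFun M α β) α β where
  coe f := f.toFun
  coe_injective := by rintro ⟨f, _⟩ ⟨g, _⟩ h; congr

@[simp] theorem IFun.mk_apply {f : α → β} {h : Internal M f} {a : α} : (IFun.mk f h) a = f a := rfl

@[ext] theorem IFun.ext {f g : IFun M α β} (h : ∀ a, f a = g a) : f = g := DFunLike.ext _ _ h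

theorem IFun.int (f : IFun M α β) : Internal M fun a => f a := f.internal

theorem exists_graph (f : IFun M α β) :
    ∃ s : M, ∀ m, E m s ↔ ∃ a, m = pr (code M a) (code M (f a)) := by
  obtain ⟨g, hg⟩ := f.internal
  obtain ⟨b, hb⟩ := exists_sep (Fm.mem 1 0) [g] (bdd_mem (by simp) (by simp)) (cset M (α × β))
  refine ⟨b, fun m => ?_⟩
  rw [hb, mem_cset]
  simp (disch := simp) [sat_mem, vs]
  constructor
  · rintro ⟨⟨a, b, rfl⟩, h⟩
    rw [hg] at h
    exact ⟨a, by rw [code_pair]; exact congrArg (pr _) (congrArg _ h.symm)⟩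
  · rintro ⟨a, rfl⟩
    refine ⟨⟨_, _, rfl⟩, ?_⟩
    rw [← code_pair, hg]
    rfl

/-- The graph of an internal function. -/
def IFun.graph (f : IFun M α β) : M := (exists_graph f).choose

theorem IFun.mem_graph {f : IFun M α β} {m : M} :
    E m f.graph ↔ ∃ a, m = pr (code M a) (code M (f a)) := (exists_graph f).choose_spec m

theorem IFun.code_mem_graph {f : IFun M α β} {a : α} {b : β} :
    E (pr (code M a) (code M b)) f.graph ↔ f a = b := by
  rw [mem_graph]
  simp only [pr_inj, code_inj]
  grind

theorem IFun.code_mem_graph' {f : IFun M α β} {p : α × β} :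
    E (code M p) f.graph ↔ f p.1 = p.2 := IFun.code_mem_graph

theorem IFun.graph_inj {f g : IFun M α β} : f.graph = g.graph ↔ f = g := by
  refine ⟨fun h => IFun.ext fun a => ?_, fun h => h ▸ rfl⟩
  rw [← IFun.code_mem_graph, h, IFun.code_mem_graph]

/-- A set that is the graph of a function between coded types is the graph of an internal function. -/
theorem exists_graph_eq {h : M} (h1 : ∀ m, E m h → ∃ p : α × β, code M p = m)
    (h2 : ∀ a : α, ∃ b : β, E (code M (a, b)) h ∧ ∀ c : β, E (code M (a, c)) h → c = b) :
    ∃ f : IFun M α β, f.graph = h := by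
  choose f hf hu using h2
  have key : ∀ a b, f a = b ↔ E (code M (a, b)) h :=
    fun a b => ⟨fun e => e ▸ hf a, fun e => (hu a b e).symm⟩
  have hi : Internal M f := ⟨h, fun p => (key _ _).symm⟩
  refine ⟨⟨f, hi⟩, ext' fun m => ?_⟩
  · rw [IFun.mem_graph]
    constructor
    · rintro ⟨a, rfl⟩
      exact (key a _).1 rfl
    · intro hm
      obtain ⟨⟨a, b⟩, rfl⟩ := h1 m hm
      refine ⟨a, ?_⟩
      rw [IFun.mk_apply, (key a b).2 hm]
      rfl

/-- Being a functional relation is a bounded condition on a member of the power set of `α × β`,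
because the quantifiers range over the sets of codes of `α` and `β`. -/
theorem exists_exp : ∃ s : M, ∀ h, E h s ↔ ∃ f : IFun M α β, f.graph = h := by
  obtain ⟨b, hb⟩ := exists_sep (Fm.allIn 0 fun x => Fm.exIn 1 fun y =>
    (Fm.exIn 3 fun p => fPair p x y) |>.and <| Fm.allIn 1 fun z =>
      (Fm.exIn 3 fun p => fPair p x z).imp (Fm.eq z y))
    [cset M α, cset M β, cset M (α × β)] (bdd_allIn (by simp) (bdd_exIn (by simp) (bdd_and
      (bdd_exIn (by simp) (bdd_fPair (by simp) (by simp) (by simp))) (bdd_allIn (by simp)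
      (bdd_imp (bdd_exIn (by simp) (bdd_fPair (by simp) (by simp) (by simp)))
      (bdd_eq (by simp) (by simp))))))) (pow (cset M (α × β)))
  refine ⟨b, fun h => ?_⟩
  rw [hb]
  simp (disch := simp) [sat_exIn, sat_fPair, vs, sat_and, sat_mem, sat_imp, sat_allIn, sat_eq]
  simp only [exists_cset, forall_cset, ← code_pair, code_inj, mem_pow]
  simp only [mem_cset]
  constructor
  · rintro ⟨h1, h2⟩
    exact exists_graph_eq (fun m hm => h1 m hm) h2
  · rintro ⟨f, rfl⟩
    simp only [IFun.code_mem_graph']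
    simp only [IFun.mem_graph]
    refine ⟨?_, fun a => ⟨f a, rfl, fun c hc => hc.symm⟩⟩
    rintro _ ⟨a, rfl⟩
    exact ⟨(a, f a), rfl⟩

instance : Coded M (IFun M α β) where
  code := IFun.graph
  inj _ _ h := IFun.graph_inj.1 h
  set := exists_exp.choose
  mem_set := (exists_exp (M := M) (α := α) (β := β)).choose_spec

theorem mem_code_ifun {f : IFun M α β} {p : α × β} :
    E (code M p) (code M f) ↔ f p.1 = p.2 := IFun.code_mem_graph

theorem Internal.eval : Internal M fun p : IFun M β γ × β => p.1 p.2 := by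
  refine Rl.of_sat (Fm.exIn 0 fun f => Fm.exIn 1 fun x => Fm.exIn 2 fun z => Fm.exIn 3 fun r =>
    (fPair r f x).and <| (fPair 4 r z).and <| Fm.exIn f fun p => fPair p x z)
    [cset M (IFun M β γ), cset M β, cset M γ, cset M (IFun M β γ × β)]
    (bdd_exIn (by simp) (bdd_exIn (by simp) (bdd_exIn (by simp) (bdd_exIn (by simp)
    (bdd_and (bdd_fPair (by simp) (by simp) (by simp)) (bdd_and
    (bdd_fPair (by simp) (by simp) (by simp)) (bdd_exIn (by simp)
    (bdd_fPair (by simp) (by simp) (by simp))))))))) fun a => ?_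
  simp (disch := simp) [sat_exIn, sat_fPair, vs, sat_and]
  simp only [exists_cset, ← code_pair, code_inj, mem_code_ifun]
  rcases a with ⟨⟨f, b⟩, c⟩
  simp
  grind

@[fun_prop]
theorem Internal.app {f : α → IFun M β γ} {g : α → β} (hf : Internal M f) (hg : Internal M g) :
    Internal M fun a => (f a) (g a) := Internal.eval.comp (hf.pair hg)

@[fun_prop]
-- Currying. Equality with a given internal function is a pointwise statement, hence internal; so
-- operations that produce functions or subsets can themselves be internal.
theorem Internal.mk {f : α → β → γ} (hf : Internal M fun p : α × β => f p.1 p.2)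
    (h : ∀ a, Internal M (f a)) : Internal M fun a => IFun.mk (f a) (h a) := by
  refine .of_graph ?_
  have : (fun p : α × IFun M β γ => IFun.mk (f p.1) (h p.1) = p.2) =
      fun p => ∀ b, f p.1 b = p.2 b := by
    funext p
    exact propext ⟨fun e b => e ▸ rfl, fun e => IFun.ext e⟩
  rw [this]
  exact internal

/-- Unique choice: the value is determined by `R`, so the graph of the function is the extension of
`R`, which is a set. The axiom of choice of the model is not involved. -/
theorem exists_ifun {R : α → β → Prop} (hR : Internal M fun p : α × β => R p.1 p.2)
    (h : ∀ a, ∃! b, R a b) : ∃ f : IFun M α β, ∀ a b, f a = b ↔ R a b := by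
  choose f hf hu using h
  have key : ∀ a b, f a = b ↔ R a b := fun a b => ⟨fun e => e ▸ hf a, fun e => (hu a b e).symm⟩
  refine ⟨⟨f, .of_graph ?_⟩, key⟩
  simpa only [key] using hR

end IFun

/-! ### Subtypes and sets of the model as types -/

section Sub

variable {α β γ δ : Type} [Coded M α] [Coded M β] [Coded M γ] [Coded M δ]

/-- The elements of an internal subset. -/
@[ext]
structure Sub (S : ISet M α) where
  val : α
  mem : S val

theorem exists_sub (S : ISet M α) : ∃ s : M, ∀ m, E m s ↔ ∃ a, S a ∧ code M a = m := by
  obtain ⟨s, hs⟩ := internal_iff_rl.1 S.int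
  obtain ⟨b, hb⟩ := exists_sep (Fm.mem 1 0) [s] (bdd_mem (by simp) (by simp)) (cset M α)
  refine ⟨b, fun m => ?_⟩
  rw [hb, mem_cset]
  simp (disch := simp) [sat_mem, vs]
  constructor
  · rintro ⟨⟨a, rfl⟩, h⟩
    exact ⟨a, (hs a).1 h, rfl⟩
  · rintro ⟨a, h, rfl⟩
    exact ⟨⟨a, rfl⟩, (hs a).2 h⟩

instance (S : ISet M α) : Coded M (Sub S) where
  code x := code M x.val
  inj x y h := Sub.ext (by simpa using h)
  set := (exists_sub S).choose
  mem_set m := by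
    rw [(exists_sub S).choose_spec]
    exact ⟨fun ⟨a, h, e⟩ => ⟨⟨a, h⟩, e⟩, fun ⟨x, e⟩ => ⟨x.1, x.2, e⟩⟩

/-- A function with the same graph, up to codes, as an internal function is internal. -/
theorem Internal.of_code {f : α → β} {g : γ → δ} (hf : Internal M f)
    (h : ∀ (c : γ) (d : δ), ∃ a b, code M a = code M c ∧ code M b = code M d ∧
      (g c = d ↔ f a = b)) : Internal M g := by
  obtain ⟨s, hs⟩ := hf
  refine ⟨s, fun p => ?_⟩
  obtain ⟨a, b, ha, hb, e⟩ := h p.1 p.2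
  rw [← Prod.mk.eta (p := p), code_pair, ← ha, ← hb, ← code_pair, hs]
  exact e.symm

theorem Internal.val' {S : ISet M α} : Internal M (Sub.val : Sub S → α) :=
  Internal.id.of_code fun c d => ⟨c.val, d, rfl, rfl, Iff.rfl⟩

@[fun_prop]
theorem Internal.val {S : ISet M β} {f : α → Sub S} (hf : Internal M f) :
    Internal M fun a => (f a).val := Internal.val'.comp hf

@[fun_prop]
theorem Internal.subMk {S : ISet M β} {f : α → β} (hf : Internal M f) (h : ∀ a, S (f a)) :
    Internal M fun a => Sub.mk (f a) (h a) :=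
  hf.of_code fun c d => ⟨c, d.val, rfl, rfl, by rw [Sub.ext_iff]⟩

/-- The members of a set of the model. -/
@[ext]
structure Mem (s : M) where
  val : M
  mem : E val s

instance (s : M) : Coded M (Mem s) where
  code := Mem.val
  inj _ _ := Mem.ext
  set := s
  mem_set _ := ⟨fun h => ⟨⟨_, h⟩, rfl⟩, fun ⟨x, h⟩ => h ▸ x.2⟩

theorem internal_of_set {P : α → Prop} {s : M} (h : ∀ a, E (code M a) s ↔ P a) : Internal M P :=
  internal_iff_rl.2 ⟨s, h⟩

theorem internal_mem : Internal M fun p : α × β => E (code M p.1) (code M p.2) := by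
  rw [internal_iff_rl]
  refine .of_sat (Fm.exIn 0 fun x => Fm.exIn 1 fun y => (fPair 2 x y).and (Fm.mem x y))
    [cset M α, cset M β] (bdd_exIn (by simp) (bdd_exIn (by simp) (bdd_and
    (bdd_fPair (by simp) (by simp) (by simp)) (bdd_mem (by simp) (by simp))))) fun a => ?_
  simp (disch := simp) [sat_exIn, sat_fPair, vs, sat_and, sat_mem]
  simp only [exists_cset, ← code_pair, code_inj]
  rcases a with ⟨a, b⟩
  simp

/-- Choice for internal relations. -/
theorem exists_choice {R : α → β → Prop} (hR : Internal M fun p : α × β => R p.1 p.2)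
    (h : ∀ a, ∃ b, R a b) : ∃ f : IFun M α β, ∀ a, R a (f a) := by
  obtain ⟨r, hr⟩ := internal_iff_rl.1 hR
  -- The choice axiom speaks of disjoint families. `F` collects the fibres `{a} × {b | R a b}`,
  -- which are disjoint because of the first coordinate; it is separated from a power set, so no
  -- replacement is needed.
  obtain ⟨F, hF⟩ := exists_sep (Fm.exIn 0 fun x => Fm.allIn 1 fun p =>
    (Fm.mem p 4).iff ((Fm.mem p 2).and (Fm.exIn 3 fun y => fPair p x y)))
    [cset M α, cset M (α × β), r, cset M β] (bdd_exIn (by simp) (bdd_allIn (by simp) (bdd_iff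
      (bdd_mem (by simp) (by simp)) (bdd_and (bdd_mem (by simp) (by simp)) (bdd_exIn (by simp)
      (bdd_fPair (by simp) (by simp) (by simp))))))) (pow (cset M (α × β)))
  replace hF : ∀ h, E h F ↔ (∀ m, E m h → E m (cset M (α × β))) ∧
      ∃ a : α, ∀ p : α × β, E (code M p) h ↔ R p.1 p.2 ∧ p.1 = a := by
    intro h
    rw [hF]
    simp (disch := simp) [sat_exIn, sat_fPair, vs, sat_and, sat_mem, sat_imp, sat_allIn, sat_iff]
    simp only [exists_cset, forall_cset, ← code_pair, code_inj, mem_pow, hr]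
    simp [Prod.ext_iff]
  have fib : ∀ a, ∃ h, E h F ∧ ∀ m, E m h ↔ ∃ b, R a b ∧ m = code M (a, b) := by
    intro a
    obtain ⟨h, hh⟩ := exists_sub (M := M)
      (⟨fun p : α × β => R p.1 p.2 ∧ p.1 = a, by fun_prop⟩ : ISet M (α × β))
    refine ⟨h, (hF h).2 ⟨?_, a, fun p => ?_⟩, fun m => ?_⟩
    · rintro m hm
      obtain ⟨p, _, rfl⟩ := (hh m).1 hm
      exact code_mem
    · rw [hh]
      simp only [code_inj, exists_eq_right]
      rfl
    · rw [hh]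
      constructor
      · rintro ⟨⟨_, b⟩, ⟨hb, rfl⟩, rfl⟩
        exact ⟨b, hb, rfl⟩
      · rintro ⟨b, hb, rfl⟩
        exact ⟨(a, b), ⟨hb, rfl⟩, rfl⟩
  have ne : ∀ h, E h F → ∃ m, E m h := by
    intro h' hh
    obtain ⟨h1, a, ha⟩ := (hF h').1 hh
    obtain ⟨b, hb⟩ := h a
    exact ⟨_, (ha (a, b)).2 ⟨hb, rfl⟩⟩
  have disj : ∀ h, E h F → ∀ k, E k F → (∃ u, E u h ∧ E u k) → h = k := by
    rintro h hh k hk ⟨u, hu, hu'⟩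
    obtain ⟨h1, a, ha⟩ := (hF h).1 hh
    obtain ⟨h2, b, hb⟩ := (hF k).1 hk
    obtain ⟨p, rfl⟩ := mem_cset.1 (h1 u hu)
    have e : a = b := by rw [← ((ha p).1 hu).2, ← ((hb p).1 hu').2]
    subst e
    refine ext' fun m => ⟨fun hm => ?_, fun hm => ?_⟩
    · obtain ⟨q, rfl⟩ := mem_cset.1 (h1 m hm)
      exact (hb q).2 ((ha q).1 hm)
    · obtain ⟨q, rfl⟩ := mem_cset.1 (h2 m hm)
      exact (ha q).2 ((hb q).1 hm)
  obtain ⟨c, hc⟩ := MacModel.choice F ne disj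
  have hS : Internal M fun p : α × β => E (code M p) c := internal_of_set fun _ => Iff.rfl
  -- The set `c` has exactly one point in each fibre and so cuts `R` down to a function.
  obtain ⟨f, hf⟩ := exists_ifun (R := fun a b => R a b ∧ E (code M (a, b)) c)
    (hR.and hS) fun a => by
      obtain ⟨h, hh, hm⟩ := fib a
      obtain ⟨u, hu, huc, hv⟩ := hc h hh
      obtain ⟨b, hb, rfl⟩ := (hm u).1 hu
      refine ⟨b, ⟨hb, huc⟩, fun b' hb' => ?_⟩
      have := hv _ ((hm _).2 ⟨b', hb'.1, rfl⟩) hb'.2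
      simpa using this
  exact ⟨f, fun a => ((hf a _).1 rfl).1⟩

end Sub

end

/-! ### Arithmetic and order on the natural numbers of the model -/

section

/-! ### The internal natural numbers -/

variable {M : Type} [MacModel M]

variable (M) in
/-- The natural numbers of the model. -/
def Nn : Type := Mem (MacModel.om : M)

namespace Nn

instance : Coded M (Nn M) := inferInstanceAs (Coded M (Mem MacModel.om))

def val (n : Nn M) : M := Mem.val n
theorem val_mem (n : Nn M) : E n.val MacModel.om := n.2
@[simp] theorem val_inj {a b : Nn M} : a.val = b.val ↔ a = b := Mem.ext_iff.symm
theorem code_nn {n : Nn M} : code M n = n.val := rfl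

instance : Zero (Nn M) := ⟨⟨emp M, emp_mem_om⟩⟩

/-- The successor `n ∪ {n}`. -/
def succ (n : Nn M) : Nn M :=
  ⟨(MacModel.om_succ n.val n.2).choose, (MacModel.om_succ n.val n.2).choose_spec.1⟩

theorem mem_succ {n : Nn M} {z : M} : E z n.succ.val ↔ E z n.val ∨ z = n.val :=
  (MacModel.om_succ n.val n.2).choose_spec.2 z

/-- `om` is least only among the inductive sets of the model and may contain nonstandard numbers.
Therefore every induction on `Nn M` requires an internal predicate. -/
theorem induction_rl {P : Nn M → Prop} (hP : Rl M P) (h0 : P 0) (hs : ∀ n, P n → P n.succ)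
    (n : Nn M) : P n := by
  obtain ⟨s, hs'⟩ := exists_sub (⟨P, internal_iff_rl.2 hP⟩ : ISet M (Nn M))
  have := MacModel.om_ind s ⟨emp M, (hs' _).2 ⟨0, h0, rfl⟩, fun _ => not_mem_emp⟩
    (fun y hy => by
      obtain ⟨n, hn, rfl⟩ := (hs' y).1 hy
      exact ⟨n.succ.val, (hs' _).2 ⟨n.succ, hs n hn, rfl⟩, fun z => mem_succ⟩) n.val n.2
  obtain ⟨m, hm, e⟩ := (hs' _).1 this
  have : m = n := val_inj.1 e
  exact this ▸ hm

theorem induction {P : Nn M → Prop} (hP : Internal M P) (h0 : P 0) (hs : ∀ n, P n → P n.succ)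
    (n : Nn M) : P n := induction_rl (internal_iff_rl.1 hP) h0 hs n

theorem mem_om_of_mem (n : Nn M) : ∀ z, E z n.val → E z MacModel.om := by
  refine induction_rl (P := fun n => ∀ z, E z n.val → E z MacModel.om) ?_ ?_ ?_ n
  · refine .of_sat (Fm.allIn 1 fun y => Fm.mem y 0) [MacModel.om] (bdd_allIn (by simp)
      (bdd_mem (by simp) (by simp))) fun a => ?_
    simp (disch := simp) [sat_allIn, sat_mem, vs, code_nn]
  · exact fun z hz => absurd hz not_mem_emp
  · intro n ih z hz
    rcases mem_succ.1 hz with h | rfl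
    · exact ih z h
    · exact n.2

instance : LT (Nn M) := ⟨fun a b => E a.val b.val⟩

theorem lt_def {a b : Nn M} : a < b ↔ E a.val b.val := Iff.rfl

@[fun_prop]
theorem internal_lt {α : Type} [Coded M α] {f g : α → Nn M} (hf : Internal M f)
    (hg : Internal M g) : Internal M fun a => f a < g a :=
  (internal_mem (M := M) (α := Nn M) (β := Nn M)).comp (hf.pair hg)

theorem not_lt_zero' {a : Nn M} : ¬ a < 0 := not_mem_emp

theorem lt_succ_iff' {a b : Nn M} : a < b.succ ↔ a < b ∨ a = b := by
  rw [lt_def, mem_succ, val_inj]; rfl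

theorem lt_trans' {a b c : Nn M} (h : a < b) (h' : b < c) : a < c := by
  have := induction (P := fun c : Nn M => ∀ a b, a < b → b < c → a < c) internal
    (fun a b _ h => absurd h not_lt_zero') (fun c ih a b h h' => by
      rw [lt_succ_iff'] at *
      rcases h' with h' | rfl
      · exact Or.inl (ih a b h h')
      · exact Or.inl h) c
  exact this a b h h'

/-- Induction takes the place of Foundation here. -/
theorem lt_irrefl' (a : Nn M) : ¬ a < a := by
  refine induction (P := fun a : Nn M => ¬ a < a) internal not_lt_zero' (fun a ih h => ?_) a
  rcases lt_succ_iff'.1 h with h | h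
  · exact ih (lt_trans' (lt_succ_iff'.2 (Or.inr rfl)) h)
  · exact ih (by simpa only [h] using lt_succ_iff'.2 (Or.inr (Eq.refl a)))

theorem succ_le_of_lt' {a b : Nn M} (h : a < b) : a.succ < b ∨ a.succ = b := by
  have hs : Internal M (succ : Nn M → Nn M) := by
    refine .of_graph ?_
    have : (fun p : Nn M × Nn M => p.1.succ = p.2) =
        fun p => ∀ z, z < p.2 ↔ z < p.1 ∨ z = p.1 := by
      funext p
      refine propext ⟨fun e z => by rw [← e, lt_succ_iff'], fun e => ?_⟩
      refine val_inj.1 (ext' fun z => ?_)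
      rw [mem_succ]
      constructor
      · rintro (h | rfl)
        · exact (e ⟨z, mem_om_of_mem _ z h⟩).2 (Or.inl h)
        · exact (e p.1).2 (Or.inr rfl)
      · intro h
        rcases (e ⟨z, mem_om_of_mem _ z h⟩).1 h with h | h
        · exact Or.inl h
        · exact Or.inr (congrArg val h)
    rw [this]
    exact internal
  have := induction (P := fun b : Nn M => ∀ a, a < b → a.succ < b ∨ a.succ = b) internal
    (fun a h => absurd h not_lt_zero') (fun b ih a h => by
      rw [lt_succ_iff'] at *
      rcases h with h | rfl
      · exact Or.inl (ih a h)
      · exact Or.inr rfl) b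
  exact this a h

theorem trichotomy' (a b : Nn M) : a < b ∨ a = b ∨ b < a := by
  have h0 : ∀ b : Nn M, 0 = b ∨ 0 < b := induction internal (Or.inl rfl) (fun b ih => by
      rw [lt_succ_iff']; tauto)
  have := induction (P := fun a : Nn M => ∀ b, a < b ∨ a = b ∨ b < a) internal
    (fun b => by have := h0 b; tauto) (fun a ih b => by
      rw [lt_succ_iff']
      rcases ih b with h | h | h
      · have := succ_le_of_lt' h; tauto
      · exact Or.inr (Or.inr (Or.inr h.symm))
      · exact Or.inr (Or.inr (Or.inl h))) a
  exact this b

instance : LinearOrder (Nn M) where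
  le a b := a < b ∨ a = b
  lt a b := a < b
  le_refl a := Or.inr rfl
  le_trans a b c := by
    rintro (h | rfl) (h' | rfl)
    · exact Or.inl (lt_trans' h h')
    · exact Or.inl h
    · exact Or.inl h'
    · exact Or.inr rfl
  le_antisymm a b := by
    rintro (h | rfl) (h' | h')
    · exact absurd (lt_trans' h h') (lt_irrefl' _)
    · exact h'.symm
    · rfl
    · rfl
  lt_iff_le_not_ge a b := by
    constructor
    · intro h
      refine ⟨Or.inl h, ?_⟩
      rintro (h' | rfl)
      · exact lt_irrefl' _ (lt_trans' h h')
      · exact lt_irrefl' _ h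
    · rintro ⟨h | rfl, h'⟩
      · exact h
      · exact absurd (Or.inr rfl) h'
  le_total a b := by have := trichotomy' a b; tauto
  toDecidableLE := Classical.decRel _

theorem lt_succ_iff {a b : Nn M} : a < b.succ ↔ a ≤ b := lt_succ_iff'

theorem succ_le_iff {a b : Nn M} : a.succ ≤ b ↔ a < b :=
  ⟨fun h => lt_of_lt_of_le (lt_succ_iff.2 le_rfl) h, succ_le_of_lt'⟩

theorem lt_succ (a : Nn M) : a < a.succ := lt_succ_iff.2 le_rfl

theorem zero_le (a : Nn M) : 0 ≤ a := not_lt.1 not_lt_zero'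

@[simp] theorem succ_inj {a b : Nn M} : a.succ = b.succ ↔ a = b := by
  refine ⟨fun h => ?_, fun h => h ▸ rfl⟩
  have h1 := lt_succ_iff.1 (h ▸ lt_succ a)
  have h2 := lt_succ_iff.1 (h ▸ lt_succ b)
  exact le_antisymm h1 h2

@[simp] theorem succ_ne_zero {a : Nn M} : a.succ ≠ 0 := fun h =>
  not_lt_zero' (h ▸ lt_succ a)

theorem succ_le_succ {a b : Nn M} : a.succ ≤ b.succ ↔ a ≤ b := by
  rw [succ_le_iff, lt_succ_iff]

@[fun_prop]
theorem internal_le {α : Type} [Coded M α] {f g : α → Nn M} (hf : Internal M f)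
    (hg : Internal M g) : Internal M fun a => f a ≤ g a := (internal_lt hf hg).or (hf.eq hg)

@[fun_prop]
theorem internal_min {α : Type} [Coded M α] {f g : α → Nn M} (hf : Internal M f)
    (hg : Internal M g) : Internal M fun a => min (f a) (g a) := by
  simp only [min_def]
  fun_prop

@[fun_prop]
theorem internal_max {α : Type} [Coded M α] {f g : α → Nn M} (hf : Internal M f)
    (hg : Internal M g) : Internal M fun a => max (f a) (g a) := by
  simp only [max_def]
  fun_prop

@[fun_prop]
theorem internal_succ' : Internal M (succ : Nn M → Nn M) := by
  refine .of_graph ?_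
  have : (fun p : Nn M × Nn M => p.1.succ = p.2) =
      fun p => ∀ z, z < p.2 ↔ z ≤ p.1 := by
    funext p
    refine propext ⟨fun e z => by rw [← e, lt_succ_iff], fun e => ?_⟩
    exact le_antisymm (succ_le_iff.2 ((e _).2 le_rfl))
      (not_lt.1 fun h => lt_irrefl _ (lt_of_lt_of_le (lt_succ p.1) ((e _).1 h)))
  rw [this]
  exact internal

theorem zero_or_succ (a : Nn M) : a = 0 ∨ ∃ b, a = succ b :=
  induction (P := fun a : Nn M => a = 0 ∨ ∃ b, a = succ b) internal (Or.inl rfl)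
    (fun n _ => Or.inr ⟨n, rfl⟩) a

/-- The predecessor, with `pred 0 = 0`. -/
def pred (a : Nn M) : Nn M := if h : ∃ b, a = succ b then h.choose else 0

@[simp] theorem pred_zero : pred (0 : Nn M) = 0 := by
  rw [pred, dif_neg]
  rintro ⟨b, h⟩
  exact succ_ne_zero h.symm

@[simp] theorem pred_succ {a : Nn M} : pred a.succ = a := by
  have h : ∃ b, a.succ = succ b := ⟨a, rfl⟩
  rw [pred, dif_pos h]
  exact (succ_inj.1 h.choose_spec).symm

@[fun_prop]
theorem internal_pred : Internal M (pred : Nn M → Nn M) := by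
  refine .of_graph ?_
  have : (fun p : Nn M × Nn M => p.1.pred = p.2) =
      fun p => (p.1 = 0 ∧ p.2 = 0) ∨ p.1 = p.2.succ := by
    funext ⟨a, b⟩
    refine propext ?_
    rcases zero_or_succ a with rfl | ⟨c, rfl⟩
    · simp [eq_comm, succ_ne_zero.symm]
    · simp
  rw [this]
  exact internal

theorem exists_least {P : Nn M → Prop} (hP : Internal M P) (h : ∃ n, P n) :
    ∃ n, P n ∧ ∀ m < n, ¬ P m := by
  by_contra! hc
  obtain ⟨n, hn⟩ := h
  have : ∀ n : Nn M, ∀ m < n, ¬ P m :=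
    induction internal (fun m h => absurd h not_lt_zero') fun n ih m hm hp => by
      obtain ⟨k, hk, hk'⟩ := hc m hp
      exact ih k (lt_of_lt_of_le hk (lt_succ_iff.1 hm)) hk'
  exact this n.succ n (lt_succ n) hn

/-- The simplices of a prism are filled in descending or ascending order; their number is a number
of the model, possibly nonstandard, so the order has to be run through by internal induction. -/
theorem down_induction {P : Nn M → Prop} (hP : Internal M P) (m : Nn M) (hm : P m)
    (h : ∀ i < m, P i.succ → P i) : P 0 := by
  by_contra h0
  have : ∀ n : Nn M, n ≤ m → ¬ P n :=
    induction internal (fun _ => h0) fun n ih hn hp =>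
      ih ((lt_succ n).le.trans hn) (h n (succ_le_iff.1 hn) hp)
  exact this m le_rfl hm

theorem up_induction {P : Nn M → Prop} (hP : Internal M P) (m : Nn M) (h0 : P 0)
    (h : ∀ i < m, P i → P i.succ) : P m := by
  have : ∀ n : Nn M, n ≤ m → P n :=
    induction internal (fun _ => h0) fun n ih hn =>
      h n (succ_le_iff.1 hn) (ih ((lt_succ n).le.trans hn))
  exact this m le_rfl

end Nn

end

/-! ### Maximal subsets without ordinals -/

section

variable {M : Type} [MacModel M]

/-! ### Zorn's lemma for internal families of subsets -/

section Zorn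

variable {α : Type} [Coded M α]

/-- Inclusion of internal subsets. -/
def Incl (A B : ISet M α) : Prop := ∀ a, A a → B a

theorem Incl.refl (A : ISet M α) : Incl A A := fun _ h => h
theorem Incl.trans {A B C : ISet M α} (h : Incl A B) (h' : Incl B C) : Incl A C :=
  fun a ha => h' a (h a ha)
theorem Incl.antisymm {A B : ISet M α} (h : Incl A B) (h' : Incl B A) : A = B :=
  IFun.ext fun a => propext ⟨h a, h' a⟩

@[fun_prop]
theorem internal_incl {β : Type} [Coded M β] {f g : β → ISet M α} (hf : Internal M f)
    (hg : Internal M g) : Internal M fun b => Incl (f b) (g b) := by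
  unfold Incl
  exact internal

/-- The union of a family, together with a given set. -/
def unionWith (G : ISet M α) (D : ISet M (ISet M α)) : ISet M α :=
  ⟨fun a => G a ∨ ∃ A, D A ∧ A a, by fun_prop⟩

/-- The least family containing the given set that is closed under `s` and unions. -/
def Tower (G : ISet M α) (s : IFun M (ISet M α) (ISet M α)) (A : ISet M α) : Prop :=
  ∀ C : ISet M (ISet M α), (∀ x, C x → C (s x)) →
    (∀ D : ISet M (ISet M α), (∀ x, D x → C x) → C (unionWith G D)) → C A

theorem internal_tower {G : ISet M α} {s : IFun M (ISet M α) (ISet M α)} :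
    Internal M (Tower G s) := by
  unfold Tower unionWith
  exact internal

variable {G : ISet M α} {s : IFun M (ISet M α) (ISet M α)}

theorem Tower.succ {A : ISet M α} (h : Tower G s A) : Tower G s (s A) :=
  fun C h1 h2 => h1 _ (h C h1 h2)

theorem Tower.union {D : ISet M (ISet M α)} (h : ∀ x, D x → Tower G s x) :
    Tower G s (unionWith G D) :=
  fun C h1 h2 => h2 D fun x hx => h x hx C h1 h2

theorem Tower.induction {P : ISet M α → Prop} (hP : Internal M P)
    (hs : ∀ x, Tower G s x → P x → P (s x))
    (hu : ∀ D : ISet M (ISet M α), (∀ x, D x → Tower G s x ∧ P x) → P (unionWith G D))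
    {A : ISet M α} (h : Tower G s A) : P A := by
  have hT : Internal M (Tower G s) := internal_tower
  refine (h ⟨fun x => Tower G s x ∧ P x, by fun_prop⟩ (fun x hx => ⟨hx.1.succ, hs x hx.1 hx.2⟩)
    fun D hD => ⟨Tower.union fun x hx => (hD x hx).1, hu D hD⟩).2

theorem Tower.base_incl (hs : ∀ x, Incl x (s x)) {A : ISet M α} (h : Tower G s A) : Incl G A :=
  h.induction (P := fun A => Incl G A) internal (fun x _ hx => hx.trans (hs x))
    fun _ _ _ ha => Or.inl ha

/-- An element of the tower is extreme if the successor of each smaller one is below it. -/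
def Extreme (G : ISet M α) (s : IFun M (ISet M α) (ISet M α)) (c : ISet M α) : Prop :=
  ∀ x, Tower G s x → Incl x c → x ≠ c → Incl (s x) c

/-- Zermelo's argument: for an extreme `c`, the sets below `c` or above `s c` are closed under `s`
and under unions, so they exhaust the tower. -/
theorem Tower.comparable (hs : ∀ x, Incl x (s x)) {c x : ISet M α} (hc : Tower G s c)
    (he : Extreme G s c) (hx : Tower G s x) : Incl x c ∨ Incl (s c) x := by
  refine hx.induction (P := fun x => Incl x c ∨ Incl (s c) x) internal ?_ ?_
  · rintro y hy (h | h)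
    · by_cases e : y = c
      · exact Or.inr (e ▸ Incl.refl _)
      · exact Or.inl (he y hy h e)
    · exact Or.inr (h.trans (hs y))
  · intro D hD
    by_cases h : ∃ y, D y ∧ Incl (s c) y
    · obtain ⟨y, hy, h⟩ := h
      exact Or.inr fun a ha => Or.inr ⟨y, hy, h a ha⟩
    · refine Or.inl ?_
      rintro a (ha | ⟨y, hy, ha⟩)
      · exact hc.base_incl hs a ha
      · exact ((hD y hy).2.resolve_right fun h' => h ⟨y, hy, h'⟩) a ha

/-- A second induction over the tower, using comparability with the extreme sets already known.
Consequently the tower is a chain. -/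
theorem Tower.extreme (hs : ∀ x, Incl x (s x)) {c : ISet M α} (hc : Tower G s c) :
    Extreme G s c := by
  have hT : Internal M (Tower G s) := internal_tower
  refine hc.induction (P := Extreme G s) (by unfold Extreme; exact internal) ?_ ?_
  · intro d hd he x hx hxd hne
    rcases hd.comparable hs he hx with h | h
    · by_cases e : x = d
      · exact e ▸ Incl.refl _
      · exact (he x hx h e).trans (hs d)
    · exact absurd (hxd.antisymm h) hne
  · intro D hD x hx hxc hne
    by_cases h : ∃ y, D y ∧ ¬ Incl (s y) x
    · obtain ⟨y, hy, h⟩ := h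
      have hyc : Incl y (unionWith G D) := fun a ha => Or.inr ⟨y, hy, ha⟩
      have hxy := ((hD y hy).1.comparable hs (hD y hy).2 hx).resolve_right h
      by_cases e : x = y
      · subst e
        exact (hx.comparable hs (hD x hy).2 (Tower.union fun z hz => (hD z hz).1)).resolve_left
          fun h' => hne (hxc.antisymm h')
      · exact ((hD y hy).2 x hx hxy e).trans hyc
    · push Not at h
      refine absurd (hxc.antisymm ?_) hne
      rintro a (ha | ⟨y, hy, ha⟩)
      · exact hx.base_incl hs a ha
      · exact h y hy a (hs y a ha)

/-- If no maximal set existed, choice would give a map `s` that strictly enlarges each admissible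
set above `G`. The tower of `s` is a chain of admissible sets, its union is again in the tower, and
`s` would enlarge that union. Adding `G` to all unions makes the empty union equal to `G`, the
bottom of the tower. -/
theorem exists_maximal (Φ : ISet M (ISet M α)) (G : ISet M α)
    (hu : ∀ D : ISet M (ISet M α), (∀ A, D A → Φ A ∧ Incl G A) →
      (∀ A B, D A → D B → Incl A B ∨ Incl B A) → Φ (unionWith G D)) :
    ∃ A, Φ A ∧ Incl G A ∧ ∀ B, Φ B → Incl A B → B = A := by
  by_contra! hc
  obtain ⟨s, hs⟩ := exists_choice (M := M) (α := ISet M α) (β := ISet M α)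
    (R := fun A B => (Φ A ∧ Incl G A → Φ B ∧ Incl A B ∧ B ≠ A) ∧ (¬ (Φ A ∧ Incl G A) → B = A))
    internal fun A => by
      by_cases h : Φ A ∧ Incl G A
      · obtain ⟨B, hB⟩ := hc A h.1 h.2
        exact ⟨B, fun _ => hB, fun h' => absurd h h'⟩
      · exact ⟨A, fun h' => absurd h' h, fun _ => rfl⟩
  have hle : ∀ x, Incl x (s x) := fun x => by
    by_cases h : Φ x ∧ Incl G x
    · exact ((hs x).1 h).2.1
    · rw [(hs x).2 h]
      exact Incl.refl x
  have hT : Internal M (Tower G s) := internal_tower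
  have hΦ : ∀ A, Tower G s A → Φ A ∧ Incl G A := fun A hA => by
    refine hA.induction (P := fun A => Φ A ∧ Incl G A) internal ?_ ?_
    · exact fun x _ hx => ⟨((hs x).1 hx).1, hx.2.trans (hle x)⟩
    · intro D hD
      refine ⟨hu D (fun A hA => (hD A hA).2) fun A B hA hB => ?_, fun a ha => Or.inl ha⟩
      rcases (hD B hB).1.comparable hle ((hD B hB).1.extreme hle) (hD A hA).1 with h | h
      · exact Or.inl h
      · exact Or.inr ((hle B).trans h)
  have htop : Tower G s (unionWith G ⟨Tower G s, hT⟩) := Tower.union fun x hx => hx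
  have h1 := (hs _).1 (hΦ _ htop)
  exact h1.2.2 (Incl.antisymm (fun a ha => Or.inr ⟨_, htop.succ, ha⟩) h1.2.1)

end Zorn

end

/-! ### Simplicial sets, standard simplices and cylinders as coded types -/

section

variable {M : Type} [MacModel M]

instance : One (Nn M) := ⟨Nn.succ 0⟩

theorem Nn.one_def : (1 : Nn M) = Nn.succ 0 := rfl

/-! ### The arrows of the simplex category -/

variable (M) in
/-- Pairs `(k, f)` with `f` a monotone function that is constant from `k` onwards. -/
def arrSet : ISet M (Nn M × IFun M (Nn M) (Nn M)) :=
  ⟨fun p => (∀ i j, i ≤ j → p.2 i ≤ p.2 j) ∧ ∀ i, p.2 i = p.2 (min i p.1), internal⟩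

variable (M) in
/-- The arrows `[k] → [m]` of the simplex category, for all `m` at once: monotone functions on the
natural numbers which are constant from `k` onwards. -/
def Arr : Type := Sub (arrSet M)

instance : Coded M (Arr M) := inferInstanceAs (Coded M (Sub (arrSet M)))

namespace Arr

/-- The number `k` with domain `[k]`. -/
def dom (a : Arr M) : Nn M := (Sub.val a).1
/-- The value of an arrow. -/
def ap (a : Arr M) (i : Nn M) : Nn M := (Sub.val a).2 i

instance : CoeFun (Arr M) fun _ => Nn M → Nn M := ⟨ap⟩

theorem internal_val : Internal M fun a : Arr M => Sub.val a := Internal.val' (S := arrSet M)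

@[fun_prop]
theorem internal_dom : Internal M (dom : Arr M → Nn M) := by
  have := internal_val (M := M)
  unfold dom
  fun_prop

@[fun_prop]
theorem internal_ap {α : Type} [Coded M α] {f : α → Arr M} {g : α → Nn M} (hf : Internal M f)
    (hg : Internal M g) : Internal M fun x => (f x) (g x) := by
  have := internal_val (M := M)
  have h : Internal M fun p : Arr M × Nn M => p.1 p.2 := by
    unfold ap
    exact ((this.comp Internal.fst').snd).app Internal.snd'
  exact h.comp (hf.pair hg)

theorem mono (a : Arr M) {i j : Nn M} (h : i ≤ j) : a i ≤ a j := (Sub.mem a).1 i j h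
theorem stable (a : Arr M) (i : Nn M) : a i = a (min i a.dom) := (Sub.mem a).2 i

theorem ext_iff' {a b : Arr M} : a = b ↔ a.dom = b.dom ∧ ∀ i, a i = b i := by
  refine ⟨fun h => h ▸ ⟨rfl, fun _ => rfl⟩, fun ⟨h, h'⟩ => ?_⟩
  exact Sub.ext (Prod.ext h (IFun.ext h'))

theorem ext_le {a b : Arr M} (h : a.dom = b.dom) (h' : ∀ i ≤ a.dom, a i = b i) : a = b := by
  refine ext_iff'.2 ⟨h, fun i => ?_⟩
  rw [a.stable, b.stable, ← h]
  exact h' _ (min_le_right _ _)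

/-- The largest value. -/
def top (a : Arr M) : Nn M := a a.dom

@[fun_prop]
theorem internal_top : Internal M (top : Arr M → Nn M) := by unfold top; fun_prop

theorem le_top (a : Arr M) (i : Nn M) : a i ≤ a.top := by
  rw [a.stable]
  exact a.mono (min_le_right _ _)

/-- The arrow with domain `[k]` given by a function that is monotone on `[k]`. -/
def of (k : Nn M) (g : Nn M → Nn M) (hg : Internal M g)
    (hm : ∀ i j, i ≤ j → j ≤ k → g i ≤ g j) : Arr M :=
  ⟨(k, ⟨fun i => g (min i k), by fun_prop⟩),
    fun i j h => hm _ _ (min_le_min_right _ h) (min_le_right _ _), fun i => by simp⟩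

@[simp] theorem of_dom {k : Nn M} {g : Nn M → Nn M} {hg hm} : (of k g hg hm).dom = k := rfl
theorem of_apply' {k : Nn M} {g : Nn M → Nn M} {hg hm} {i : Nn M} :
    (of k g hg hm) i = g (min i k) := rfl
theorem of_apply {k : Nn M} {g : Nn M → Nn M} {hg hm} {i : Nn M} (h : i ≤ k) :
    (of k g hg hm) i = g i := by rw [of_apply', min_eq_left h]
@[simp] theorem of_top {k : Nn M} {g : Nn M → Nn M} {hg hm} : (of k g hg hm).top = g k :=
  of_apply le_rfl

@[fun_prop]
theorem internal_of {α : Type} [Coded M α] {k : α → Nn M} {g : α → Nn M → Nn M}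
    (hk : Internal M k) (hg : Internal M fun p : α × Nn M => g p.1 p.2)
    (h1 : ∀ a, Internal M (g a)) (h2 : ∀ a i j, i ≤ j → j ≤ k a → g a i ≤ g a j) :
    Internal M fun a => of (k a) (g a) (h1 a) (h2 a) := by
  have h : Internal M fun a => (k a, (⟨fun i => g a (min i (k a)), by fun_prop⟩ : IFun M _ _)) := by
    refine hk.pair (Internal.mk ?_ _)
    exact hg.comp (g := fun p : α × Nn M => (p.1, min p.2 (k p.1))) (by fun_prop)
  exact h.subMk (S := arrSet M) _

/-- Composition of arrows. -/
def comp (a b : Arr M) : Arr M :=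
  ⟨(b.dom, ⟨fun i => a (b i), by fun_prop⟩), fun _ _ h => a.mono (b.mono h),
    fun i => congrArg a.ap (b.stable i)⟩

@[simp] theorem comp_dom {a b : Arr M} : (a.comp b).dom = b.dom := rfl
@[simp] theorem comp_apply {a b : Arr M} {i : Nn M} : (a.comp b) i = a (b i) := rfl
theorem comp_top_le {a b : Arr M} : (a.comp b).top ≤ a.top := a.le_top _
theorem comp_assoc {a b c : Arr M} : (a.comp b).comp c = a.comp (b.comp c) := rfl

@[fun_prop]
theorem internal_comp {α : Type} [Coded M α] {f g : α → Arr M} (hf : Internal M f)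
    (hg : Internal M g) : Internal M fun x => (f x).comp (g x) := by
  have h : Internal M fun x => ((g x).dom,
      (⟨fun i => (f x) ((g x) i), by fun_prop⟩ : IFun M (Nn M) (Nn M))) :=
    (internal_dom.comp hg).pair (Internal.mk (by fun_prop) _)
  exact h.subMk (S := arrSet M) _

variable (M) in
/-- The identity of `[n]`. -/
def id (n : Nn M) : Arr M := of n (fun i => i) (by fun_prop) fun _ _ h _ => h

@[simp] theorem id_dom {n : Nn M} : (id M n).dom = n := rfl
@[simp] theorem id_top {n : Nn M} : (id M n).top = n := of_top
theorem id_apply {n i : Nn M} : (id M n) i = min i n := rfl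

@[fun_prop]
theorem internal_id : Internal M (id M) := by unfold id; fun_prop

theorem id_comp {n : Nn M} {a : Arr M} (h : a.top ≤ n) : (id M n).comp a = a :=
  ext_iff'.2 ⟨rfl, fun i => by simp [id_apply, (a.le_top i).trans h]⟩

theorem comp_id {a : Arr M} : a.comp (id M a.dom) = a :=
  ext_iff'.2 ⟨rfl, fun i => (a.stable i).symm⟩

/-- The constant arrow on `[k]`. -/
def const (k v : Nn M) : Arr M := of k (fun _ => v) (by fun_prop) fun _ _ _ _ => le_rfl

@[simp] theorem const_dom {k v : Nn M} : (const k v).dom = k := rfl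
@[simp] theorem const_top {k v : Nn M} : (const k v).top = v := rfl

@[fun_prop]
theorem internal_const {α : Type} [Coded M α] {f g : α → Nn M} (hf : Internal M f)
    (hg : Internal M g) : Internal M fun x => const (f x) (g x) := by unfold const; fun_prop

@[simp] theorem const_comp {k v : Nn M} {a : Arr M} : (const k v).comp a = const a.dom v := rfl

/-- Replaces an arrow that does not end in `[n]` by the identity of `[n]`. -/
def trunc (n : Nn M) (a : Arr M) : Arr M := if a.top ≤ n then a else id M n

theorem trunc_top_le {n : Nn M} {a : Arr M} : (trunc n a).top ≤ n := by
  unfold trunc; split_ifs with h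
  · exact h
  · simp
theorem trunc_eq {n : Nn M} {a : Arr M} (h : a.top ≤ n) : trunc n a = a := if_pos h

@[fun_prop]
theorem internal_trunc {α : Type} [Coded M α] {f : α → Nn M} {g : α → Arr M} (hf : Internal M f)
    (hg : Internal M g) : Internal M fun x => trunc (f x) (g x) := by unfold trunc; fun_prop

/-- The arrow `a`, thought of as an arrow to `[n]`, lies in the horn `Λ^k[n]`. -/
def InHorn (n k : Nn M) (a : Arr M) : Prop := ∃ i, i ≤ n ∧ i ≠ k ∧ ∀ j, a j ≠ i

@[fun_prop]
theorem internal_inHorn {α : Type} [Coded M α] {f g : α → Nn M} {h : α → Arr M}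
    (hf : Internal M f) (hg : Internal M g) (hh : Internal M h) :
    Internal M fun x => InHorn (f x) (g x) (h x) := by
  unfold InHorn
  exact internal

theorem InHorn.comp {n k : Nn M} {a : Arr M} (h : InHorn n k a) (b : Arr M) :
    InHorn n k (a.comp b) := by
  obtain ⟨i, h1, h2, h3⟩ := h
  exact ⟨i, h1, h2, fun j => h3 _⟩

theorem not_inHorn_id {n k : Nn M} : ¬ InHorn n k (id M n) := by
  rintro ⟨i, h1, _, h3⟩
  exact h3 i (by simp [id_apply, h1])

end Arr

/-! ### Simplicial sets -/

/-- An internal simplicial set, given by the coded type of all its simplices. -/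
class SSet (M : Type) [MacModel M] (X : Type) [Coded M X] where
  dim : X → Nn M
  act : X → Arr M → X
  internal_dim : Internal M dim
  internal_act : Internal M fun p : X × Arr M => act p.1 p.2
  -- The action is total, but an arrow has no codomain of its own: `a.top ≤ dim x` says that `a` can
  -- be read as an arrow to `[dim x]`, and only then is the value meaningful.
  dim_act : ∀ x a, a.top ≤ dim x → dim (act x a) = a.dom
  act_id : ∀ x, act x (Arr.id M (dim x)) = x
  act_act : ∀ x a b, a.top ≤ dim x → b.top ≤ a.dom → act (act x a) b = act x (a.comp b)

variable {X Y Z K F B : Type} [Coded M X] [Coded M Y] [Coded M Z] [Coded M K] [Coded M F]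
  [Coded M B] [SSet M X] [SSet M Y] [SSet M Z] [SSet M K] [SSet M F] [SSet M B]

variable (M) in
/-- The dimension of a simplex. -/
def dim (x : X) : Nn M := SSet.dim x

/-- The action of an arrow on a simplex. -/
def act (x : X) (a : Arr M) : X := SSet.act x a

infixl:70 " ⋆ " => act

@[fun_prop]
theorem internal_dim : Internal M (dim M : X → Nn M) := SSet.internal_dim

@[fun_prop]
theorem internal_act {α : Type} [Coded M α] {f : α → X} {g : α → Arr M} (hf : Internal M f)
    (hg : Internal M g) : Internal M fun z => f z ⋆ g z :=
  (SSet.internal_act (M := M) (X := X)).comp (hf.pair hg)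

theorem dim_act {x : X} {a : Arr M} (h : a.top ≤ dim M x) : dim M (x ⋆ a) = a.dom :=
  SSet.dim_act x a h
theorem act_id (x : X) : x ⋆ Arr.id M (dim M x) = x := SSet.act_id x
theorem act_act {x : X} {a b : Arr M} (h : a.top ≤ dim M x) (h' : b.top ≤ a.dom) :
    (x ⋆ a) ⋆ b = x ⋆ a.comp b := SSet.act_act x a b h h'

variable (M) in
/-- Simplicial maps. -/
structure IsSMap (f : X → Y) : Prop where
  internal : Internal M f
  dim : ∀ x, dim M (f x) = dim M x
  act : ∀ (x : X) (a : Arr M), a.top ≤ MacSet.dim M x → f (x ⋆ a) = f x ⋆ a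

theorem IsSMap.comp {g : Y → Z} {f : X → Y} (hg : IsSMap M g) (hf : IsSMap M f) :
    IsSMap M fun x => g (f x) where
  internal := hg.internal.comp hf.internal
  dim x := by rw [hg.dim, hf.dim]
  act x a h := by rw [hf.act x a h, hg.act _ a (by rwa [hf.dim])]

/-! #### Standard simplices and their subcomplexes -/

/-- A sieve on `[n]`: a subcomplex of the standard simplex. -/
structure Sieve (M : Type) [MacModel M] (n : Nn M) where
  set : ISet M (Arr M)
  top_le : ∀ a, set a → a.top ≤ n
  comp : ∀ a b, set a → b.top ≤ a.dom → set (a.comp b)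

/-- The simplices of a subcomplex of the standard simplex. -/
def Sieve.El {n : Nn M} (S : Sieve M n) : Type := Sub S.set

instance {n : Nn M} (S : Sieve M n) : Coded M S.El := inferInstanceAs (Coded M (Sub S.set))

/-- The arrow belonging to a simplex of a standard simplex. -/
def Sieve.El.arr {n : Nn M} {S : Sieve M n} (x : S.El) : Arr M := Sub.val x

theorem Sieve.El.arr_mem {n : Nn M} {S : Sieve M n} (x : S.El) : S.set x.arr := Sub.mem x

@[ext] theorem Sieve.El.ext {n : Nn M} {S : Sieve M n} {x y : S.El} (h : x.arr = y.arr) :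
    x = y := Sub.ext h

theorem Sieve.internal_arr' {n : Nn M} {S : Sieve M n} : Internal M fun x : S.El => x.arr :=
  Internal.val' (S := S.set)

@[fun_prop]
theorem Sieve.internal_arr {n : Nn M} {S : Sieve M n} {α : Type} [Coded M α] {f : α → S.El}
    (hf : Internal M f) : Internal M fun z => (f z).arr := Sieve.internal_arr'.comp hf

instance {n : Nn M} (S : Sieve M n) : SSet M S.El where
  dim x := x.arr.dom
  -- `trunc` supplies a default value for arrows that do not end in the right object, so that the
  -- action never leaves the sieve.
  act x a := ⟨x.arr.comp (a.trunc x.arr.dom), S.comp _ _ x.arr_mem Arr.trunc_top_le⟩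
  internal_dim := by fun_prop
  internal_act := Internal.subMk (S := S.set) (by fun_prop) _
  dim_act x a h := by
    change (x.arr.comp _).dom = _
    rw [Arr.trunc_eq h]; rfl
  act_id x := Sieve.El.ext (by
    change x.arr.comp _ = _
    rw [Arr.trunc_eq (by simp), Arr.comp_id])
  act_act x a b h h' := Sieve.El.ext (by
    change (x.arr.comp (a.trunc x.arr.dom)).comp
      (b.trunc (x.arr.comp (a.trunc x.arr.dom)).dom) = x.arr.comp ((a.comp b).trunc x.arr.dom)
    rw [Arr.trunc_eq h, Arr.comp_dom, Arr.trunc_eq h', Arr.trunc_eq (Arr.comp_top_le.trans h),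
      Arr.comp_assoc])

theorem Sieve.act_arr {n : Nn M} {S : Sieve M n} (x : S.El) {a : Arr M} (h : a.top ≤ x.arr.dom) :
    (x ⋆ a).arr = x.arr.comp a := congrArg x.arr.comp (Arr.trunc_eq h)

/-- The standard simplex. -/
def std (n : Nn M) : Sieve M n := ⟨⟨fun a => a.top ≤ n, by fun_prop⟩, fun _ h => h,
  fun _ _ h _ => Arr.comp_top_le.trans h⟩

/-- The horn `Λ^k[n]`. -/
def horn (n k : Nn M) : Sieve M n :=
  ⟨⟨fun a => a.top ≤ n ∧ Arr.InHorn n k a, by fun_prop⟩, fun _ h => h.1,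
  fun _ b h _ => ⟨Arr.comp_top_le.trans h.1, h.2.comp b⟩⟩

/-- The Yoneda correspondence: an `n`-simplex is turned into a map from `Δ[n]`, so that fillers
found as simplices can be attached as maps. -/
theorem isSMap_yoneda {n : Nn M} (x : X) (hx : dim M x = n) :
    IsSMap M fun c : (std n).El => x ⋆ c.arr where
  internal := by fun_prop
  dim c := dim_act (by rw [hx]; exact c.arr_mem)
  act c a h := by
    rw [Sieve.act_arr c h, act_act (by rw [hx]; exact c.arr_mem) h]

/-! #### Cylinders -/

variable (M X) in
/-- The simplices of `X × Δ[1]`. -/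
def cylSet : ISet M (X × Arr M) :=
  ⟨fun p => p.2.dom = dim M p.1 ∧ p.2.top ≤ 1, by fun_prop⟩

variable (M X) in
/-- The cylinder `X × Δ[1]`. -/
def Cyl : Type := Sub (cylSet M X)

instance : Coded M (Cyl M X) := inferInstanceAs (Coded M (Sub (cylSet M X)))

namespace Cyl

/-- The simplex of the base. -/
def fst (c : Cyl M X) : X := (Sub.val c).1
/-- The arrow to `[1]`. -/
def snd (c : Cyl M X) : Arr M := (Sub.val c).2

theorem snd_dom (c : Cyl M X) : c.snd.dom = dim M c.fst := (Sub.mem c).1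
theorem snd_top_le (c : Cyl M X) : c.snd.top ≤ 1 := (Sub.mem c).2

/-- A simplex of the cylinder. -/
def mk (x : X) (t : Arr M) (h : t.dom = dim M x) (h' : t.top ≤ 1) : Cyl M X := ⟨(x, t), h, h'⟩

@[simp] theorem mk_fst {x : X} {t : Arr M} {h h'} : (mk x t h h').fst = x := rfl
@[simp] theorem mk_snd {x : X} {t : Arr M} {h h'} : (mk x t h h').snd = t := rfl
@[ext] theorem ext {c d : Cyl M X} (h : c.fst = d.fst) (h' : c.snd = d.snd) : c = d :=
  Sub.ext (Prod.ext h h')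

theorem internal_val : Internal M fun c : Cyl M X => Sub.val c := Internal.val' (S := cylSet M X)

@[fun_prop]
theorem internal_fst : Internal M (fst : Cyl M X → X) := internal_val.fst

@[fun_prop]
theorem internal_snd : Internal M (snd : Cyl M X → Arr M) := internal_val.snd

@[fun_prop]
theorem internal_mk {α : Type} [Coded M α] {f : α → X} {g : α → Arr M} (hf : Internal M f)
    (hg : Internal M g) (h : ∀ z, (g z).dom = dim M (f z)) (h' : ∀ z, (g z).top ≤ 1) :
    Internal M fun z => mk (f z) (g z) (h z) (h' z) :=
  (hf.pair hg).subMk (S := cylSet M X) _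

instance : SSet M (Cyl M X) where
  dim c := dim M c.fst
  act c a := mk (c.fst ⋆ a.trunc (dim M c.fst)) (c.snd.comp (a.trunc (dim M c.fst)))
    (by rw [dim_act Arr.trunc_top_le]; rfl) (Arr.comp_top_le.trans c.snd_top_le)
  internal_dim := by fun_prop
  internal_act := by fun_prop
  dim_act c a h := by rw [mk_fst, Arr.trunc_eq h, dim_act h]
  act_id c := by
    ext1
    · rw [mk_fst, Arr.trunc_eq (by simp), act_id]
    · rw [mk_snd, Arr.trunc_eq (by simp), ← c.snd_dom, Arr.comp_id]
  act_act c a b h h' := by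
    ext1
    · simp only [mk_fst]
      rw [Arr.trunc_eq h, dim_act h, Arr.trunc_eq h', act_act h h',
        Arr.trunc_eq (Arr.comp_top_le.trans h)]
    · simp only [mk_fst, mk_snd]
      rw [Arr.trunc_eq h, dim_act h, Arr.trunc_eq h', Arr.comp_assoc,
        Arr.trunc_eq (Arr.comp_top_le.trans h)]

theorem dim_eq {c : Cyl M X} : MacSet.dim M c = MacSet.dim M c.fst := rfl

theorem act_fst {c : Cyl M X} {a : Arr M} (h : a.top ≤ MacSet.dim M c.fst) :
    (c ⋆ a).fst = c.fst ⋆ a := congrArg (act c.fst) (Arr.trunc_eq h)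

theorem act_snd {c : Cyl M X} {a : Arr M} (h : a.top ≤ MacSet.dim M c.fst) :
    (c ⋆ a).snd = c.snd.comp a := congrArg c.snd.comp (Arr.trunc_eq h)

theorem isSMap_fst : IsSMap M (fst : Cyl M X → X) :=
  ⟨by fun_prop, fun _ => rfl, fun _ _ h => act_fst h⟩

/-- The map of cylinders given by a simplicial map. -/
def map {f : X → Y} (hf : IsSMap M f) (c : Cyl M X) : Cyl M Y :=
  mk (f c.fst) c.snd (by rw [hf.dim, c.snd_dom]) c.snd_top_le

theorem isSMap_map {f : X → Y} (hf : IsSMap M f) : IsSMap M (map hf) where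
  internal := by
    have := hf.internal
    unfold map
    fun_prop
  dim c := hf.dim _
  act c a h := by
    have h2 : a.top ≤ MacSet.dim M (f c.fst) := by rw [hf.dim]; exact h
    ext1
    · simp only [map, mk_fst]
      rw [act_fst h, act_fst h2, mk_fst, hf.act _ _ h]
    · simp only [map, mk_snd]
      rw [act_snd h, act_snd h2, mk_snd]

end Cyl

end

/-! ### Partial maps into Kan complexes and simplices of least dimension -/

section

variable {M : Type} [MacModel M]

variable {X Y Z K F B A : Type} [Coded M X] [Coded M Y] [Coded M Z] [Coded M K] [Coded M F]
  [Coded M B] [Coded M A] [SSet M X] [SSet M Y] [SSet M Z] [SSet M K] [SSet M F] [SSet M B]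
  [SSet M A]

/-! ### Partial simplicial maps -/

/-- The graph of a simplicial map defined on a subcomplex. -/
structure IsPMap (G : ISet M (A × K)) : Prop where
  dim_eq : ∀ e κ, G (e, κ) → dim M e = dim M κ
  act : ∀ e κ (a : Arr M), G (e, κ) → a.top ≤ dim M e → G (e ⋆ a, κ ⋆ a)
  func : ∀ e κ κ', G (e, κ) → G (e, κ') → κ = κ'

theorem isPMap_iff {G : ISet M (A × K)} : IsPMap G ↔
    (∀ e κ, G (e, κ) → dim M e = dim M κ) ∧
    (∀ e κ (a : Arr M), G (e, κ) → a.top ≤ dim M e → G (e ⋆ a, κ ⋆ a)) ∧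
    (∀ e κ κ', G (e, κ) → G (e, κ') → κ = κ') :=
  ⟨fun h => ⟨h.1, h.2, h.3⟩, fun h => ⟨h.1, h.2.1, h.2.2⟩⟩

@[fun_prop]
theorem internal_isPMap {α : Type} [Coded M α] {f : α → ISet M (A × K)} (hf : Internal M f) :
    Internal M fun x => IsPMap (f x) := by
  simp only [isPMap_iff]
  exact internal

/-- The domain of a partial map. -/
def Dom (G : ISet M (A × K)) (e : A) : Prop := ∃ κ, G (e, κ)

@[fun_prop]
theorem internal_dom {α : Type} [Coded M α] {f : α → ISet M (A × K)} {g : α → A}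
    (hf : Internal M f) (hg : Internal M g) : Internal M fun x => Dom (f x) (g x) := by
  unfold Dom; fun_prop

theorem IsPMap.dom_act {G : ISet M (A × K)} (hG : IsPMap G) {e : A} (h : Dom G e) {a : Arr M}
    (ha : a.top ≤ dim M e) : Dom G (e ⋆ a) := by
  obtain ⟨κ, h⟩ := h
  exact ⟨_, hG.act _ _ _ h ha⟩

theorem Incl.dom {G G' : ISet M (A × K)} (h : Incl G G') {e : A} (he : Dom G e) : Dom G' e := by
  obtain ⟨κ, he⟩ := he
  exact ⟨κ, h _ he⟩

/-- Extension of partial maps by Zorn's lemma. -/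
theorem exists_total_extension (R : A → A → Prop) (hR : Internal M fun p : A × A => R p.1 p.2)
    (G : ISet M (A × K)) (hG : IsPMap G) (hGR : ∀ e e', Dom G e → R e e' → Dom G e')
    (step : ∀ H : ISet M (A × K), IsPMap H → Incl G H → (∀ e e', Dom H e → R e e' → Dom H e') →
      (∃ e, ¬ Dom H e) → ∃ H' : ISet M (A × K), IsPMap H' ∧ Incl H H' ∧
        (∀ e e', Dom H' e → R e e' → Dom H' e') ∧ ∃ e, Dom H' e ∧ ¬ Dom H e) :
    ∃ f : A → K, IsSMap M f ∧ ∀ e κ, G (e, κ) → f e = κ := by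
  -- Only partial maps whose domain is closed under `R` compete. In the applications this forces the
  -- domain to be a union of complete pieces (cells, cylinders over simplices), so that the missing
  -- part of a piece is exactly what a horn filler provides.
  obtain ⟨H, hH, hGH, hmax⟩ := exists_maximal (M := M)
    ⟨fun H : ISet M (A × K) => IsPMap H ∧ ∀ e e', Dom H e → R e e' → Dom H e', internal⟩ G
    (fun D hD hchain => by
      have mem : ∀ p, unionWith G D p → p ∈ {p | G p} ∨ ∃ A, D A ∧ A p := fun p h => h
      have common : ∀ p q, unionWith G D p → unionWith G D q → ∃ A : ISet M (A × K),
          IsPMap A ∧ A p ∧ A q := by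
        rintro p q (hp | ⟨A, hA, hp⟩) (hq | ⟨B, hB, hq⟩)
        · exact ⟨G, hG, hp, hq⟩
        · exact ⟨B, (hD B hB).1.1, (hD B hB).2 p hp, hq⟩
        · exact ⟨A, (hD A hA).1.1, hp, (hD A hA).2 q hq⟩
        · rcases hchain A B hA hB with h | h
          · exact ⟨B, (hD B hB).1.1, h _ hp, hq⟩
          · exact ⟨A, (hD A hA).1.1, hp, h _ hq⟩
      refine ⟨⟨fun e κ h => ?_, fun e κ a h ha => ?_, fun e κ κ' h h' => ?_⟩, ?_⟩
      · obtain ⟨A, hA, h, _⟩ := common _ _ h h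
        exact hA.dim_eq _ _ h
      · rcases h with h | ⟨A, hA, h⟩
        · exact Or.inl (hG.act _ _ _ h ha)
        · exact Or.inr ⟨A, hA, (hD A hA).1.1.act _ _ _ h ha⟩
      · obtain ⟨A, hA, h, h'⟩ := common _ _ h h'
        exact hA.func _ _ _ h h'
      · rintro e e' ⟨κ, h | ⟨A, hA, h⟩⟩ hr
        · obtain ⟨κ', h'⟩ := hGR e e' ⟨κ, h⟩ hr
          exact ⟨κ', Or.inl h'⟩
        · obtain ⟨κ', h'⟩ := (hD A hA).1.2 e e' ⟨κ, h⟩ hr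
          exact ⟨κ', Or.inr ⟨A, hA, h'⟩⟩)
  have tot : ∀ e, Dom H e := by
    by_contra! hc
    obtain ⟨H', h1, h2, h3, e, he, hne⟩ := step H hH.1 hGH hH.2 hc
    rw [hmax H' ⟨h1, h3⟩ h2] at he
    exact hne he
  obtain ⟨f, hf⟩ := exists_ifun (M := M) (R := fun e κ => H (e, κ)) (by fun_prop) fun e => by
    obtain ⟨κ, h⟩ := tot e
    exact ⟨κ, h, fun κ' h' => hH.1.func _ _ _ h' h⟩
  have hf' : ∀ e, H (e, f e) := fun e => (hf _ _).1 rfl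
  exact ⟨f, ⟨f.int, fun e => (hH.1.dim_eq _ _ (hf' e)).symm, fun e a h =>
    (hf _ _).2 (hH.1.act _ _ _ (hf' e) h)⟩, fun e κ h => (hf _ _).2 (hGH _ h)⟩

/-- Extension of a partial map along the image of a map. -/
theorem exists_attach (G : ISet M (A × K)) (hG : IsPMap G) {φ : F → A} {γ : F → K}
    (hφ : IsSMap M φ) (hγ : IsSMap M γ) (h1 : ∀ c κ, G (φ c, κ) → γ c = κ)
    (h2 : ∀ c c', ¬ Dom G (φ c) → φ c = φ c' → γ c = γ c') :
    ∃ G' : ISet M (A × K), IsPMap G' ∧ Incl G G' ∧ ∀ e, Dom G' e ↔ Dom G e ∨ ∃ c, φ c = e := by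
  have i1 := hφ.internal
  have i2 := hγ.internal
  refine ⟨⟨fun p => G p ∨ ∃ c, φ c = p.1 ∧ γ c = p.2, by fun_prop⟩, ⟨?_, ?_, ?_⟩,
    fun p h => Or.inl h, fun e => ?_⟩
  · rintro _ _ (h | ⟨c, rfl, rfl⟩)
    · exact hG.dim_eq _ _ h
    · rw [hφ.dim, hγ.dim]
  · rintro _ _ a (h | ⟨c, rfl, rfl⟩) ha
    · exact Or.inl (hG.act _ _ _ h ha)
    · rw [hφ.dim] at ha
      exact Or.inr ⟨c ⋆ a, hφ.act _ _ ha, hγ.act _ _ ha⟩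
  · have aux : ∀ c κ, (G (φ c, κ) ∨ ∃ c', φ c' = φ c ∧ γ c' = κ) → κ = γ c := by
      rintro c κ (h | ⟨c', h, rfl⟩)
      · exact (h1 c κ h).symm
      · by_cases hd : Dom G (φ c)
        · obtain ⟨κ, hκ⟩ := hd
          rw [h1 c κ hκ, h1 c' κ (h ▸ hκ)]
        · exact (h2 c c' hd h.symm).symm
    rintro e κ κ' h h'
    rcases h with h | ⟨c, rfl, rfl⟩
    · rcases h' with h' | ⟨c, rfl, rfl⟩
      · exact hG.func _ _ _ h h'
      · exact aux c κ (Or.inl h)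
    · exact (aux c κ' h').symm
  · constructor
    · rintro ⟨κ, h | ⟨c, h, _⟩⟩
      · exact Or.inl ⟨κ, h⟩
      · exact Or.inr ⟨c, h⟩
    · rintro (⟨κ, h⟩ | ⟨c, h⟩)
      · exact ⟨κ, Or.inl h⟩
      · exact ⟨γ c, Or.inr ⟨c, h, rfl⟩⟩

/-! ### Kan complexes -/

/-- The graph of a simplicial map defined on the horn `Λ^k[n]`. -/
structure IsHornMap (n k : Nn M) (G : ISet M (Arr M × K)) : Prop where
  horn : ∀ c κ, G (c, κ) → c.top ≤ n ∧ c.InHorn n k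
  ex : ∀ c : Arr M, c.top ≤ n → c.InHorn n k → ∃ κ, G (c, κ)
  func : ∀ c κ κ', G (c, κ) → G (c, κ') → κ = κ'
  dim : ∀ c κ, G (c, κ) → MacSet.dim M κ = c.dom
  act : ∀ c κ (b : Arr M), G (c, κ) → b.top ≤ c.dom → G (c.comp b, κ ⋆ b)

variable (M K) in
/-- Kan complexes. -/
def IsKan : Prop := ∀ (n k : Nn M) (G : ISet M (Arr M × K)), 0 < n → k ≤ n → IsHornMap n k G →
  ∃ κ, dim M κ = n ∧ ∀ c κ', G (c, κ') → κ ⋆ c = κ'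

/-- Kan fibrations. -/
def IsKanFib (p : Z → Y) : Prop := ∀ (n k : Nn M) (G : ISet M (Arr M × Z)) (y : Y), 0 < n →
  k ≤ n → dim M y = n → IsHornMap n k G → (∀ c z, G (c, z) → p z = y ⋆ c) →
  ∃ z, p z = y ∧ ∀ c z', G (c, z') → z ⋆ c = z'

/-- Extension of a partial map by a simplex that meets its domain in a horn. -/
theorem exists_attach_simplex (hK : IsKan M K) (G : ISet M (A × K)) (hG : IsPMap G) (σ : A)
    (n k : Nn M) (hn : 0 < n) (hk : k ≤ n) (hσ : dim M σ = n)
    (h1 : ∀ c : Arr M, c.top ≤ n → (Dom G (σ ⋆ c) ↔ c.InHorn n k))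
    (h2 : ∀ c c' : Arr M, c.top ≤ n → c'.top ≤ n → ¬ Dom G (σ ⋆ c) → σ ⋆ c = σ ⋆ c' → c = c') :
    ∃ G' : ISet M (A × K), IsPMap G' ∧ Incl G G' ∧
      ∀ e, Dom G' e ↔ Dom G e ∨ ∃ c : Arr M, c.top ≤ n ∧ e = σ ⋆ c := by
  -- The pullback of `G` along `σ : Δ[n] → A` is a horn in `K`; a filler of it defines the extension
  -- on the image of `σ`.
  obtain ⟨κ, hκ, hκ'⟩ := hK n k ⟨fun p => p.1.top ≤ n ∧ G (σ ⋆ p.1, p.2), by fun_prop⟩ hn hk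
    ⟨fun c κ h => ⟨h.1, (h1 c h.1).1 ⟨κ, h.2⟩⟩,
      fun c hc h => (by obtain ⟨κ, h⟩ := (h1 c hc).2 h; exact ⟨κ, hc, h⟩),
      fun c κ κ' h h' => hG.func _ _ _ h.2 h'.2,
      fun c κ h => by rw [← hG.dim_eq _ _ h.2, dim_act (by rw [hσ]; exact h.1)],
      fun c κ b h hb => ⟨Arr.comp_top_le.trans h.1, by
        have h3 : c.top ≤ dim M σ := by rw [hσ]; exact h.1
        have := hG.act _ _ b h.2 (by rwa [dim_act h3])
        rwa [act_act h3 hb] at this⟩⟩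
  obtain ⟨G', h3, h4, h5⟩ := exists_attach G hG (isSMap_yoneda σ hσ) (isSMap_yoneda κ hκ)
    (fun c κ' h => hκ' _ _ ⟨c.arr_mem, h⟩)
    (fun c c' h h' => by rw [h2 _ _ c.arr_mem c'.arr_mem h h'])
  refine ⟨G', h3, h4, fun e => (h5 e).trans (or_congr_right ⟨?_, ?_⟩)⟩
  · rintro ⟨c, rfl⟩
    exact ⟨c.arr, c.arr_mem, rfl⟩
  · rintro ⟨c, hc, rfl⟩
    exact ⟨⟨c, hc⟩, rfl⟩

/-! ### Minimal simplices outside a subcomplex -/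

/-- The arrow takes all values up to `n`. -/
def Arr.Onto (n : Nn M) (a : Arr M) : Prop := ∀ j ≤ n, ∃ p, a p = j

/-- A monotone map that takes all values up to `n` starts at `0` and skips no value, so it rises by
at most one at each step. -/
theorem Arr.Onto.le {n : Nn M} {c : Arr M} (h : c.Onto n) (hc : c.top ≤ n) (i : Nn M) :
    c i ≤ i := by
  refine Nn.induction (P := fun i => c i ≤ i) internal ?_ (fun i ih => ?_) i
  · obtain ⟨p, hp⟩ := h 0 (Nn.zero_le _)
    exact (c.mono (Nn.zero_le p)).trans hp.le
  · refine le_trans ?_ (Nn.succ_le_succ.2 ih)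
    by_contra! hlt
    obtain ⟨p, hp⟩ := h (c i).succ (hlt.le.trans ((c.le_top _).trans hc))
    rcases lt_or_ge p i.succ with h' | h'
    · have := c.mono (Nn.lt_succ_iff.1 h')
      rw [hp, Nn.succ_le_iff] at this
      exact lt_irrefl _ this
    · have := c.mono h'
      rw [hp] at this
      exact lt_irrefl _ (lt_of_lt_of_le hlt this)

/-- The section may be made to pass through any prescribed point `p₀`; this freedom is what
distinguishes different surjections in `IsMinimal.le`. -/
theorem Arr.Onto.exists_section {n : Nn M} {a : Arr M} (h : a.Onto n) (ha : a.top ≤ n) (p₀ : Nn M)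
    (hp : p₀ ≤ a.dom) : ∃ d : Arr M, d.dom = n ∧ d.top ≤ a.dom ∧ a.comp d = Arr.id M n ∧
      d (a p₀) = p₀ := by
  -- The value `a p₀` is sent to `p₀` and every other value up to `n` to its least preimage;
  -- arguments beyond `n` get the default value `p₀`.
  obtain ⟨f, hf⟩ := exists_ifun (M := M) (R := fun j p : Nn M =>
    ((j = a p₀ ∨ n < j) ∧ p = p₀) ∨ (¬ (j = a p₀ ∨ n < j) ∧ a p = j ∧ ∀ q, q < p → a q ≠ j))
    internal fun j => by
      by_cases hj : j = a p₀ ∨ n < j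
      · exact ⟨p₀, Or.inl ⟨hj, rfl⟩, fun q hq => by tauto⟩
      · obtain ⟨p, hp, hp'⟩ := Nn.exists_least (P := fun p => a p = j) internal
          (h j (by push Not at hj; exact hj.2))
        refine ⟨p, Or.inr ⟨hj, hp, hp'⟩, fun q hq => ?_⟩
        rcases hq with ⟨h1, _⟩ | ⟨_, h1, h2⟩
        · exact absurd h1 hj
        · rcases lt_trichotomy p q with h3 | h3 | h3
          · exact absurd hp (h2 p h3)
          · exact h3.symm
          · exact absurd h1 (hp' q h3)
  have hf' := fun j => (hf j (f j)).1 rfl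
  have sec : ∀ j ≤ n, a (f j) = j := fun j hj => by
    rcases hf' j with ⟨h1 | h1, h2⟩ | ⟨_, h1, _⟩
    · rw [h2, h1]
    · exact absurd h1 (not_lt.2 hj)
    · exact h1
  have mono : ∀ i j, i ≤ j → j ≤ n → f i ≤ f j := fun i j hij hj => by
    by_contra! hlt
    have := a.mono hlt.le
    rw [sec i (hij.trans hj), sec j hj] at this
    rw [le_antisymm hij this] at hlt
    exact lt_irrefl _ hlt
  refine ⟨Arr.of n f f.int mono, rfl, ?_, Arr.ext_le rfl fun i hi => ?_, ?_⟩
  · rw [Arr.of_top]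
    rcases hf' n with ⟨_, h2⟩ | ⟨_, h1, h2⟩
    · rw [h2]; exact hp
    · by_contra! hlt
      refine h2 _ hlt ?_
      rw [← h1, a.stable (f n), min_eq_right hlt.le]
  · replace hi : i ≤ n := hi
    rw [Arr.comp_apply, Arr.of_apply hi, sec i hi, Arr.id_apply, min_eq_left hi]
  · rw [Arr.of_apply ((a.le_top _).trans ha)]
    exact (hf _ _).2 (Or.inl ⟨Or.inl rfl, rfl⟩)

/-- The simplex `x` of dimension `n` is not in the subcomplex `S`, which contains all simplices of
smaller dimension. -/
structure IsMinimal (S : B → Prop) (x : B) (n : Nn M) : Prop where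
  act : ∀ b (a : Arr M), S b → a.top ≤ dim M b → S (b ⋆ a)
  dim_eq : dim M x = n
  not_mem : ¬ S x
  lower : ∀ b, dim M b < n → S b

variable {S : B → Prop} {x : B} {n : Nn M}

/-- An arrow that misses `j` factors through the coface `δ` omitting `j`, and `x ⋆ δ` lies in `S`
because its dimension is smaller than `n`. -/
theorem IsMinimal.not_onto (h : IsMinimal S x n) {a : Arr M} (ha : a.top ≤ n) (ho : ¬ a.Onto n) :
    S (x ⋆ a) := by
  simp only [Arr.Onto, not_forall, not_exists] at ho
  obtain ⟨j, hj, hja⟩ := ho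
  -- For `n = 0` the value `0` cannot be missed. Hence `n = m + 1`, and the coface starts at `[m]`.
  have hpos : 0 < n := by
    by_contra! h0
    have e : n = 0 := le_antisymm h0 (Nn.zero_le _)
    subst e
    exact hja 0 (le_antisymm ((a.le_top _).trans ha) (Nn.zero_le _) |>.trans
      (le_antisymm (Nn.zero_le _) hj))
  obtain ⟨m, rfl⟩ := (Nn.zero_or_succ n).resolve_left hpos.ne'
  have hm : Internal M fun p : Nn M => if p < j then p else p.succ := by fun_prop
  have hpa : Internal M fun p : Nn M => if a p < j then a p else (a p).pred := by fun_prop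
  let δ : Arr M := Arr.of m (fun p => if p < j then p else p.succ) hm fun i i' h _ => by
    split_ifs with h1 h2 h2
    · exact h
    · exact h.trans (Nn.lt_succ _).le
    · exact absurd (lt_of_le_of_lt h h2) h1
    · exact Nn.succ_le_succ.2 h
  have hne : ∀ p, ¬ a p < j → ∃ r, a p = r.succ ∧ j ≤ r := fun p hp => by
    have h1 : j < a p := lt_of_le_of_ne (not_lt.1 hp) fun e => hja p e.symm
    rcases Nn.zero_or_succ (a p) with h2 | ⟨r, h2⟩
    · rw [h2] at h1; exact absurd h1 (not_lt.2 (Nn.zero_le _))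
    · exact ⟨r, h2, Nn.lt_succ_iff.1 (h2 ▸ h1)⟩
  let a' : Arr M := Arr.of a.dom (fun p => if a p < j then a p else (a p).pred) hpa
    fun i i' h _ => by
      have h3 := a.mono h
      split_ifs with h1 h2 h2
      · exact h3
      · obtain ⟨r, hr, hjr⟩ := hne _ h2
        rw [hr, Nn.pred_succ]
        exact h1.le.trans hjr
      · exact absurd (lt_of_le_of_lt h3 h2) h1
      · obtain ⟨r, hr, hjr⟩ := hne _ h2
        obtain ⟨s, hs, hjs⟩ := hne _ h1
        rw [hr, hs, Nn.succ_le_succ] at h3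
        rwa [hr, hs, Nn.pred_succ, Nn.pred_succ]
  have hδ : δ.top ≤ m.succ := by
    change (if _ then _ else _) ≤ _
    split_ifs
    · exact (min_le_right _ _).trans (Nn.lt_succ _).le
    · exact Nn.succ_le_succ.2 (min_le_right _ _)
  have ha' : a'.top ≤ m := by
    rw [Arr.of_top]
    split_ifs with h1
    · exact Nn.lt_succ_iff.1 (lt_of_lt_of_le h1 hj)
    · obtain ⟨r, hr, hjr⟩ := hne _ h1
      rw [hr, Nn.pred_succ]
      have := (a.le_top a.dom).trans ha
      rwa [hr, Nn.succ_le_succ] at this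
  have e : δ.comp a' = a := Arr.ext_le rfl fun i hi => by
    replace hi : i ≤ a.dom := hi
    have hi' : a' i ≤ m := (a'.le_top _).trans ha'
    rw [Arr.comp_apply, Arr.of_apply hi', Arr.of_apply hi]
    by_cases h1 : a i < j
    · simp only [if_pos h1]
    · obtain ⟨r, hr, hjr⟩ := hne _ h1
      simp only [if_neg h1]
      rw [hr, Nn.pred_succ, if_neg (not_lt.2 hjr)]
  have hδx : δ.top ≤ dim M x := by rw [h.dim_eq]; exact hδ
  have h4 := h.act _ a' (h.lower (x ⋆ δ) (by rw [dim_act hδx]; exact Nn.lt_succ _))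
    (by rw [dim_act hδx]; exact ha')
  rwa [act_act hδx ha', e] at h4

/-- A section of `a` recovers `x` from the degenerate simplex `x ⋆ a`. -/
theorem IsMinimal.onto (h : IsMinimal S x n) {a : Arr M} (ha : a.top ≤ n) (ho : a.Onto n) :
    ¬ S (x ⋆ a) := fun hs => by
  obtain ⟨d, h1, h2, h3, -⟩ := ho.exists_section ha 0 (Nn.zero_le _)
  have hx : a.top ≤ dim M x := by rw [h.dim_eq]; exact ha
  have := h.act _ d hs (by rwa [dim_act hx])
  rw [act_act hx h2, h3, ← h.dim_eq, act_id] at this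
  exact h.not_mem this

theorem IsMinimal.mem_iff (h : IsMinimal S x n) {a : Arr M} (ha : a.top ≤ n) :
    S (x ⋆ a) ↔ ¬ a.Onto n :=
  ⟨fun hs ho => h.onto ha ho hs, h.not_onto ha⟩

/-- Let `d` be a section of `a` through `p`. Then `x ⋆ (a'.comp d) = (x ⋆ a) ⋆ d = x`, so `a'.comp
d` is onto, since otherwise `x` would lie in `S`. By `Arr.Onto.le` its value at `a p`, which is `a'
p`, is at most `a p`. -/
theorem IsMinimal.le (h : IsMinimal S x n) {a a' : Arr M} (ha : a.top ≤ n) (ha' : a'.top ≤ n)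
    (hs : ¬ S (x ⋆ a)) (he : x ⋆ a = x ⋆ a') (p : Nn M) (hp : p ≤ a.dom) : a' p ≤ a p := by
  have ho : a.Onto n := by_contra fun h' => hs (h.not_onto ha h')
  obtain ⟨d, h1, h2, h3, h4⟩ := ho.exists_section ha p hp
  have hx : a.top ≤ dim M x := by rw [h.dim_eq]; exact ha
  have hx' : a'.top ≤ dim M x := by rw [h.dim_eq]; exact ha'
  have hd : a.dom = a'.dom := by rw [← dim_act hx, he, dim_act hx']
  have h5 : x ⋆ a'.comp d = x := by
    rw [← act_act hx' (hd ▸ h2), ← he, act_act hx h2, h3, ← h.dim_eq, act_id]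
  have ht : (a'.comp d).top ≤ n := Arr.comp_top_le.trans ha'
  have h6 : (a'.comp d).Onto n := by
    by_contra h'
    exact h.not_mem (h5 ▸ h.not_onto ht h')
  have := h6.le ht (a p)
  rwa [Arr.comp_apply, h4] at this

/-- Together with `IsMinimal.mem_iff` this says that `x` is attached to `S` freely along the
boundary of `Δ[n]`. It replaces the Eilenberg–Zilber decomposition of simplices. -/
theorem IsMinimal.inj (h : IsMinimal S x n) {a a' : Arr M} (ha : a.top ≤ n) (ha' : a'.top ≤ n)
    (hs : ¬ S (x ⋆ a)) (he : x ⋆ a = x ⋆ a') : a = a' := by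
  have hx : a.top ≤ dim M x := by rw [h.dim_eq]; exact ha
  have hx' : a'.top ≤ dim M x := by rw [h.dim_eq]; exact ha'
  have hd : a.dom = a'.dom := by rw [← dim_act hx, he, dim_act hx']
  exact Arr.ext_le hd fun i hi => le_antisymm (h.le ha' ha (he ▸ hs) he.symm i (hd ▸ hi))
    (h.le ha ha' hs he i hi)

end

/-! ### Prisms and homotopy extension -/

section

variable {M : Type} [MacModel M]

variable {K B : Type} [Coded M K] [Coded M B] [SSet M K] [SSet M B]

/-! ### The homotopy extension property of Kan complexes -/

theorem Nn.eq_zero_or_one {a : Nn M} (h : a ≤ 1) : a = 0 ∨ a = 1 := by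
  rcases Nn.zero_or_succ a with rfl | ⟨b, rfl⟩
  · exact Or.inl rfl
  · rw [Nn.one_def, Nn.succ_le_succ] at h
    exact Or.inr (by rw [le_antisymm h (Nn.zero_le _), Nn.one_def])

theorem Nn.zero_ne_one : (0 : Nn M) ≠ 1 := Nn.succ_ne_zero.symm
theorem Nn.zero_lt_one : (0 : Nn M) < 1 := Nn.lt_succ 0

theorem Nn.le_or_succ (q i : Nn M) : q ≤ i ∨ ∃ r, q = succ r ∧ i ≤ r := by
  rcases le_or_gt q i with h | h
  · exact Or.inl h
  · rcases Nn.zero_or_succ q with rfl | ⟨r, rfl⟩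
    · exact absurd h (not_lt.2 (Nn.zero_le _))
    · exact Or.inr ⟨r, rfl, Nn.lt_succ_iff.1 h⟩

namespace Cyl

/-- The simplex of one end of a cylinder over a simplex of the base. -/
def endAt {δ : Nn M} (h : δ ≤ 1) (x : B) : Cyl M B :=
  mk x (Arr.const (dim M x) δ) Arr.const_dom (by rw [Arr.const_top]; exact h)

variable {δ : Nn M} {hδ : δ ≤ 1}

@[simp] theorem endAt_fst {x : B} : (endAt hδ x).fst = x := rfl
@[simp] theorem endAt_snd {x : B} : (endAt hδ x).snd = Arr.const (dim M x) δ := rfl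

theorem endAt_act {x : B} {a : Arr M} (ha : a.top ≤ dim M x) :
    endAt hδ x ⋆ a = endAt hδ (x ⋆ a) := by
  ext1
  · rw [act_fst ha, endAt_fst, endAt_fst]
  · rw [act_snd ha, endAt_snd, endAt_snd, Arr.const_comp, dim_act ha]

@[fun_prop]
theorem internal_endAt : Internal M (endAt hδ : B → Cyl M B) := by unfold endAt; fun_prop

theorem eq_endAt {c : Cyl M B} (h : ∀ p, c.snd p = δ) : c = endAt hδ c.fst :=
  ext rfl (Arr.ext_iff'.2 ⟨c.snd_dom, h⟩)

end Cyl

namespace Arr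

/-- The degeneracy `[n + 1] → [n]` that takes the value `i` twice. -/
def deg (n i : Nn M) : Arr M :=
  of n.succ (fun q => if q ≤ i then q else q.pred) (by fun_prop) fun p q h _ => by
    split_ifs with h1 h2 h2
    · exact h
    · obtain ⟨r, rfl, hr⟩ := (Nn.le_or_succ q i).resolve_left h2
      rw [Nn.pred_succ]
      exact h1.trans hr
    · exact absurd (h.trans h2) h1
    · obtain ⟨r, rfl, hr⟩ := (Nn.le_or_succ q i).resolve_left h2
      obtain ⟨s, rfl, hs⟩ := (Nn.le_or_succ p i).resolve_left h1
      rw [Nn.pred_succ, Nn.pred_succ]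
      exact Nn.succ_le_succ.1 h

/-- The arrow `[n + 1] → [1]` that is `0` exactly up to `i`. -/
def cut (n i : Nn M) : Arr M :=
  of n.succ (fun q => if q ≤ i then 0 else 1) (by fun_prop) fun p q h _ => by
    split_ifs with h1 h2 h2
    · exact le_rfl
    · exact Nn.zero_le _
    · exact absurd (h.trans h2) h1
    · exact le_rfl

variable {n i : Nn M} {c c' a t : Arr M}

theorem deg_top (hi : i ≤ n) : (deg n i).top ≤ n := by
  rw [deg, of_top, if_neg (not_le.2 (Nn.lt_succ_iff.2 hi)), Nn.pred_succ]

theorem cut_top : (cut n i).top ≤ 1 := by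
  rw [cut, of_top]
  split_ifs
  · exact Nn.zero_le _
  · exact le_rfl

/-- In the prism simplex given by `deg n i` and `cut n i`, the vertices up to `i` lie on the bottom
and a vertex `r + 1` with `i ≤ r` lies on the top over `r`; both `i` and `i + 1` lie over `i`. -/
theorem prism_cases (hc : c.top ≤ n.succ) (p : Nn M) :
    (((deg n i).comp c) p = c p ∧ c p ≤ i ∧ ((cut n i).comp c) p = 0) ∨
      ∃ r, c p = r.succ ∧ i ≤ r ∧ i < c p ∧ ((deg n i).comp c) p = r ∧
        ((cut n i).comp c) p = 1 := by
  have h := (c.le_top p).trans hc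
  rw [comp_apply, comp_apply, deg, cut, of_apply h, of_apply h]
  rcases Nn.le_or_succ (c p) i with h1 | ⟨r, hr, h2⟩
  · exact Or.inl ⟨if_pos h1, h1, if_pos h1⟩
  · have h1 : ¬ c p ≤ i := by
      rw [hr, not_le]
      exact Nn.lt_succ_iff.2 h2
    exact Or.inr ⟨r, hr, h2, not_le.1 h1, by rw [if_neg h1, hr, Nn.pred_succ], if_neg h1⟩

theorem prism_inj (hc : c.top ≤ n.succ) (hc' : c'.top ≤ n.succ)
    (h1 : (deg n i).comp c = (deg n i).comp c') (h2 : (cut n i).comp c = (cut n i).comp c') :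
    c = c' := by
  have hd : c.dom = c'.dom := by simpa using congrArg dom h1
  refine ext_iff'.2 ⟨hd, fun p => ?_⟩
  have e1 := prism_cases (i := i) hc p
  have e2 := prism_cases (i := i) hc' p
  rw [h1, h2] at e1
  have := Nn.zero_ne_one (M := M)
  grind

/-- The hypotheses say that the bottom part of `(a, t)` stays at or before `i` and the top part at
or after `i`. The arrow sought is `a` on the bottom part and `a + 1` on the top part. -/
theorem prism_lift (ha : a.top ≤ n) (ht : t.top ≤ 1) (hd : t.dom = a.dom)
    (h0 : ∀ p, t p = 0 → a p ≤ i) (h1 : ∀ p, t p = 1 → i ≤ a p) :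
    ∃ c : Arr M, c.top ≤ n.succ ∧ (deg n i).comp c = a ∧ (cut n i).comp c = t := by
  have ht' : ∀ p, t p = 0 ∨ t p = 1 := fun p => Nn.eq_zero_or_one ((t.le_top p).trans ht)
  have h01 := Nn.zero_ne_one (M := M)
  have hg : Internal M fun p => if t p = 0 then a p else (a p).succ := by fun_prop
  let c : Arr M := of a.dom (fun p => if t p = 0 then a p else (a p).succ) hg fun p q h _ => by
    have h3 := t.mono h
    have h4 := a.mono h
    split_ifs with h5 h6 h6
    · exact h4
    · exact h4.trans (Nn.lt_succ _).le
    · rw [h6] at h3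
      exact absurd (le_antisymm h3 (Nn.zero_le _)) h5
    · exact Nn.succ_le_succ.2 h4
  have hc : c.top ≤ n.succ := by
    rw [of_top]
    split_ifs
    · exact (ha).trans (Nn.lt_succ _).le
    · exact Nn.succ_le_succ.2 ha
  have key : ∀ p, p ≤ a.dom → ((deg n i).comp c) p = a p ∧ ((cut n i).comp c) p = t p := by
    intro p hp
    have hcp : c p = if t p = 0 then a p else (a p).succ := of_apply hp
    rcases prism_cases (i := i) hc p with ⟨e1, e2, e3⟩ | ⟨r, e1, e2, -, e3, e4⟩
    · rcases ht' p with h | h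
      · rw [e1, e3, hcp, if_pos h, h]
        exact ⟨rfl, rfl⟩
      · have h' : ¬ t p = 0 := fun h' => h01 (h'.symm.trans h)
        rw [hcp, if_neg h', Nn.succ_le_iff] at e2
        exact absurd (h1 p h) (not_le.2 e2)
    · rcases ht' p with h | h
      · rw [hcp, if_pos h] at e1
        have := h0 p h
        rw [e1, Nn.succ_le_iff] at this
        exact absurd e2 (not_le.2 this)
      · have h' : ¬ t p = 0 := fun h' => h01 (h'.symm.trans h)
        rw [hcp, if_neg h', Nn.succ_inj] at e1
        exact ⟨by rw [e3, e1], by rw [e4, h]⟩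
  exact ⟨c, hc, ext_le rfl fun p hp => (key p hp).1, ext_le hd.symm fun p hp => (key p hp).2⟩

end Arr

section Prism

variable {S : B → Prop} {x : B} {n : Nn M}

/-- The simplex of dimension `n + 1` of the prism over `x` that goes up at the vertex `i`. -/
def prismSimplex (x : B) (n i : Nn M) (hx : dim M x = n) (hi : i ≤ n) : Cyl M B :=
  Cyl.mk (x ⋆ Arr.deg n i) (Arr.cut n i) (by rw [dim_act (by rw [hx]; exact Arr.deg_top hi)]; rfl)
    Arr.cut_top

theorem prismSimplex_dim {i : Nn M} (hx : dim M x = n) (hi : i ≤ n) :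
    dim M (prismSimplex x n i hx hi) = n.succ := by
  rw [Cyl.dim_eq]
  exact dim_act (by rw [hx]; exact Arr.deg_top hi)

theorem prismSimplex_fst {i : Nn M} (hx : dim M x = n) (hi : i ≤ n) {c : Arr M}
    (hc : c.top ≤ n.succ) :
    (prismSimplex x n i hx hi ⋆ c).fst = x ⋆ (Arr.deg n i).comp c := by
  rw [Cyl.act_fst (by rw [← Cyl.dim_eq, prismSimplex_dim]; exact hc)]
  exact act_act (by rw [hx]; exact Arr.deg_top hi) hc

theorem prismSimplex_snd {i : Nn M} (hx : dim M x = n) (hi : i ≤ n) {c : Arr M}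
    (hc : c.top ≤ n.succ) :
    (prismSimplex x n i hx hi ⋆ c).snd = (Arr.cut n i).comp c := by
  rw [Cyl.act_snd (by rw [← Cyl.dim_eq, prismSimplex_dim]; exact hc)]
  rfl

/-- One step of filling a prism. The domain of the partial map consists of `T`, which contains the
part of the cylinder over `S`, and of the simplices `(x ⋆ a, t)` such that `Q a t`. -/
theorem prism_step (hK : IsKan M K) (G : ISet M (Cyl M B × K)) (hG : IsPMap G)
    (hx : IsMinimal S x n) {i k : Nn M} (hi : i ≤ n) (hk : k ≤ n.succ) {Q Q' : Arr M → Arr M → Prop}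
    {T : Cyl M B → Prop} (hT : ∀ e, S e.fst → T e)
    (hT' : ∀ e (a : Arr M), a.top ≤ n → e.fst = x ⋆ a → T e → S e.fst ∨ Q a e.snd)
    (hd : ∀ e, Dom G e ↔ T e ∨ ∃ a : Arr M, a.top ≤ n ∧ e.fst = x ⋆ a ∧ Q a e.snd)
    (hh : ∀ c : Arr M, c.top ≤ n.succ → (c.InHorn n.succ k ↔ ¬ ((Arr.deg n i).comp c).Onto n ∨
      Q ((Arr.deg n i).comp c) ((Arr.cut n i).comp c)))
    (hQ : ∀ a t : Arr M, a.top ≤ n → t.top ≤ 1 → t.dom = a.dom → (Q' a t ↔ Q a t ∨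
      ∃ c : Arr M, c.top ≤ n.succ ∧ a = (Arr.deg n i).comp c ∧ t = (Arr.cut n i).comp c)) :
    ∃ G' : ISet M (Cyl M B × K), IsPMap G' ∧ Incl G G' ∧ ∀ e, Dom G' e ↔ T e ∨
      ∃ a : Arr M, a.top ≤ n ∧ e.fst = x ⋆ a ∧ Q' a e.snd := by
  have hdt : ∀ c : Arr M, ((Arr.deg n i).comp c).top ≤ n := fun c =>
    Arr.comp_top_le.trans (Arr.deg_top hi)
  have hdom : ∀ c : Arr M, c.top ≤ n.succ → (Dom G (prismSimplex x n i hx.dim_eq hi ⋆ c) ↔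
      ¬ ((Arr.deg n i).comp c).Onto n ∨ Q ((Arr.deg n i).comp c) ((Arr.cut n i).comp c)) := by
    intro c hc
    have ef := prismSimplex_fst hx.dim_eq hi hc
    have es := prismSimplex_snd hx.dim_eq hi hc
    rw [hd, ← hx.mem_iff (hdt c)]
    constructor
    · rintro (h | ⟨a, ha, e, hq⟩)
      · rw [← ef, ← es]
        exact hT' _ _ (hdt c) ef h
      -- Outside `S` the arrow is determined by the simplex (`IsMinimal.inj`), so the witness `a` is
      -- the arrow at hand.
      · by_cases ho : S (x ⋆ (Arr.deg n i).comp c)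
        · exact Or.inl ho
        · rw [ef] at e
          rw [hx.inj (hdt c) ha ho e, ← es]
          exact Or.inr hq
    · rintro (h | h)
      · exact Or.inl (hT _ (ef ▸ h))
      · exact Or.inr ⟨_, hdt c, ef, es.symm ▸ h⟩
  obtain ⟨G', h1, h2, h3⟩ := exists_attach_simplex hK G hG (prismSimplex x n i hx.dim_eq hi)
    n.succ k (lt_of_le_of_lt (Nn.zero_le _) (Nn.lt_succ n)) hk (prismSimplex_dim _ _)
    (fun c hc => by rw [hdom c hc, hh c hc]) (fun c c' hc hc' hnd he => by
      rw [hdom c hc, not_or, not_not] at hnd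
      have e1 := congrArg Cyl.fst he
      have e2 := congrArg Cyl.snd he
      rw [prismSimplex_fst _ _ hc, prismSimplex_fst _ _ hc'] at e1
      rw [prismSimplex_snd _ _ hc, prismSimplex_snd _ _ hc'] at e2
      exact Arr.prism_inj hc hc' (hx.inj (hdt c) (hdt c') (hx.onto (hdt c) hnd.1) e1) e2)
  refine ⟨G', h1, h2, fun e => ?_⟩
  rw [h3, hd]
  have hxa : ∀ a : Arr M, a.top ≤ n → a.top ≤ dim M x := fun a ha => by rwa [hx.dim_eq]
  constructor
  · rintro ((h | ⟨a, ha, he, hq⟩) | ⟨c, hc, rfl⟩)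
    · exact Or.inl h
    · exact Or.inr ⟨a, ha, he, (hQ a _ ha e.snd_top_le
        (by rw [e.snd_dom, he, dim_act (hxa a ha)])).2 (Or.inl hq)⟩
    · rw [prismSimplex_fst _ _ hc, prismSimplex_snd _ _ hc]
      exact Or.inr ⟨_, hdt c, rfl, (hQ _ _ (hdt c) (Arr.comp_top_le.trans Arr.cut_top) rfl).2
        (Or.inr ⟨c, hc, rfl, rfl⟩)⟩
  · rintro (h | ⟨a, ha, he, hq⟩)
    · exact Or.inl (Or.inl h)
    · rcases (hQ a _ ha e.snd_top_le (by rw [e.snd_dom, he, dim_act (hxa a ha)])).1 hq with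
        hq | ⟨c, hc, h4, h5⟩
      · exact Or.inl (Or.inr ⟨a, ha, he, hq⟩)
      · refine Or.inr ⟨c, hc, Cyl.ext ?_ ?_⟩
        · rw [prismSimplex_fst _ _ hc, he, h4]
        · rw [prismSimplex_snd _ _ hc, h5]

/-- The part of the prism filled when moving down from the bottom to `i`. -/
def Upper (i : Nn M) (a t : Arr M) : Prop := ∀ p, t p = 1 → i ≤ a p
/-- The part of the prism filled when moving up from the top to `i`. -/
def Lower (i : Nn M) (a t : Arr M) : Prop := ∀ p, t p = 0 → a p < i

/-- The faces of the `i`-th prism simplex that omit a vertex `j < i` or `j > i + 1` project to the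
boundary of `Δ[n]`; the face omitting `i + 1` is shared with the simplices filled before. What
remains is the face omitting `i`, so a horn `Λ^i[n + 1]` is given. -/
theorem upper_horn {i : Nn M} (hi : i ≤ n) {c : Arr M} (hc : c.top ≤ n.succ) :
    c.InHorn n.succ i ↔ ¬ ((Arr.deg n i).comp c).Onto n ∨
      Upper i.succ ((Arr.deg n i).comp c) ((Arr.cut n i).comp c) := by
  have key := fun p => Arr.prism_cases (i := i) hc p
  have h01 := Nn.zero_ne_one (M := M)
  constructor
  · rintro ⟨j, hj, hji, hne⟩
    rcases lt_or_gt_of_ne hji with h | h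
    · refine Or.inl fun ho => ?_
      obtain ⟨p, hp⟩ := ho j (h.le.trans hi)
      have := key p
      have := hne p
      grind
    · rcases Nn.zero_or_succ j with rfl | ⟨m, rfl⟩
      · exact absurd h (not_lt.2 (Nn.zero_le _))
      rw [Nn.lt_succ_iff] at h
      rcases h.eq_or_lt with rfl | h
      · refine Or.inr fun p hp => ?_
        rw [Nn.succ_le_iff]
        have := key p
        have := hne p
        grind
      · refine Or.inl fun ho => ?_
        obtain ⟨p, hp⟩ := ho m (Nn.succ_le_succ.1 hj)
        have := key p
        have := hne p
        grind
  · rintro (ho | h)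
    · simp only [Arr.Onto, not_forall, not_exists] at ho
      obtain ⟨j, hj, hne⟩ := ho
      rcases lt_or_ge j i with h | h
      · refine ⟨j, hj.trans (Nn.lt_succ _).le, h.ne, fun p => ?_⟩
        have := key p
        have := hne p
        grind
      · refine ⟨j.succ, Nn.succ_le_succ.2 hj, (lt_of_le_of_lt h (Nn.lt_succ _)).ne', fun p => ?_⟩
        have := key p
        have := hne p
        have := Nn.lt_succ j
        grind [Nn.succ_inj]
    · refine ⟨i.succ, Nn.succ_le_succ.2 hi, (Nn.lt_succ _).ne', fun p hp => ?_⟩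
      have h1 := key p
      have h2 := h p
      rw [Nn.succ_le_iff] at h2
      have := Nn.lt_succ i
      grind [Nn.succ_inj]

/-- In ascending order the roles are exchanged: the face omitting `i` is already filled and the face
omitting `i + 1` is the missing one. -/
theorem lower_horn {i : Nn M} (hi : i ≤ n) {c : Arr M} (hc : c.top ≤ n.succ) :
    c.InHorn n.succ i.succ ↔ ¬ ((Arr.deg n i).comp c).Onto n ∨
      Lower i ((Arr.deg n i).comp c) ((Arr.cut n i).comp c) := by
  have key := fun p => Arr.prism_cases (i := i) hc p
  have h01 := Nn.zero_ne_one (M := M)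
  constructor
  · rintro ⟨j, hj, hji, hne⟩
    rcases lt_trichotomy j i with h | h | h
    · refine Or.inl fun ho => ?_
      obtain ⟨p, hp⟩ := ho j (h.le.trans hi)
      have := key p
      have := hne p
      grind
    · refine Or.inr fun p hp => ?_
      have := key p
      have := hne p
      grind
    · rcases Nn.zero_or_succ j with rfl | ⟨m, rfl⟩
      · exact absurd h (not_lt.2 (Nn.zero_le _))
      rw [Nn.lt_succ_iff] at h
      refine Or.inl fun ho => ?_
      obtain ⟨p, hp⟩ := ho m (Nn.succ_le_succ.1 hj)
      have := key p
      have := hne p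
      grind
  · rintro (ho | h)
    · simp only [Arr.Onto, not_forall, not_exists] at ho
      obtain ⟨j, hj, hne⟩ := ho
      rcases le_or_gt j i with h | h
      · refine ⟨j, hj.trans (Nn.lt_succ _).le, (lt_of_le_of_lt h (Nn.lt_succ _)).ne, fun p => ?_⟩
        have := key p
        have := hne p
        grind [Nn.lt_succ_iff]
      · refine ⟨j.succ, Nn.succ_le_succ.2 hj, fun e => h.ne' (Nn.succ_inj.1 e), fun p => ?_⟩
        have := key p
        have := hne p
        have := Nn.lt_succ j
        grind [Nn.succ_inj]
    · refine ⟨i, hi.trans (Nn.lt_succ _).le, (Nn.lt_succ _).ne, fun p hp => ?_⟩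
      have h1 := key p
      have h2 := h p
      have := Nn.lt_succ i
      grind [Nn.lt_succ_iff]

/-- If `Upper i` holds but `Upper i.succ` fails, then `a` takes the value `i` at some place on the
top part. By monotonicity the bottom part stays at or below `i`, and `prism_lift` applies. -/
theorem upper_step {i : Nn M} {a t : Arr M} (ha : a.top ≤ n) (ht : t.top ≤ 1)
    (hd : t.dom = a.dom) : Upper i a t ↔ Upper i.succ a t ∨
      ∃ c : Arr M, c.top ≤ n.succ ∧ a = (Arr.deg n i).comp c ∧ t = (Arr.cut n i).comp c := by
  constructor
  · intro h
    by_cases h1 : Upper i.succ a t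
    · exact Or.inl h1
    · simp only [Upper, not_forall, not_le] at h1
      obtain ⟨q, hq, hlt⟩ := h1
      have hai : a q = i := le_antisymm (Nn.lt_succ_iff.1 hlt) (h q hq)
      obtain ⟨c, hc, e1, e2⟩ := Arr.prism_lift ha ht hd (fun p hp => by
        rw [← hai]
        refine a.mono (le_of_not_gt fun hlt => ?_)
        have := t.mono hlt.le
        rw [hp, hq] at this
        exact absurd this (not_le.2 Nn.zero_lt_one)) h
      exact Or.inr ⟨c, hc, e1.symm, e2.symm⟩
  · rintro (h | ⟨c, hc, rfl, rfl⟩)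
    · exact fun p hp => (Nn.lt_succ i).le.trans (h p hp)
    · intro p hp
      have := Arr.prism_cases (i := i) hc p
      have h01 := Nn.zero_ne_one (M := M)
      grind

theorem lower_step {i : Nn M} {a t : Arr M} (ha : a.top ≤ n) (ht : t.top ≤ 1)
    (hd : t.dom = a.dom) : Lower i.succ a t ↔ Lower i a t ∨
      ∃ c : Arr M, c.top ≤ n.succ ∧ a = (Arr.deg n i).comp c ∧ t = (Arr.cut n i).comp c := by
  constructor
  · intro h
    by_cases h1 : Lower i a t
    · exact Or.inl h1
    · simp only [Lower, not_forall, not_lt] at h1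
      obtain ⟨q, hq, hlt⟩ := h1
      have hai : a q = i := le_antisymm (Nn.lt_succ_iff.1 (h q hq)) hlt
      obtain ⟨c, hc, e1, e2⟩ := Arr.prism_lift ha ht hd
        (fun p hp => Nn.lt_succ_iff.1 (h p hp)) (fun p hp => by
        rw [← hai]
        refine a.mono (le_of_not_gt fun hlt => ?_)
        have := t.mono hlt.le
        rw [hp, hq] at this
        exact absurd this (not_le.2 Nn.zero_lt_one))
      exact Or.inr ⟨c, hc, e1.symm, e2.symm⟩
  · rintro (h | ⟨c, hc, rfl, rfl⟩)
    · exact fun p hp => (h p hp).trans (Nn.lt_succ i)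
    · intro p hp
      have := Arr.prism_cases (i := i) hc p
      have h01 := Nn.zero_ne_one (M := M)
      grind [Nn.lt_succ_iff]

/-- The `n + 1` simplices of the prism over `x` are filled one after the other: downwards from `n`
if the bottom of the cylinder is given, upwards from `0` if the top is given. -/
theorem exists_prism (hK : IsKan M K) (G : ISet M (Cyl M B × K)) (hG : IsPMap G)
    (hS : Internal M S) (hx : IsMinimal S x n) {ε : Nn M} (hε : ε = 0 ∨ ε = 1)
    (hd : ∀ e, Dom G e ↔ S e.fst ∨ ∀ p, e.snd p = ε) :
    ∃ G' : ISet M (Cyl M B × K), IsPMap G' ∧ Incl G G' ∧ ∀ e, Dom G' e ↔ Dom G e ∨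
      ∃ a : Arr M, a.top ≤ n ∧ e.fst = x ⋆ a := by
  have hxa : ∀ a : Arr M, a.top ≤ n → a.top ≤ dim M x := fun a ha => by rwa [hx.dim_eq]
  have h01 := Nn.zero_ne_one (M := M)
  rcases hε with rfl | rfl
  · obtain ⟨G', h1, h2, h3⟩ := Nn.down_induction (P := fun i => ∃ G' : ISet M (Cyl M B × K),
      IsPMap G' ∧ Incl G G' ∧ ∀ e, Dom G' e ↔ (S e.fst ∨ ∀ p, e.snd p = 0) ∨
        ∃ a : Arr M, a.top ≤ n ∧ e.fst = x ⋆ a ∧ Upper i a e.snd) (by unfold Upper; exact internal)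
      n.succ
      -- No value of an arrow to `[n]` is as large as `n + 1`, so `Upper n.succ` leaves only the
      -- bottom of the prism, where `G` is defined. At the other end of the induction, `Upper 0` is
      -- no restriction.
      ⟨G, hG, Incl.refl G, fun e => by
        rw [hd]
        refine ⟨Or.inl, ?_⟩
        rintro (h | ⟨a, ha, he, hu⟩)
        · exact h
        · refine Or.inr fun p => (Nn.eq_zero_or_one ((e.snd.le_top p).trans e.snd_top_le)).resolve_right
            fun hp => ?_
          exact absurd ((hu p hp).trans ((a.le_top p).trans ha)) (not_le.2 (Nn.lt_succ n))⟩
      fun i hi ⟨G', h1, h2, h3⟩ => by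
        rw [Nn.lt_succ_iff] at hi
        obtain ⟨G'', h4, h5, h6⟩ := prism_step (Q := Upper i.succ) (Q' := Upper i) hK G' h1 hx hi
          (hi.trans (Nn.lt_succ n).le) (T := fun e => S e.fst ∨ ∀ p, e.snd p = 0)
          (fun e h => Or.inl h) (fun e a ha he h => h.imp_right fun h p hp =>
            absurd ((h p).symm.trans hp) h01) h3 (fun c hc => upper_horn hi hc)
          (fun a t ha ht hdt => upper_step ha ht hdt)
        exact ⟨G'', h4, fun p hp => h5 p (h2 p hp), h6⟩
    refine ⟨G', h1, h2, fun e => ?_⟩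
    rw [h3, hd]
    refine or_congr_right (exists_congr fun a => and_congr_right fun _ => ?_)
    exact ⟨fun h => h.1, fun h => ⟨h, fun p _ => Nn.zero_le _⟩⟩
  · obtain ⟨G', h1, h2, h3⟩ := Nn.up_induction (P := fun i => ∃ G' : ISet M (Cyl M B × K),
      IsPMap G' ∧ Incl G G' ∧ ∀ e, Dom G' e ↔ (S e.fst ∨ ∀ p, e.snd p = 1) ∨
        ∃ a : Arr M, a.top ≤ n ∧ e.fst = x ⋆ a ∧ Lower i a e.snd) (by unfold Lower; exact internal)
      n.succ
      ⟨G, hG, Incl.refl G, fun e => by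
        rw [hd]
        refine ⟨Or.inl, ?_⟩
        rintro (h | ⟨a, ha, he, hu⟩)
        · exact h
        · refine Or.inr fun p => (Nn.eq_zero_or_one ((e.snd.le_top p).trans e.snd_top_le)).resolve_left
            fun hp => ?_
          exact absurd (hu p hp) (not_lt.2 (Nn.zero_le _))⟩
      fun i hi ⟨G', h1, h2, h3⟩ => by
        rw [Nn.lt_succ_iff] at hi
        obtain ⟨G'', h4, h5, h6⟩ := prism_step (Q := Lower i) (Q' := Lower i.succ) hK G' h1 hx hi
          (Nn.succ_le_succ.2 hi) (T := fun e => S e.fst ∨ ∀ p, e.snd p = 1)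
          (fun e h => Or.inl h) (fun e a ha he h => h.imp_right fun h p hp =>
            absurd (hp.symm.trans (h p)) h01) h3 (fun c hc => lower_horn hi hc)
          (fun a t ha ht hdt => lower_step ha ht hdt)
        exact ⟨G'', h4, fun p hp => h5 p (h2 p hp), h6⟩
    refine ⟨G', h1, h2, fun e => ?_⟩
    rw [h3, hd]
    refine or_congr_right (exists_congr fun a => and_congr_right fun ha => ?_)
    exact ⟨fun h => h.1, fun h => ⟨h, fun p _ => Nn.lt_succ_iff.2 ((a.le_top p).trans ha)⟩⟩

end Prism

/-- The homotopy extension property: a partial map into a Kan complex which is defined on one end of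
a cylinder and on the cylinder of a subcomplex extends to the cylinder. -/
theorem exists_homotopy_extension (hK : IsKan M K) {ε : Nn M} (hε : ε = 0 ∨ ε = 1)
    (G : ISet M (Cyl M B × K)) (hG : IsPMap G) (hend : ∀ e, (∀ p, e.snd p = ε) → Dom G e)
    (hR : ∀ e e', Dom G e → (¬ (∀ p, e.snd p = ε) ∧ e.fst = e'.fst) → Dom G e') :
    ∃ f : Cyl M B → K, IsSMap M f ∧ ∀ e κ, G (e, κ) → f e = κ := by
  -- This closure condition makes every domain the union of the given end and of the full cylinder
  -- over some `S`.
  refine exists_total_extension (fun e e' => ¬ (∀ p, e.snd p = ε) ∧ e.fst = e'.fst) internal G hG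
    hR fun H hH hGH hHR hnt => ?_
  obtain ⟨δ, hδ, hδε⟩ : ∃ δ : Nn M, δ ≤ 1 ∧ δ ≠ ε := by
    rcases hε with rfl | rfl
    · exact ⟨1, le_rfl, Nn.zero_ne_one.symm⟩
    · exact ⟨0, Nn.zero_le _, Nn.zero_ne_one⟩
  -- `S` is read off at the end `δ` opposite to `ε`, where membership in the domain is not
  -- automatic.
  let S : B → Prop := fun b => Dom H (Cyl.endAt hδ b)
  have hS : Internal M S := by
    change Internal M fun b => Dom H (Cyl.endAt hδ b)
    fun_prop
  have hdom : ∀ e, Dom H e ↔ S e.fst ∨ ∀ p, e.snd p = ε := by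
    intro e
    by_cases he : ∀ p, e.snd p = ε
    · simp only [he, implies_true, or_true, iff_true]
      exact hGH.dom (hend e he)
    · simp only [he, or_false]
      exact ⟨fun h => hHR e _ h ⟨he, rfl⟩, fun h => hHR _ e h ⟨fun h' => hδε (h' 0), rfl⟩⟩
  have hnS : ∃ n : Nn M, ∃ b, dim M b = n ∧ ¬ S b := by
    obtain ⟨e, he⟩ := hnt
    rw [hdom, not_or] at he
    exact ⟨_, e.fst, rfl, he.1⟩
  -- A simplex of least dimension outside `S` has its whole boundary in `S`, so only its prism has
  -- to be filled.
  obtain ⟨n, ⟨x, hxn, hxS⟩, hmin⟩ := Nn.exists_least (by fun_prop) hnS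
  have hx : IsMinimal S x n := ⟨fun b a hb ha => by
      have := hH.dom_act hb (a := a) ha
      rwa [Cyl.endAt_act ha] at this, hxn, hxS, fun b hb => by
      by_contra h
      exact hmin _ hb ⟨b, rfl, h⟩⟩
  obtain ⟨H', h1, h2, h3⟩ := exists_prism hK H hH hS hx hε hdom
  refine ⟨H', h1, h2, fun e e' he hr => ?_, Cyl.endAt hδ x, ?_, hxS⟩
  · rw [h3] at he ⊢
    rcases he with he | ⟨a, ha, he⟩
    · exact Or.inl (hHR e e' he hr)
    · exact Or.inr ⟨a, ha, hr.2 ▸ he⟩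
  · rw [h3]
    refine Or.inr ⟨Arr.id M n, by simp, ?_⟩
    rw [Cyl.endAt_fst, ← hxn, act_id]

end

/-! ### The pushout product of a horn with the ends of an interval -/

section

variable {M : Type} [MacModel M]

variable {K B : Type} [Coded M K] [Coded M B] [SSet M K] [SSet M B]

/-! ### Extension from the union of a cylinder on a horn and the ends of the cylinder -/

/-- Extension of a partial map to a deformation retract of a cylinder. -/
theorem exists_extension_of_retract (hK : IsKan M K) {ε : Nn M} (hε : ε = 0 ∨ ε = 1)
    (G : ISet M (B × K)) (hG : IsPMap G) {r : Cyl M B → B} {s : B → Cyl M B} (hr : IsSMap M r)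
    (hs : IsSMap M s) (hsf : ∀ b, (s b).fst = b) (hrs : ∀ b, r (s b) = b)
    (h1 : ∀ e : Cyl M B, Dom G e.fst → Dom G (r e))
    (h2 : ∀ e : Cyl M B, (∀ p, e.snd p = ε) → Dom G (r e)) :
    ∃ l : B → K, IsSMap M l ∧ ∀ e κ, G (e, κ) → l e = κ := by
  have ir := hr.internal
  -- `G` composed with `r`, on the cylinder over its domain and on the end `ε`. The hypotheses say
  -- that `r` maps this part into the domain; an extension to the whole cylinder restricts along `s`
  -- to an extension of `G`.
  let G₀ : ISet M (Cyl M B × K) :=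
    ⟨fun p => (Dom G p.1.fst ∨ ∀ i, p.1.snd i = ε) ∧ G (r p.1, p.2), internal⟩
  have hd : ∀ e, Dom G₀ e ↔ Dom G e.fst ∨ ∀ i, e.snd i = ε := fun e => by
    constructor
    · rintro ⟨κ, h, _⟩
      exact h
    · intro h
      obtain ⟨κ, hκ⟩ : Dom G (r e) := h.elim (h1 e) (h2 e)
      exact ⟨κ, h, hκ⟩
  obtain ⟨f, hf, hf'⟩ := exists_homotopy_extension hK hε G₀
    ⟨fun e κ h => by rw [← hG.dim_eq _ _ h.2, hr.dim], fun e κ a h ha => by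
        refine ⟨?_, ?_⟩
        · rw [Cyl.act_fst ha, Cyl.act_snd ha]
          exact h.1.imp (fun h => hG.dom_act h ha) fun h i => h _
        · change G (r (e ⋆ a), κ ⋆ a)
          rw [hr.act _ _ ha]
          exact hG.act _ _ _ h.2 (by rwa [hr.dim]),
      fun e κ κ' h h' => hG.func _ _ _ h.2 h'.2⟩
    (fun e h => (hd e).2 (Or.inr h))
    (fun e e' h h' => (hd e').2 (Or.inl (h'.2 ▸ ((hd e).1 h).resolve_right h'.1)))
  refine ⟨fun b => f (s b), hf.comp hs, fun b κ h => hf' _ _ ⟨Or.inl ?_, ?_⟩⟩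
  · rw [hsf]
    exact ⟨κ, h⟩
  · change G (r (s b), κ)
    rwa [hrs]

/-- The vertex map `m` defines a homotopy `Δ[n] × Δ[1] → Δ[n]` with section `v ↦ (v, q v)`. It moves
vertices only to `k` (`m_ne`), so it preserves each face omitting a vertex other than `k`, and its
end `ε` lies in one such face (`hi`). Taking the product with a further `Δ[1]` yields the retraction
needed in `exists_extension_of_retract`. -/
theorem exists_cylinder_horn_aux (hK : IsKan M K) {n k : Nn M} {ε : Nn M} (hε : ε = 0 ∨ ε = 1)
    (G : ISet M (Cyl M (std n).El × K)) (hG : IsPMap G) (hd : ∀ e, Dom G e ↔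
      e.fst.arr.InHorn n k ∨ (∀ p, e.snd p = 0) ∨ ∀ p, e.snd p = 1)
    {m : Nn M → Nn M → Nn M} {q : Nn M → Nn M} (hm : Internal M fun p : Nn M × Nn M => m p.1 p.2)
    (hq : Internal M q) (m_mono : ∀ v v' t t', v ≤ v' → t ≤ t' → m v t ≤ m v' t')
    (m_le : ∀ v t, v ≤ n → m v t ≤ n) (q_mono : ∀ v v', v ≤ v' → q v ≤ q v') (q_le : ∀ v, q v ≤ 1)
    (mq : ∀ v, m v (q v) = v) (m_ne : ∀ v t, m v t ≠ k → m v t = v)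
    (hi : ∃ i ≤ n, i ≠ k ∧ ∀ v, m v ε ≠ i) :
    ∃ l : Cyl M (std n).El → K, IsSMap M l ∧ ∀ e κ, G (e, κ) → l e = κ := by
  have hm' : ∀ {α : Type} [Coded M α] {f g : α → Nn M}, Internal M f → Internal M g →
      Internal M fun x => m (f x) (g x) := fun hf hg => hm.comp (hf.pair hg)
  let ρ : Arr M → Arr M → Arr M := fun a t => Arr.of a.dom (fun p => m (a p) (t p))
    (hm' (by fun_prop) (by fun_prop)) fun i j h _ => m_mono _ _ _ _ (a.mono h) (t.mono h)
  have hρ : Internal M fun p : Arr M × Arr M => ρ p.1 p.2 :=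
    Arr.internal_of (k := fun p : Arr M × Arr M => p.1.dom) (g := fun p v => m (p.1 v) (p.2 v))
      (by fun_prop) (hm' (by fun_prop) (by fun_prop)) _ _
  have ρ_apply : ∀ a t : Arr M, t.dom = a.dom → ∀ p, (ρ a t) p = m (a p) (t p) := by
    intro a t h p
    rw [a.stable, t.stable, h, (ρ a t).stable]
    exact Arr.of_apply (min_le_right _ _)
  have ρ_comp : ∀ a t c : Arr M, t.dom = a.dom → ρ (a.comp c) (t.comp c) = (ρ a t).comp c :=
    fun a t c h => Arr.ext_iff'.2 ⟨rfl, fun p => by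
      rw [ρ_apply (a.comp c) (t.comp c) rfl, Arr.comp_apply, Arr.comp_apply, Arr.comp_apply, ρ_apply _ _ h]⟩
  have ρ_top : ∀ a t : Arr M, a.top ≤ n → (ρ a t).top ≤ n := fun a t h => by
    rw [Arr.of_top]
    exact m_le _ _ h
  let τ : Arr M → Arr M := fun a => Arr.of a.dom (fun p => q (a p)) (by fun_prop)
    fun i j h _ => q_mono _ _ (a.mono h)
  have hτ : Internal M τ := Arr.internal_of (by fun_prop) (by fun_prop) _ _
  have τ_apply : ∀ (a : Arr M) p, (τ a) p = q (a p) := by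
    intro a p
    rw [a.stable, (τ a).stable]
    exact Arr.of_apply (min_le_right _ _)
  have τ_comp : ∀ a c : Arr M, τ (a.comp c) = (τ a).comp c :=
    fun a c => Arr.ext_iff'.2 ⟨rfl, fun p => by
      rw [τ_apply, Arr.comp_apply, Arr.comp_apply, τ_apply]⟩
  have dom_eq : ∀ e : Cyl M (Cyl M (std n).El), e.snd.dom = e.fst.fst.arr.dom := fun e => e.snd_dom
  let r : Cyl M (Cyl M (std n).El) → Cyl M (std n).El := fun e =>
    Cyl.mk ⟨ρ e.fst.fst.arr e.snd, ρ_top _ _ e.fst.fst.arr_mem⟩ e.fst.snd e.fst.snd_dom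
      e.fst.snd_top_le
  have ir : Internal M r := by
    refine Cyl.internal_mk ?_ (by fun_prop) _ _
    exact Internal.subMk (S := (std n).set) (hρ.comp (g := fun e : Cyl M (Cyl M (std n).El) =>
      (e.fst.fst.arr, e.snd)) (by fun_prop)) _
  have r_arr : ∀ e, (r e).fst.arr = ρ e.fst.fst.arr e.snd := fun _ => rfl
  have r_snd : ∀ e, (r e).snd = e.fst.snd := fun _ => rfl
  let s : Cyl M (std n).El → Cyl M (Cyl M (std n).El) := fun b =>
    Cyl.mk b (τ b.fst.arr) Arr.of_dom (by rw [Arr.of_top]; exact q_le _)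
  have s_fst : ∀ b, (s b).fst = b := fun _ => rfl
  have s_snd : ∀ b, (s b).snd = τ b.fst.arr := fun _ => rfl
  refine exists_extension_of_retract hK hε G hG (r := r) (s := s) ⟨ir, fun e => rfl, ?_⟩
    ⟨Cyl.internal_mk (by fun_prop) (by fun_prop) _ _, fun e => rfl, ?_⟩ s_fst ?_ ?_ ?_
  · intro e a ha
    have h1 : a.top ≤ dim M e.fst.fst := ha
    have h2 : a.top ≤ dim M (r e).fst := ha
    have h3 : a.top ≤ dim M e.fst := ha
    ext1
    · refine Sieve.El.ext ?_
      rw [Cyl.act_fst h2, Sieve.act_arr _ h2, r_arr, r_arr, Cyl.act_snd h3, Cyl.act_fst h3,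
        Cyl.act_fst h1, Sieve.act_arr _ h1, ρ_comp _ _ _ (dom_eq e)]
    · rw [Cyl.act_snd h2, r_snd, r_snd, Cyl.act_fst h3, Cyl.act_snd h1]
  · intro b a ha
    have h1 : a.top ≤ dim M b.fst := ha
    have h2 : a.top ≤ dim M (s b).fst := ha
    ext1
    · rw [Cyl.act_fst h2, s_fst, s_fst]
    · rw [Cyl.act_snd h2, s_snd, s_snd, Cyl.act_fst h1, Sieve.act_arr _ h1, τ_comp]
  · intro b
    ext1
    · refine Sieve.El.ext (Arr.ext_iff'.2 ⟨rfl, fun p => ?_⟩)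
      rw [r_arr, ρ_apply _ _ (dom_eq _), s_snd, s_fst, τ_apply, mq]
    · rw [r_snd, s_fst]
  · intro e h
    rw [hd] at h ⊢
    rw [r_snd]
    refine h.imp_left ?_
    rintro ⟨i, h1, h2, h3⟩
    refine ⟨i, h1, h2, fun p hp => h3 p ?_⟩
    rw [r_arr, ρ_apply _ _ (dom_eq _)] at hp
    rw [← hp]
    exact (m_ne _ _ (by rwa [hp])).symm
  · intro e h
    obtain ⟨i, h1, h2, h3⟩ := hi
    rw [hd]
    refine Or.inl ⟨i, h1, h2, fun p => ?_⟩
    rw [r_arr, ρ_apply _ _ (dom_eq _), h]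
    exact h3 _

/-- A map from the union of `Λ^k[n] × Δ[1]` and `Δ[n] × ∂Δ[1]` to a Kan complex extends to
`Δ[n] × Δ[1]`. -/
theorem exists_cylinder_horn (hK : IsKan M K) {n k : Nn M} (hn : 0 < n) (hk : k ≤ n)
    (G : ISet M (Cyl M (std n).El × K)) (hG : IsPMap G) (hd : ∀ e, Dom G e ↔
      e.fst.arr.InHorn n k ∨ (∀ p, e.snd p = 0) ∨ ∀ p, e.snd p = 1) :
    ∃ l : Cyl M (std n).El → K, IsSMap M l ∧ ∀ e κ, G (e, κ) → l e = κ := by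
  have h01 := Nn.zero_ne_one (M := M)
  have h0 := Nn.zero_le (M := M)
  rcases hk.lt_or_eq with hlt | rfl
  -- For `k < n` the homotopy starts from the map `v ↦ min v k`, which omits the vertex `n`, and
  -- ends at the identity.
  · refine exists_cylinder_horn_aux hK (ε := 0) (Or.inl rfl) G hG hd
      (m := fun v t => if t = 0 then min v k else v) (q := fun v => if v ≤ k then 0 else 1)
      (by fun_prop) (by fun_prop) ?_ ?_ ?_ ?_ ?_ ?_ ⟨n, le_rfl, hlt.ne', ?_⟩
    · intro v v' t t' h h'
      have := h0 t
      grind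
    · grind
    · intro v v' h
      have := h0 1
      grind
    · intro v
      have := h0 1
      grind
    · grind
    · grind
    · grind
  -- For `k = n` the homotopy leads from the identity to `v ↦ max v k`, which omits the vertex `0`
  -- since the dimension is positive.
  · refine exists_cylinder_horn_aux hK (ε := 1) (Or.inr rfl) G hG hd
      (m := fun v t => if t = 0 then v else max v k) (q := fun v => if v < k then 0 else 1)
      (by fun_prop) (by fun_prop) ?_ ?_ ?_ ?_ ?_ ?_ ⟨0, h0 _, hn.ne, ?_⟩
    · intro v v' t t' h h'
      have := h0 t
      grind
    · grind
    · intro v v' h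
      have := h0 1
      grind
    · intro v
      have := h0 1
      grind
    · grind
    · grind
    · grind

end

/-! ### Acyclicity of maps that attach cells along horns -/

section

variable {M : Type} [MacModel M]

variable {X Y Z K P : Type} [Coded M X] [Coded M Y] [Coded M Z] [Coded M K] [Coded M P]
  [SSet M X] [SSet M Y] [SSet M Z] [SSet M K]

/-! ### Homotopies and acyclic maps -/

variable (M) in
/-- One step homotopies. -/
def Homotopic (f g : X → K) : Prop := ∃ H : Cyl M X → K, IsSMap M H ∧
  (∀ c, (∀ p, c.snd p = 0) → H c = f c.fst) ∧ ∀ c, (∀ p, c.snd p = 1) → H c = g c.fst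

variable (M) in
/-- Acyclic maps: composition with the map is bijective on homotopy classes of maps to Kan
complexes. -/
def IsAcyc (f : X → Y) : Prop := ∀ (K : Type) [Coded M K] [SSet M K], IsKan M K →
  (∀ g : X → K, IsSMap M g → ∃ h : Y → K, IsSMap M h ∧ Homotopic M (fun x => h (f x)) g) ∧
  ∀ h h' : Y → K, IsSMap M h → IsSMap M h' →
    Homotopic M (fun x => h (f x)) (fun x => h' (f x)) → Homotopic M h h'

theorem Homotopic.refl {f : X → K} (hf : IsSMap M f) : Homotopic M f f :=
  ⟨fun c => f c.fst, hf.comp Cyl.isSMap_fst, fun _ _ => rfl, fun _ _ => rfl⟩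

/-! ### Cellular maps -/

/-- The simplicial set `Z` is obtained from the subcomplex `j : X → Z` by filling horns freely: every
other simplex is, uniquely, a face `c` of one of the cells `σ q`, where `c` is not in the horn. -/
structure IsCellular (j : X → Z) (n k : P → Nn M) (σ : P → Z) : Prop where
  map : IsSMap M j
  inj : ∀ x x', j x = j x' → x = x'
  int_n : Internal M n
  int_k : Internal M k
  int_σ : Internal M σ
  dim : ∀ q, dim M (σ q) = n q
  pos : ∀ q, 0 < n q
  le : ∀ q, k q ≤ n q
  ne : ∀ x q (c : Arr M), c.top ≤ n q → ¬ c.InHorn (n q) (k q) → j x ≠ σ q ⋆ c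
  cell_inj : ∀ q q' (c c' : Arr M), c.top ≤ n q → c'.top ≤ n q' → ¬ c.InHorn (n q) (k q) →
    ¬ c'.InHorn (n q') (k q') → σ q ⋆ c = σ q' ⋆ c' → q = q' ∧ c = c'
  ind : ∀ Q : Z → Prop, Internal M Q → (∀ x, Q (j x)) →
    (∀ q, (∀ c : Arr M, c.top ≤ n q → c.InHorn (n q) (k q) → Q (σ q ⋆ c)) →
      ∀ c : Arr M, c.top ≤ n q → ¬ c.InHorn (n q) (k q) → Q (σ q ⋆ c)) → ∀ z, Q z

namespace IsCellular

variable {j : X → Z} {n k : P → Nn M} {σ : P → Z}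

/-- Zorn's lemma replaces the induction over stages: as long as the domain is not everything, some
cell has its horn in the domain but is not itself there, and the Kan condition adds it. -/
theorem exists_extension (h : IsCellular j n k σ) (hK : IsKan M K) {g : X → K}
    (hg : IsSMap M g) : ∃ f : Z → K, IsSMap M f ∧ ∀ x, f (j x) = g x := by
  have i1 := h.map.internal
  have i2 := hg.internal
  have i3 := h.int_n
  have i4 := h.int_k
  have i5 := h.int_σ
  let G : ISet M (Z × K) := ⟨fun p => ∃ x, j x = p.1 ∧ g x = p.2, by fun_prop⟩
  have hG : IsPMap G := by
    refine ⟨?_, ?_, ?_⟩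
    · rintro _ _ ⟨x, rfl, rfl⟩
      rw [h.map.dim, hg.dim]
    · rintro _ _ a ⟨x, rfl, rfl⟩ ha
      rw [h.map.dim] at ha
      exact ⟨x ⋆ a, h.map.act _ _ ha, hg.act _ _ ha⟩
    · rintro _ _ _ ⟨x, rfl, rfl⟩ ⟨x', h', rfl⟩
      rw [h.inj _ _ h']
  -- A domain that contains one face of a cell outside the horn must contain all faces of the cell;
  -- hence no cell is ever partly filled.
  refine (exists_total_extension
    (fun z z' => ∃ (q : P) (c c' : Arr M), c.top ≤ n q ∧ ¬ c.InHorn (n q) (k q) ∧ c'.top ≤ n q ∧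
      z = σ q ⋆ c ∧ z' = σ q ⋆ c') internal G hG ?_ ?_).imp
      fun f hf => ⟨hf.1, fun x => hf.2 _ _ ⟨x, rfl, rfl⟩⟩
  · rintro _ _ ⟨_, x, rfl, rfl⟩ ⟨q, c, c', h1, h2, h3, h4, h5⟩
    exact absurd h4 (h.ne _ _ _ h1 h2)
  · intro H hH hGH hHR ⟨z, hz⟩
    -- Otherwise the domain would satisfy the premises of the induction principle `ind` and would be
    -- everything.
    obtain ⟨q, hq, hq'⟩ : ∃ q, (∀ c : Arr M, c.top ≤ n q → c.InHorn (n q) (k q) →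
        Dom H (σ q ⋆ c)) ∧ ¬ Dom H (σ q) := by
      by_contra! hc
      refine hz (h.ind (Dom H) (by fun_prop) (fun x => hGH.dom ⟨g x, x, rfl, rfl⟩)
        (fun q hq c hc' _ => hH.dom_act (hc q hq) ?_) z)
      rwa [h.dim]
    have hid : σ q = σ q ⋆ Arr.id M (n q) := by rw [← h.dim, act_id]
    obtain ⟨H', h1, h2, h3⟩ := exists_attach_simplex hK H hH (σ q) (n q) (k q) (h.pos q) (h.le q)
      (h.dim q) (fun c hc => ⟨fun hd => by
        by_contra hn
        exact hq' (hHR _ _ hd ⟨q, c, _, hc, hn, by simp, rfl, hid⟩), hq c hc⟩)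
      (fun c c' hc hc' hd he => (h.cell_inj q q c c' hc hc' (fun h' => hd (hq c hc h'))
        (fun h' => hd (he ▸ hq c' hc' h')) he).2)
    refine ⟨H', h1, h2, ?_, σ q, (h3 _).2 (Or.inr ⟨_, by simp, hid⟩), hq'⟩
    rintro e e' he ⟨q', c, c', h4, h5, h6, rfl, rfl⟩
    rcases (h3 _).1 he with he | ⟨d, hd, he'⟩
    · exact h2.dom (hHR _ _ he ⟨q', c, c', h4, h5, h6, rfl, rfl⟩)
    · by_cases hd' : d.InHorn (n q) (k q)
      · refine h2.dom (hHR _ _ (he' ▸ hq d hd hd') ⟨q', c, c', h4, h5, h6, rfl, rfl⟩)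
      · obtain ⟨rfl, rfl⟩ := h.cell_inj _ _ _ _ h4 hd h5 hd' he'
        exact (h3 _).2 (Or.inr ⟨c', h6, rfl⟩)

/-- The same argument on the cylinder over `Z`, starting from `f` and `f'` on the two ends and the
given homotopy on the cylinder over `X`; the extension over one cell is `exists_cylinder_horn`. -/
theorem homotopic (h : IsCellular j n k σ) (hK : IsKan M K) {f f' : Z → K}
    (hf : IsSMap M f) (hf' : IsSMap M f')
    (hff : Homotopic M (fun x => f (j x)) fun x => f' (j x)) : Homotopic M f f' := by
  obtain ⟨H₀, hH₀, hH0, hH1⟩ := hff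
  have h01 := Nn.zero_ne_one (M := M)
  have i1 := h.map.internal
  have i2 := hf.internal
  have i2' := hf'.internal
  have i3 := h.int_n
  have i4 := h.int_k
  have i5 := h.int_σ
  have i6 := hH₀.internal
  let G : ISet M (Cyl M Z × K) := ⟨fun p => ((∀ i, p.1.snd i = 0) ∧ f p.1.fst = p.2) ∨
    ((∀ i, p.1.snd i = 1) ∧ f' p.1.fst = p.2) ∨
    ∃ c : Cyl M X, (j c.fst = p.1.fst ∧ c.snd = p.1.snd) ∧ H₀ c = p.2, internal⟩
  have hG : IsPMap G := by
    refine ⟨?_, ?_, ?_⟩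
    · rintro e κ (⟨_, h'⟩ | ⟨_, h'⟩ | ⟨c, ⟨h1, h2⟩, rfl⟩)
      · obtain rfl : f e.fst = κ := h'
        rw [hf.dim]; rfl
      · obtain rfl : f' e.fst = κ := h'
        rw [hf'.dim]; rfl
      · rw [hH₀.dim, Cyl.dim_eq, Cyl.dim_eq, ← h1, h.map.dim]
    · rintro e κ a (⟨h', h''⟩ | ⟨h', h''⟩ | ⟨c, ⟨h1, h2⟩, rfl⟩) ha
      · obtain rfl : f e.fst = κ := h''
        refine Or.inl ⟨fun i => ?_, ?_⟩
        · change (e ⋆ a).snd i = 0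
          rw [Cyl.act_snd ha]
          exact h' _
        · change f (e ⋆ a).fst = _
          rw [Cyl.act_fst ha, hf.act _ _ ha]
      · obtain rfl : f' e.fst = κ := h''
        refine Or.inr (Or.inl ⟨fun i => ?_, ?_⟩)
        · change (e ⋆ a).snd i = 1
          rw [Cyl.act_snd ha]
          exact h' _
        · change f' (e ⋆ a).fst = _
          rw [Cyl.act_fst ha, hf'.act _ _ ha]
      · have ha' : a.top ≤ MacSet.dim M c.fst := by
          rw [← h.map.dim, h1]
          exact ha
        refine Or.inr (Or.inr ⟨c ⋆ a, ⟨?_, ?_⟩, ?_⟩)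
        · change _ = (e ⋆ a).fst
          rw [Cyl.act_fst ha, Cyl.act_fst ha', h.map.act _ _ ha', h1]
        · change _ = (e ⋆ a).snd
          rw [Cyl.act_snd ha, Cyl.act_snd ha', h2]
        · exact hH₀.act _ _ ha'
    · have aux0 : ∀ (e : Cyl M Z) κ, (∀ i, e.snd i = 0) → G (e, κ) → f e.fst = κ := by
        rintro e κ he (⟨_, h'⟩ | ⟨h', _⟩ | ⟨c, ⟨h1, h2⟩, rfl⟩)
        · exact h'
        · exact absurd ((he 0).symm.trans (h' 0)) h01
        · rw [hH0 c fun i => h2 ▸ he i, ← h1]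
      have aux1 : ∀ (e : Cyl M Z) κ, (∀ i, e.snd i = 1) → G (e, κ) → f' e.fst = κ := by
        rintro e κ he (⟨h', _⟩ | ⟨_, h'⟩ | ⟨c, ⟨h1, h2⟩, rfl⟩)
        · exact absurd ((h' 0).symm.trans (he 0)) h01
        · exact h'
        · rw [hH1 c fun i => h2 ▸ he i, ← h1]
      rintro e κ κ' h1 h2
      by_cases he : ∀ i, e.snd i = 0
      · rw [← aux0 e κ he h1, ← aux0 e κ' he h2]
      by_cases he' : ∀ i, e.snd i = 1
      · rw [← aux1 e κ he' h1, ← aux1 e κ' he' h2]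
      obtain ⟨c, ⟨h3, h4⟩, rfl⟩ := (h1.resolve_left fun h' => he h'.1).resolve_left fun h' => he' h'.1
      obtain ⟨c', ⟨h5, h6⟩, rfl⟩ := (h2.resolve_left fun h' => he h'.1).resolve_left fun h' => he' h'.1
      rw [Cyl.ext (h.inj _ _ (h3.trans h5.symm)) (h4.trans h6.symm)]
  refine (exists_total_extension
    (fun e e' : Cyl M Z => (¬ (∀ p, e.snd p = 0) ∧ ¬ ∀ p, e.snd p = 1) ∧
      ∃ (q : P) (c c' : Arr M), c.top ≤ n q ∧ ¬ c.InHorn (n q) (k q) ∧ c'.top ≤ n q ∧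
      e.fst = σ q ⋆ c ∧ e'.fst = σ q ⋆ c') internal G hG ?_ ?_).imp
      fun Γ hΓ => ⟨hΓ.1, fun c hc => hΓ.2 _ _ (Or.inl ⟨hc, rfl⟩),
        fun c hc => hΓ.2 _ _ (Or.inr (Or.inl ⟨hc, rfl⟩))⟩
  · rintro e e' ⟨κ, hκ⟩ ⟨⟨h0, h1⟩, q, c, c', h2, h3, h4, h5, h6⟩
    obtain ⟨d, ⟨h7, h8⟩, _⟩ := (hκ.resolve_left fun h' => h0 h'.1).resolve_left fun h' => h1 h'.1
    exact absurd (h7.trans h5) (h.ne _ _ _ h2 h3)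
  · intro H hH hGH hHR ⟨z, hz⟩
    obtain ⟨q, hq, hq'⟩ : ∃ q, (∀ e : Cyl M Z, (∃ c : Arr M, c.top ≤ n q ∧ c.InHorn (n q) (k q) ∧
        e.fst = σ q ⋆ c) → Dom H e) ∧ ∃ (e : Cyl M Z) (c : Arr M), c.top ≤ n q ∧
        ¬ c.InHorn (n q) (k q) ∧ e.fst = σ q ⋆ c ∧ ¬ Dom H e := by
      by_contra! hc
      refine hz (h.ind (fun z => ∀ e : Cyl M Z, e.fst = z → Dom H e) internal (fun x e he => ?_)
        (fun q hq c hc' hc'' e he => hc q (fun e he => ?_) e c hc' hc'' he) z.fst z rfl)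
      · refine hGH.dom ⟨_, Or.inr (Or.inr ⟨Cyl.mk x e.snd ?_ e.snd_top_le, ⟨he.symm, rfl⟩, rfl⟩)⟩
        rw [e.snd_dom, he, h.map.dim]
      · obtain ⟨c, h1, h2, h3⟩ := he
        exact hq c h1 h2 e h3
    have hY := isSMap_yoneda (σ q) (h.dim q)
    have iφ := (Cyl.isSMap_map hY).internal
    have φf : ∀ c, (Cyl.map hY c).fst = σ q ⋆ c.fst.arr := fun _ => rfl
    have φs : ∀ c, (Cyl.map hY c).snd = c.snd := fun _ => rfl
    have nonhorn : ∀ c : Cyl M (std (n q)).El, ¬ Dom H (Cyl.map hY c) →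
        ¬ c.fst.arr.InHorn (n q) (k q) := fun c hc hd =>
      hc (hq _ ⟨c.fst.arr, c.fst.arr_mem, hd, rfl⟩)
    obtain ⟨e₀, c₀, hc₀, hc₀', he₀, hd₀⟩ := hq'
    obtain ⟨l, hl, hl'⟩ := exists_cylinder_horn hK (h.pos q) (h.le q)
      ⟨fun p => H (Cyl.map hY p.1, p.2), by fun_prop⟩
      ⟨fun e κ h' => by rw [← hH.dim_eq _ _ h', (Cyl.isSMap_map hY).dim],
        fun e κ a h' ha => by
          have := hH.act _ _ a h' (by rwa [(Cyl.isSMap_map hY).dim])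
          rwa [← (Cyl.isSMap_map hY).act _ _ ha] at this,
        fun e κ κ' h1 h2 => hH.func _ _ _ h1 h2⟩
      (fun e => by
        change Dom H (Cyl.map hY e) ↔ _
        constructor
        · intro hd
          -- If the domain met the cylinder over the cell away from the horn and from both ends, the
          -- closure condition would put the missing simplex `e₀` into it.
          by_contra! hc
          refine hd₀ (hHR _ _ hd ⟨⟨?_, ?_⟩, q, e.fst.arr, c₀, e.fst.arr_mem, hc.1, hc₀, φf _, he₀⟩)
          · rw [φs]
            exact not_forall.2 hc.2.1
          · rw [φs]
            exact not_forall.2 hc.2.2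
        · rintro (hd | hd | hd)
          · exact hq _ ⟨_, e.fst.arr_mem, hd, rfl⟩
          · exact hGH.dom ⟨f (Cyl.map hY e).fst, Or.inl ⟨hd, rfl⟩⟩
          · exact hGH.dom ⟨f' (Cyl.map hY e).fst, Or.inr (Or.inl ⟨hd, rfl⟩)⟩)
    obtain ⟨H', h1, h2, h3⟩ := exists_attach H hH (Cyl.isSMap_map hY) hl
      (fun c κ hc => hl' _ _ hc) (fun c c' hd he => by
        have e1 : σ q ⋆ c.fst.arr = σ q ⋆ c'.fst.arr := congrArg (fun e : Cyl M Z => e.fst) he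
        have e2 : c.snd = c'.snd := congrArg (fun e : Cyl M Z => e.snd) he
        have e3 := (h.cell_inj q q _ _ c.fst.arr_mem c'.fst.arr_mem (nonhorn c hd)
          (nonhorn c' (he ▸ hd)) e1).2
        rw [Cyl.ext (Sieve.El.ext e3) e2])
    have cover : ∀ (e : Cyl M Z) (c : Arr M), c.top ≤ n q → e.fst = σ q ⋆ c → Dom H' e := by
      intro e c hc he
      refine (h3 e).2 (Or.inr ⟨Cyl.mk (⟨c, hc⟩ : (std (n q)).El) e.snd ?_ e.snd_top_le, ?_⟩)
      · rw [e.snd_dom, he, dim_act (by rw [h.dim]; exact hc)]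
        rfl
      · exact Cyl.ext he.symm rfl
    refine ⟨H', h1, h2, ?_, e₀, cover _ _ hc₀ he₀, hd₀⟩
    rintro e e' he ⟨hne, q', c, c', h4, h5, h6, h7, h8⟩
    rcases (h3 _).1 he with he | ⟨d, rfl⟩
    · exact h2.dom (hHR _ _ he ⟨hne, q', c, c', h4, h5, h6, h7, h8⟩)
    · by_cases hd' : d.fst.arr.InHorn (n q) (k q)
      · exact h2.dom (hHR _ _ (hq _ ⟨_, d.fst.arr_mem, hd', rfl⟩)
          ⟨hne, q', c, c', h4, h5, h6, h7, h8⟩)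
      · obtain ⟨rfl, -⟩ := h.cell_inj _ _ _ _ d.fst.arr_mem h4 hd' h5 h7
        exact cover _ _ h6 h8

theorem isAcyc (h : IsCellular j n k σ) : IsAcyc M j := fun K _ _ hK =>
  ⟨fun g hg => by
    obtain ⟨f, hf, hfg⟩ := h.exists_extension hK hg
    exact ⟨f, hf, by simp only [hfg]; exact Homotopic.refl hg⟩,
    fun _ _ hf hf' hff => h.homotopic hK hf hf' hff⟩

end IsCellular

end

/-! ### Free filling of horns by well-founded trees -/

section

variable {M : Type} [MacModel M]

variable {X Y α : Type} [Coded M X] [Coded M Y] [Coded M α] [SSet M X] [SSet M Y]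

/-! ### Well-founded trees -/

/-- Singletons. -/
def sing (a : α) : ISet M α := ⟨fun b => b = a, by fun_prop⟩

variable (M α) in
/-- The empty internal set. -/
def noneOf : ISet M α := ⟨fun _ => False, by fun_prop⟩

theorem sing_inj {a b : α} (h : (sing a : ISet M α) = sing b) : a = b := by
  have : (sing b : ISet M α) a := h ▸ (rfl : a = a)
  exact this

/-- Labels are triples with one singleton and two empty entries, which codes a disjoint sum by
products and subsets; the kinds of labels are told apart by this fact. -/
theorem sing_ne {a : α} (h : (sing a : ISet M α) = noneOf M α) : False := by
  have : noneOf M α a := h ▸ (rfl : a = a)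
  exact this

@[fun_prop]
theorem internal_sing : Internal M (sing : α → ISet M α) := by unfold sing; fun_prop

namespace Tree

variable (M X Y) in
/-- Labels: an arrow (an edge of a tree), or a simplex of `X` (a leaf), or `(n, k, y, a)` (a node). -/
abbrev Label : Type := ISet M (Arr M) × ISet M X × ISet M (Nn M × Nn M × Y × Arr M)

variable (M X Y) in
/-- The universe of trees: sets of sequences of labels. -/
abbrev Univ : Type := ISet M (IFun M (Nn M) (Label M X Y))

variable (M X Y) in
/-- Data `(n, k, y, h)` consisting of a horn `h` of type `Λ^k[n]` and an `n`-simplex `y`. -/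
def HornData : Type := Nn M × Nn M × Y × IFun M (Arr M) (Univ M X Y)

instance : Coded M (HornData M X Y) :=
  inferInstanceAs (Coded M (Nn M × Nn M × Y × IFun M (Arr M) (Univ M X Y)))

namespace HornData

def size (q : HornData M X Y) : Nn M := q.1
def corner (q : HornData M X Y) : Nn M := q.2.1
def base (q : HornData M X Y) : Y := q.2.2.1
def horn (q : HornData M X Y) : IFun M (Arr M) (Univ M X Y) := q.2.2.2

variable {β : Type} [Coded M β] {g : β → HornData M X Y}

theorem internal_tuple (hg : Internal M g) :
    Internal M fun x => (g x : Nn M × Nn M × Y × IFun M (Arr M) (Univ M X Y)) := hg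

@[fun_prop] theorem internal_size (hg : Internal M g) : Internal M fun x => (g x).size :=
  (internal_tuple hg).fst
@[fun_prop] theorem internal_corner (hg : Internal M g) : Internal M fun x => (g x).corner :=
  (internal_tuple hg).snd.fst
@[fun_prop] theorem internal_base (hg : Internal M g) : Internal M fun x => (g x).base :=
  (internal_tuple hg).snd.snd.fst
@[fun_prop] theorem internal_horn (hg : Internal M g) : Internal M fun x => (g x).horn :=
  (internal_tuple hg).snd.snd.snd

theorem ext {q q' : HornData M X Y} (h1 : q.size = q'.size) (h2 : q.corner = q'.corner)
    (h3 : q.base = q'.base) (h4 : q.horn = q'.horn) : q = q' :=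
  Prod.ext h1 (Prod.ext h2 (Prod.ext h3 h4))

end HornData

open HornData

/-- The label of an edge. -/
def edgeLabel (b : Arr M) : Label M X Y := (sing b, noneOf M _, noneOf M _)
/-- The label of a leaf. -/
def leafLabel (x : X) : Label M X Y := (noneOf M _, sing x, noneOf M _)
/-- The label of a node. -/
def nodeLabel (q : HornData M X Y) (a : Arr M) : Label M X Y :=
  (noneOf M _, noneOf M _, sing (q.size, q.corner, q.base, a))

@[fun_prop] theorem internal_edgeLabel : Internal M (edgeLabel : Arr M → Label M X Y) := by
  unfold edgeLabel; fun_prop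
@[fun_prop] theorem internal_leafLabel : Internal M (leafLabel : X → Label M X Y) := by
  unfold leafLabel; fun_prop
@[fun_prop] theorem internal_nodeLabel {β : Type} [Coded M β] {g : β → HornData M X Y}
    {g' : β → Arr M} (hg : Internal M g) (hg' : Internal M g') :
    Internal M fun x => nodeLabel (g x) (g' x) := by
  unfold nodeLabel; fun_prop

/-- The tree with one vertex. -/
def leaf (x : X) : Univ M X Y := ⟨fun w => w 0 = leafLabel x, by fun_prop⟩

/-- The tree with subtrees `q.horn b`. -/
def node (q : HornData M X Y) (a : Arr M) : Univ M X Y :=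
  ⟨fun w => w 0 = nodeLabel q a ∨ ∃ b : Arr M, w 0 = edgeLabel b ∧
    q.horn b ⟨fun i => w i.succ, by fun_prop⟩, by fun_prop⟩

variable {β : Type} [Coded M β]

@[fun_prop] theorem internal_leaf : Internal M (leaf : X → Univ M X Y) := by
  unfold leaf; fun_prop
@[fun_prop] theorem internal_node {g : β → HornData M X Y} {g' : β → Arr M} (hg : Internal M g)
    (hg' : Internal M g') : Internal M fun x => node (g x) (g' x) := by
  unfold node; fun_prop

theorem leaf_inj {x x' : X} (h : (leaf x : Univ M X Y) = leaf x') : x = x' := by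
  have : (leaf x' : Univ M X Y) ⟨fun _ => leafLabel x, by fun_prop⟩ :=
    h ▸ (rfl : (leafLabel x : Label M X Y) = leafLabel x)
  have e : (leafLabel x : Label M X Y) = leafLabel x' := this
  exact sing_inj (congrArg (fun l => l.2.1) e)

theorem leaf_ne_node {x : X} {q : HornData M X Y} {a : Arr M} (h : leaf x = node q a) : False := by
  have : node q a ⟨fun _ => leafLabel x, by fun_prop⟩ :=
    h ▸ (rfl : (leafLabel x : Label M X Y) = leafLabel x)
  rcases this with e | ⟨b, e, _⟩
  · have e : (leafLabel x : Label M X Y) = nodeLabel q a := e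
    exact sing_ne (congrArg (fun l => l.2.1) e)
  · have e : (leafLabel x : Label M X Y) = edgeLabel b := e
    exact sing_ne (congrArg (fun l => l.2.1) e)

/-- The label of the root and all subtrees can be read off from the set of sequences. So leaves and
nodes together embed into the single set `Univ`, although a node contains a whole function from
arrows to `Univ`; no tower of power sets is needed to hold all trees. -/
theorem node_inj {q q' : HornData M X Y} {a a' : Arr M} (h : node q a = node q' a') :
    q = q' ∧ a = a' := by
  have h1 : (q.size, q.corner, q.base, a) = (q'.size, q'.corner, q'.base, a') := by
    have : node q' a' ⟨fun _ => nodeLabel q a, by fun_prop⟩ :=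
      h ▸ (Or.inl rfl : (nodeLabel q a : Label M X Y) = nodeLabel q a ∨ _)
    rcases this with e | ⟨b, e, _⟩
    · have e : nodeLabel q a = nodeLabel q' a' := e
      exact sing_inj (congrArg (fun l => l.2.2) e)
    · have e : nodeLabel q a = edgeLabel b := e
      exact (sing_ne (congrArg (fun l => l.2.2) e)).elim
  -- Prefixing a sequence with the edge label `b` turns membership in the subtree at `b` into
  -- membership in the node.
  have key : ∀ (q : HornData M X Y) (a b : Arr M) (w : IFun M (Nn M) (Label M X Y)),
      node q a ⟨fun i => if i = 0 then edgeLabel b else w i.pred, by fun_prop⟩ ↔ q.horn b w := by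
    intro q a b w
    have e0 : ∀ b', (if (0 : Nn M) = 0 then edgeLabel b else w (Nn.pred 0)) = edgeLabel b' ↔
        b = b' := fun b' => by
      rw [if_pos rfl]
      exact ⟨fun e => sing_inj (congrArg (fun l : Label M X Y => l.1) e), fun e => e ▸ rfl⟩
    have e1 : (⟨fun i : Nn M => if i.succ = 0 then edgeLabel b else w i.succ.pred, by fun_prop⟩ :
        IFun M (Nn M) (Label M X Y)) = w := by
      refine IFun.ext fun i => ?_
      rw [IFun.mk_apply, if_neg Nn.succ_ne_zero, Nn.pred_succ]
    constructor
    · rintro (e | ⟨b', e, h'⟩)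
      · have e : (if (0 : Nn M) = 0 then edgeLabel b else w (Nn.pred 0)) = nodeLabel q a := e
        rw [if_pos rfl] at e
        exact (sing_ne (congrArg (fun l : Label M X Y => l.1) e)).elim
      · obtain rfl := (e0 b').1 e
        rwa [← e1]
    · intro h'
      refine Or.inr ⟨b, (e0 b).2 rfl, ?_⟩
      rwa [← e1] at h'
  simp only [Prod.mk.injEq] at h1
  refine ⟨HornData.ext h1.1 h1.2.1 h1.2.2.1 ?_, h1.2.2.2⟩
  ext b w
  rw [← key q a b w, ← key q' a' b w, h]

/-- The tree `u` is a simplex of dimension `m`. -/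
def DimRel (u : Univ M X Y) (m : Nn M) : Prop :=
  (∃ x, u = leaf x ∧ m = dim M x) ∨ ∃ q a, u = node q a ∧ m = a.dom

/-- The tree `u` is a simplex over `y`. -/
def MapRel (f : X → Y) (u : Univ M X Y) (y : Y) : Prop :=
  (∃ x, u = leaf x ∧ y = f x) ∨ ∃ q a, u = node q a ∧ y = q.base ⋆ a

/-- The arrow `b` sends the tree `u` to `v`. -/
def ActRel (u : Univ M X Y) (b : Arr M) (v : Univ M X Y) : Prop :=
  (∃ x, u = leaf x ∧ v = leaf (x ⋆ b)) ∨ ∃ q a, u = node q a ∧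
    (((a.comp b).InHorn q.size q.corner ∧ v = q.horn (a.comp b)) ∨
      ¬ (a.comp b).InHorn q.size q.corner ∧ v = node q (a.comp b))

section

variable {g g' : β → Univ M X Y} (hg : Internal M g) (hg' : Internal M g')
include hg

@[fun_prop]
theorem internal_dimRel {d : β → Nn M} (hd : Internal M d) :
    Internal M fun x => DimRel (g x) (d x) := by unfold DimRel; fun_prop
@[fun_prop]
theorem internal_mapRel {f : X → Y} (hf : Internal M f) {d : β → Y} (hd : Internal M d) :
    Internal M fun x => MapRel f (g x) (d x) := by unfold MapRel; fun_prop
include hg' in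
@[fun_prop]
theorem internal_actRel {d : β → Arr M} (hd : Internal M d) :
    Internal M fun x => ActRel (g x) (d x) (g' x) := by unfold ActRel; fun_prop

end

variable {x : X} {q : HornData M X Y} {a b : Arr M} {u v : Univ M X Y} {m : Nn M} {y : Y}
  {f : X → Y}

theorem dimRel_leaf : DimRel (leaf x : Univ M X Y) m ↔ m = dim M x := by
  refine ⟨?_, fun h => Or.inl ⟨x, rfl, h⟩⟩
  rintro (⟨x', h, rfl⟩ | ⟨q, a, h, rfl⟩)
  · rw [leaf_inj h]
  · exact (leaf_ne_node h).elim

theorem dimRel_node : DimRel (node q a) m ↔ m = a.dom := by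
  refine ⟨?_, fun h => Or.inr ⟨q, a, rfl, h⟩⟩
  rintro (⟨x', h, rfl⟩ | ⟨q, a, h, rfl⟩)
  · exact (leaf_ne_node h.symm).elim
  · rw [(node_inj h).2]

theorem mapRel_leaf : MapRel f (leaf x : Univ M X Y) y ↔ y = f x := by
  refine ⟨?_, fun h => Or.inl ⟨x, rfl, h⟩⟩
  rintro (⟨x', h, rfl⟩ | ⟨q, a, h, rfl⟩)
  · rw [leaf_inj h]
  · exact (leaf_ne_node h).elim

theorem mapRel_node : MapRel f (node q a) y ↔ y = q.base ⋆ a := by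
  refine ⟨?_, fun h => Or.inr ⟨q, a, rfl, h⟩⟩
  rintro (⟨x', h, rfl⟩ | ⟨q, a, h, rfl⟩)
  · exact (leaf_ne_node h.symm).elim
  · rw [(node_inj h).1, (node_inj h).2]

theorem actRel_leaf : ActRel (leaf x) b v ↔ v = leaf (x ⋆ b) := by
  refine ⟨?_, fun h => Or.inl ⟨x, rfl, h⟩⟩
  rintro (⟨x', h, rfl⟩ | ⟨q, a, h, _⟩)
  · rw [leaf_inj h]
  · exact (leaf_ne_node h).elim

theorem actRel_node : ActRel (node q a) b v ↔
    v = if (a.comp b).InHorn q.size q.corner then q.horn (a.comp b) else node q (a.comp b) := by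
  constructor
  · rintro (⟨x', h, rfl⟩ | ⟨q, a, h, h'⟩)
    · exact (leaf_ne_node h.symm).elim
    · obtain ⟨rfl, rfl⟩ := node_inj h
      rcases h' with ⟨h1, h2⟩ | ⟨h1, h2⟩
      · rwa [if_pos h1]
      · rwa [if_neg h1]
  · intro h
    refine Or.inr ⟨q, a, rfl, ?_⟩
    split_ifs at h with h1
    · exact Or.inl ⟨h1, h⟩
    · exact Or.inr ⟨h1, h⟩

/-- The data describe a commutative square from a horn inclusion to the map to be constructed. -/
def Valid (f : X → Y) (S : ISet M (Univ M X Y)) (q : HornData M X Y) : Prop :=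
  (0 < q.size ∧ q.corner ≤ q.size ∧ dim M q.base = q.size) ∧ ∀ c : Arr M, c.top ≤ q.size →
    -- Dimension, projection and action are relations on arbitrary trees, so `S` occurs only
    -- positively and validity is monotone in `S`. Values of `q.horn` off the horn are not
    -- constrained.
    c.InHorn q.size q.corner → (S (q.horn c) ∧ DimRel (q.horn c) c.dom ∧
      MapRel f (q.horn c) (q.base ⋆ c)) ∧
      ∀ b : Arr M, b.top ≤ c.dom → ActRel (q.horn c) b (q.horn (c.comp b))

@[fun_prop]
theorem internal_valid {f : X → Y} (hf : Internal M f) {g : β → ISet M (Univ M X Y)}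
    {g' : β → HornData M X Y} (hg : Internal M g) (hg' : Internal M g') :
    Internal M fun x => Valid f (g x) (g' x) := by
  unfold Valid
  exact internal

theorem Valid.mono {S S' : ISet M (Univ M X Y)} (h : Valid f S q) (hS : ∀ u, S u → S' u) :
    Valid f S' q :=
  ⟨h.1, fun c hc hc' => ⟨⟨hS _ (h.2 c hc hc').1.1, (h.2 c hc hc').1.2⟩, (h.2 c hc hc').2⟩⟩

/-- All trees needed in the construction belong to the set. -/
def Closed (f : X → Y) (S : ISet M (Univ M X Y)) : Prop :=
  (∀ x, S (leaf x)) ∧ ∀ (q : HornData M X Y) (a : Arr M), Valid f S q → a.top ≤ q.size →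
    ¬ a.InHorn q.size q.corner → S (node q a)

/-- The least closed set of trees. -/
def good (hf : IsSMap M f) : ISet M (Univ M X Y) :=
  ⟨fun u => ∀ S : ISet M (Univ M X Y), Closed f S → S u, by
    have := hf.internal
    unfold Closed
    exact internal⟩

/-- The Knaster–Tarski argument: by monotonicity of `Valid`, the intersection of all closed sets is
closed. -/
theorem closed_good (hf : IsSMap M f) : Closed f (good hf) :=
  ⟨fun x _ hS => hS.1 x, fun q a hq ha ha' S hS => hS.2 q a (hq.mono fun _ hu => hu S hS) ha ha'⟩

end Tree

open MacSet.Tree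

/-- The simplices of the free filling of horns. -/
def Tree {f : X → Y} (hf : IsSMap M f) : Type := Sub (good hf)

namespace Tree

variable {f : X → Y} {hf : IsSMap M f}

instance : Coded M (Tree hf) := inferInstanceAs (Coded M (Sub (good hf)))

/-- The underlying tree. -/
def val (z : Tree hf) : Univ M X Y := Sub.val z

theorem ext {z z' : Tree hf} (h : z.val = z'.val) : z = z' := Sub.ext h

theorem internal_val' : Internal M (val : Tree hf → Univ M X Y) := Internal.val' (S := good hf)

@[fun_prop]
theorem internal_val {β : Type} [Coded M β] {g : β → Tree hf} (hg : Internal M g) :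
    Internal M fun x => (g x).val := internal_val'.comp hg

variable (hf) in
/-- The horns in the simplicial set under construction. -/
def Cell : Type := Sub (⟨fun q => Valid f (good hf) q, by
  have := hf.internal
  fun_prop⟩ : ISet M (HornData M X Y))

instance : Coded M (Cell hf) := inferInstanceAs (Coded M (Sub _))

/-- The underlying horn data. -/
def Cell.data (q : Cell hf) : HornData M X Y := Sub.val q

theorem Cell.valid (q : Cell hf) : Valid f (good hf) q.data := Sub.mem q

theorem Cell.internal_data' : Internal M (Cell.data : Cell hf → HornData M X Y) := Internal.val'

@[fun_prop]
theorem Cell.internal_data {β : Type} [Coded M β] {g : β → Cell hf} (hg : Internal M g) :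
    Internal M fun x => (g x).data := Cell.internal_data'.comp hg

/-- The inclusion of `X`. -/
def inl (x : X) : Tree hf := ⟨leaf x, (closed_good hf).1 x⟩

/-- A face, not in the horn, of a simplex filling a horn. -/
def face (q : Cell hf) (a : Arr M) (ha : a.top ≤ q.data.size)
    (ha' : ¬ a.InHorn q.data.size q.data.corner) : Tree hf :=
  ⟨node q.data a, (closed_good hf).2 q.data a q.valid ha ha'⟩

/-- A face, in the horn, of a simplex filling a horn. -/
def hornFace (q : Cell hf) (a : Arr M) (ha : a.top ≤ q.data.size)
    (ha' : a.InHorn q.data.size q.data.corner) : Tree hf :=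
  ⟨q.data.horn a, (q.valid.2 a ha ha').1.1⟩

theorem inl_val {x : X} : (inl x : Tree hf).val = leaf x := rfl
theorem face_val {q : Cell hf} {a : Arr M} {ha ha'} : (face q a ha ha').val = node q.data a := rfl

/-- The good trees satisfying `Q` form a closed set, and `good` is the least one. -/
theorem induction {Q : Tree hf → Prop} (hQ : Internal M Q) (h1 : ∀ x, Q (inl x))
    (h2 : ∀ q : Cell hf, (∀ c hc hc', Q (hornFace q c hc hc')) → ∀ a ha ha', Q (face q a ha ha'))
    (z : Tree hf) : Q z := by
  have hS : Internal M fun u => good hf u ∧ ∃ z : Tree hf, z.val = u ∧ Q z := by fun_prop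
  obtain ⟨z', h, h'⟩ := ((Sub.mem z : good hf z.val) ⟨_, hS⟩
    ⟨fun x => ⟨(closed_good hf).1 x, _, rfl, h1 x⟩, fun q a hq ha ha' => by
      have hq' : Valid f (good hf) q := hq.mono fun u hu => hu.1
      refine ⟨(closed_good hf).2 q a hq' ha ha', _, rfl, h2 ⟨q, hq'⟩ (fun c hc hc' => ?_) a ha ha'⟩
      obtain ⟨-, z', h, h'⟩ := (hq.2 c hc hc').1.1
      have e : z' = hornFace (⟨q, hq'⟩ : Cell hf) c hc hc' := ext h
      exact e ▸ h'⟩).2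
  rwa [← ext h]

theorem cases (z : Tree hf) : (∃ x, z = inl x) ∨ ∃ q a ha ha', z = face q a ha ha' := by
  have e : ∀ z : Tree hf, ((∃ x, z.val = leaf x) ∨ ∃ (q : Cell hf) (a : Arr M),
      a.top ≤ q.data.size ∧ ¬ a.InHorn q.data.size q.data.corner ∧ z.val = node q.data a) := by
    refine induction internal (fun x => Or.inl ⟨x, rfl⟩) fun q _ a ha ha' =>
      Or.inr ⟨q, a, ha, ha', rfl⟩
  rcases e z with ⟨x, h⟩ | ⟨q, a, ha, ha', h⟩
  · exact Or.inl ⟨x, ext h⟩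
  · exact Or.inr ⟨q, a, ha, ha', ext h⟩

/-- The structure is defined by looking at the root alone, whose data are unique; no recursion on
trees is needed. -/
theorem exists_dim : ∃ d : IFun M (Tree hf) (Nn M), ∀ z m, d z = m ↔ DimRel z.val m :=
  exists_ifun (by fun_prop) fun z => by
    rcases z.cases with ⟨x, rfl⟩ | ⟨q, a, ha, ha', rfl⟩
    · simp only [inl_val, dimRel_leaf, exists_eq_left, imp_self, implies_true]
      exact ⟨_, rfl, fun _ h => h⟩
    · simp only [face_val, dimRel_node]
      exact ⟨_, rfl, fun _ h => h⟩

theorem exists_map : ∃ p : IFun M (Tree hf) Y, ∀ z y, p z = y ↔ MapRel f z.val y :=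
  exists_ifun (by have := hf.internal; fun_prop) fun z => by
    rcases z.cases with ⟨x, rfl⟩ | ⟨q, a, ha, ha', rfl⟩
    · simp only [inl_val, mapRel_leaf]
      exact ⟨_, rfl, fun _ h => h⟩
    · simp only [face_val, mapRel_node]
      exact ⟨_, rfl, fun _ h => h⟩

/-- The dimension. -/
def dimFun (z : Tree hf) : Nn M := exists_dim.choose z

theorem dimFun_eq {z : Tree hf} {m : Nn M} : dimFun z = m ↔ DimRel z.val m :=
  exists_dim.choose_spec z m

@[fun_prop]
theorem internal_dimFun : Internal M (dimFun : Tree hf → Nn M) := exists_dim.choose.int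

/-- The map to `Y`. -/
def proj (z : Tree hf) : Y := exists_map.choose z

theorem proj_eq {z : Tree hf} {y : Y} : proj z = y ↔ MapRel f z.val y :=
  exists_map.choose_spec z y

@[fun_prop]
theorem internal_proj : Internal M (proj : Tree hf → Y) := exists_map.choose.int

@[simp] theorem dimFun_inl {x : X} : dimFun (inl x : Tree hf) = dim M x :=
  dimFun_eq.2 (dimRel_leaf.2 rfl)
@[simp] theorem dimFun_face {q : Cell hf} {a : Arr M} {ha ha'} :
    dimFun (face q a ha ha') = a.dom := dimFun_eq.2 (dimRel_node.2 rfl)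
@[simp] theorem dimFun_hornFace {q : Cell hf} {a : Arr M} {ha ha'} :
    dimFun (hornFace q a ha ha') = a.dom := dimFun_eq.2 (q.valid.2 a ha ha').1.2.1
@[simp] theorem proj_inl {x : X} : proj (inl x : Tree hf) = f x :=
  proj_eq.2 (mapRel_leaf.2 rfl)
@[simp] theorem proj_face {q : Cell hf} {a : Arr M} {ha ha'} :
    proj (face q a ha ha') = q.data.base ⋆ a := proj_eq.2 (mapRel_node.2 rfl)
@[simp] theorem proj_hornFace {q : Cell hf} {a : Arr M} {ha ha'} :
    proj (hornFace q a ha ha') = q.data.base ⋆ a := proj_eq.2 (q.valid.2 a ha ha').1.2.2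

theorem exists_act : ∃ p : IFun M (Tree hf × Arr M) (Tree hf),
    ∀ z z', p z = z' ↔ ActRel z.1.val (z.2.trunc (dimFun z.1)) z'.val :=
  exists_ifun (by fun_prop) fun ⟨z, b⟩ => by
    have : ∀ b : Arr M, b.top ≤ dimFun z → ∃ z' : Tree hf, ActRel z.val b z'.val ∧
        ∀ z'' : Tree hf, ActRel z.val b z''.val → z'' = z' := by
      intro b hb
      rcases z.cases with ⟨x, rfl⟩ | ⟨q, a, ha, ha', rfl⟩
      · simp only [inl_val, actRel_leaf]
        exact ⟨inl (x ⋆ b), rfl, fun _ h => ext h⟩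
      · simp only [face_val, actRel_node]
        have hab := (Arr.comp_top_le (a := a) (b := b)).trans ha
        by_cases h : (a.comp b).InHorn q.data.size q.data.corner
        · simp only [if_pos h]
          exact ⟨hornFace q _ hab h, rfl, fun _ h => ext h⟩
        · simp only [if_neg h]
          exact ⟨face q _ hab h, rfl, fun _ h => ext h⟩
    exact this _ Arr.trunc_top_le

/-- The action. -/
def actFun (z : Tree hf) (b : Arr M) : Tree hf := exists_act.choose (z, b)

theorem internal_actFun : Internal M fun p : Tree hf × Arr M => actFun p.1 p.2 :=
  exists_act.choose.int

theorem actFun_eq {z z' : Tree hf} {b : Arr M} (hb : b.top ≤ dimFun z) :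
    actFun z b = z' ↔ ActRel z.val b z'.val := by
  have := exists_act.choose_spec (z, b) z'
  rwa [Arr.trunc_eq hb] at this

theorem actFun_inl {x : X} {b : Arr M} (hb : b.top ≤ dim M x) :
    actFun (inl x : Tree hf) b = inl (x ⋆ b) :=
  (actFun_eq (by rwa [dimFun_inl])).2 (actRel_leaf.2 rfl)

theorem actFun_face {q : Cell hf} {a b : Arr M} {ha ha'} (hb : b.top ≤ a.dom)
    (h : ¬ (a.comp b).InHorn q.data.size q.data.corner) :
    actFun (face q a ha ha') b = face q (a.comp b) (Arr.comp_top_le.trans ha) h :=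
  (actFun_eq (by rwa [dimFun_face])).2 (actRel_node.2 (by rw [if_neg h]; rfl))

theorem actFun_face_horn {q : Cell hf} {a b : Arr M} {ha ha'} (hb : b.top ≤ a.dom)
    (h : (a.comp b).InHorn q.data.size q.data.corner) :
    actFun (face q a ha ha') b = hornFace q (a.comp b) (Arr.comp_top_le.trans ha) h :=
  (actFun_eq (by rwa [dimFun_face])).2 (actRel_node.2 (by rw [if_pos h]; rfl))

theorem actFun_hornFace {q : Cell hf} {a b : Arr M} {ha ha'} (hb : b.top ≤ a.dom) :
    actFun (hornFace q a ha ha') b = hornFace q (a.comp b) (Arr.comp_top_le.trans ha) (ha'.comp b) :=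
  (actFun_eq (by rwa [dimFun_hornFace])).2 ((q.valid.2 a ha ha').2 b hb)

instance : SSet M (Tree hf) where
  dim := dimFun
  act := actFun
  internal_dim := internal_dimFun
  internal_act := internal_actFun
  dim_act z b hb := by
    rcases z.cases with ⟨x, rfl⟩ | ⟨q, a, ha, ha', rfl⟩
    · rw [dimFun_inl] at hb
      rw [actFun_inl hb, dimFun_inl, dim_act hb]
    · rw [dimFun_face] at hb
      by_cases h : (a.comp b).InHorn q.data.size q.data.corner
      · rw [actFun_face_horn hb h, dimFun_hornFace, Arr.comp_dom]
      · rw [actFun_face hb h, dimFun_face, Arr.comp_dom]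
  act_id z := by
    rcases z.cases with ⟨x, rfl⟩ | ⟨q, a, ha, ha', rfl⟩
    · rw [dimFun_inl, actFun_inl (by simp), act_id]
    · rw [dimFun_face, actFun_face (by simp) (by rwa [Arr.comp_id])]
      simp only [Arr.comp_id]
  act_act z b c hb hc := by
    rcases z.cases with ⟨x, rfl⟩ | ⟨q, a, ha, ha', rfl⟩
    · rw [dimFun_inl] at hb
      rw [actFun_inl hb, actFun_inl (by rwa [dim_act hb]), actFun_inl (Arr.comp_top_le.trans hb),
        act_act hb hc]
    · rw [dimFun_face] at hb
      have hbc : (b.comp c).top ≤ a.dom := Arr.comp_top_le.trans hb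
      by_cases h : (a.comp b).InHorn q.data.size q.data.corner
      · rw [actFun_face_horn hb h, actFun_hornFace (a := a.comp b) hc, actFun_face_horn hbc (h.comp c)]
        rfl
      · rw [actFun_face hb h]
        by_cases h' : (a.comp (b.comp c)).InHorn q.data.size q.data.corner
        · rw [actFun_face_horn hbc h', actFun_face_horn (a := a.comp b) hc h']
          rfl
        · rw [actFun_face hbc h', actFun_face (a := a.comp b) hc h']
          rfl

theorem act_eq {z : Tree hf} {b : Arr M} : z ⋆ b = actFun z b := rfl
theorem dim_eq {z : Tree hf} : dim M z = dimFun z := rfl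

theorem isSMap_inl : IsSMap M (inl : X → Tree hf) where
  internal := Internal.subMk (S := good hf) (by fun_prop) _
  dim _ := dimFun_inl
  act _ _ ha := (actFun_inl ha).symm

theorem isSMap_proj : IsSMap M (proj : Tree hf → Y) where
  internal := internal_proj
  dim z := by
    rw [dim_eq]
    rcases z.cases with ⟨x, rfl⟩ | ⟨q, a, ha, ha', rfl⟩
    · rw [proj_inl, dimFun_inl, hf.dim]
    · rw [proj_face, dimFun_face, dim_act (by rwa [q.valid.1.2.2])]
  act z b hb := by
    rw [dim_eq] at hb
    rw [act_eq]
    rcases z.cases with ⟨x, rfl⟩ | ⟨q, a, ha, ha', rfl⟩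
    · rw [dimFun_inl] at hb
      rw [actFun_inl hb, proj_inl, proj_inl, hf.act _ _ hb]
    · rw [dimFun_face] at hb
      rw [proj_face, act_act (by rwa [q.valid.1.2.2]) hb]
      by_cases h : (a.comp b).InHorn q.data.size q.data.corner
      · rw [actFun_face_horn hb h, proj_hornFace]
      · rw [actFun_face hb h, proj_face]

/-- The simplex that fills the horn. -/
def filler (q : Cell hf) : Tree hf := face q (Arr.id M q.data.size) (by simp) Arr.not_inHorn_id

theorem filler_act {q : Cell hf} {a : Arr M} (ha : a.top ≤ q.data.size)
    (ha' : ¬ a.InHorn q.data.size q.data.corner) : filler q ⋆ a = face q a ha ha' := by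
  have e := Arr.id_comp ha
  rw [act_eq, filler, actFun_face (by simpa using ha) (by rwa [e])]
  simp only [e]

theorem filler_act_horn {q : Cell hf} {a : Arr M} (ha : a.top ≤ q.data.size)
    (ha' : a.InHorn q.data.size q.data.corner) : filler q ⋆ a = hornFace q a ha ha' := by
  have e := Arr.id_comp ha
  rw [act_eq, filler, actFun_face_horn (by simpa using ha) (by rwa [e])]
  simp only [e]

/-- Freeness is the injectivity of the tree constructors, and well-foundedness of the attachment is
tree induction. -/
theorem isCellular : IsCellular (inl : X → Tree hf) (fun q : Cell hf => q.data.size)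
    (fun q => q.data.corner) filler where
  map := isSMap_inl
  inj _ _ h := leaf_inj (congrArg val h)
  int_n := by fun_prop
  int_k := by fun_prop
  int_σ := Internal.subMk (S := good hf) (by fun_prop) _
  dim q := by rw [dim_eq, filler, dimFun_face, Arr.id_dom]
  pos q := q.valid.1.1
  le q := q.valid.1.2.1
  ne x q c hc hc' h := by
    rw [filler_act hc hc'] at h
    exact leaf_ne_node (congrArg val h)
  cell_inj q q' c c' h1 h2 h3 h4 h := by
    rw [filler_act h1 h3, filler_act h2 h4] at h
    obtain ⟨h5, h6⟩ := node_inj (congrArg val h)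
    exact ⟨Sub.ext h5, h6⟩
  ind Q hQ h1 h2 := induction hQ h1 fun q hq a ha ha' => by
    rw [← filler_act ha ha']
    refine h2 q (fun c hc hc' => ?_) a ha ha'
    rw [filler_act_horn hc hc']
    exact hq c hc hc'

/-- A horn in the set of trees over a simplex of `Y` is itself valid horn data, so its filler is
already among the trees. -/
theorem isKanFib_proj : IsKanFib (M := M) (proj : Tree hf → Y) := by
  intro n k G y hn hk hy hG hGy
  have := hf.internal
  -- The horn must be a function on all arrows; outside the horn it gets the empty set as default
  -- value.
  obtain ⟨h, hh⟩ := exists_ifun (M := M) (R := fun (c : Arr M) (u : Univ M X Y) =>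
    (∃ z : Tree hf, G (c, z) ∧ z.val = u) ∨ (¬ (∃ z : Tree hf, G (c, z)) ∧ u = noneOf M _))
    (by fun_prop) fun c => by
      by_cases hc : ∃ z : Tree hf, G (c, z)
      · obtain ⟨z, hz⟩ := hc
        refine ⟨z.val, Or.inl ⟨z, hz, rfl⟩, ?_⟩
        rintro _ (⟨z', hz', rfl⟩ | ⟨h', _⟩)
        · rw [hG.func _ _ _ hz hz']
        · exact absurd ⟨z, hz⟩ h'
      · refine ⟨_, Or.inr ⟨hc, rfl⟩, ?_⟩
        rintro _ (⟨z', hz', rfl⟩ | ⟨_, rfl⟩)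
        · exact absurd ⟨z', hz'⟩ hc
        · rfl
  have hGh : ∀ c z, G (c, z) → h c = z.val := fun c z hz => (hh _ _).2 (Or.inl ⟨z, hz, rfl⟩)
  let q : Cell hf := ⟨((n, k, y, h) : HornData M X Y), ⟨hn, hk, hy⟩, fun c hc hc' => by
    change c.top ≤ n at hc
    change c.InHorn n k at hc'
    obtain ⟨z, hz⟩ := hG.ex c hc hc'
    change (good hf (h c) ∧ DimRel (h c) _ ∧ MapRel f (h c) (y ⋆ c)) ∧
      ∀ b : Arr M, b.top ≤ c.dom → ActRel (h c) b (h (c.comp b))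
    rw [hGh c z hz]
    have hd : dimFun z = c.dom := hG.dim _ _ hz
    refine ⟨⟨Sub.mem z, dimFun_eq.1 hd, proj_eq.1 (hGy _ _ hz)⟩, fun b hb => ?_⟩
    rw [hGh _ _ (hG.act _ _ b hz hb)]
    exact (actFun_eq (by rwa [hd])).1 rfl⟩
  refine ⟨filler q, ?_, fun c z hz => ?_⟩
  · rw [filler, proj_face]
    change y ⋆ Arr.id M n = y
    rw [← hy, act_id]
  · obtain ⟨hc, hc'⟩ := hG.horn _ _ hz
    rw [filler_act_horn (q := q) hc hc']
    exact ext (hGh _ _ hz)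

end Tree

/-- Every simplicial map is an acyclic monic map followed by a Kan fibration. -/
theorem exists_factorization_acyclic_monic {f : X → Y} (hf : IsSMap M f) :
    ∃ (Z : Type) (_ : Coded M Z) (_ : SSet M Z) (j : X → Z) (p : Z → Y), IsSMap M j ∧ IsSMap M p ∧
      (∀ x, p (j x) = f x) ∧ (∀ x x', j x = j x' → x = x') ∧ IsAcyc M j ∧ IsKanFib (M := M) p :=
  ⟨Tree hf, inferInstance, inferInstance, Tree.inl, Tree.proj, Tree.isSMap_inl, Tree.isSMap_proj,
    fun _ => Tree.proj_inl, Tree.isCellular.inj, Tree.isCellular.isAcyc, Tree.isKanFib_proj⟩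

end

/-! ### Partial lifts and the acyclic fibration -/

section

variable {M : Type} [MacModel M]

variable {X Y Z : Type} [Coded M X] [Coded M Y] [Coded M Z] [SSet M X] [SSet M Y] [SSet M Z]

/-! ### Simplices with a partial lift -/

/-- A map with a section is acyclic if there is a homotopy from the idempotent to the identity. -/
theorem isAcyc_of_section {p : Z → Y} {q : Y → Z} (hq : IsSMap M q)
    (hpq : ∀ y, p (q y) = y) (h : Homotopic M (fun z => q (p z)) fun z => z) : IsAcyc M p := by
  obtain ⟨H, hH, h0, h1⟩ := h
  intro K _ _ _
  refine ⟨fun g hg => ⟨fun y => g (q y), hg.comp hq, fun c => g (H c), hg.comp hH,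
    fun c hc => congrArg g (h0 c hc),
    fun c hc => congrArg g (h1 c hc)⟩, ?_⟩
  rintro h h' _ _ ⟨H', hH', h0', h1'⟩
  refine ⟨fun c => H' (Cyl.map hq c), hH'.comp (Cyl.isSMap_map hq), fun c hc => ?_, fun c hc => ?_⟩
  · exact (h0' (Cyl.map hq c) hc).trans (congrArg h (hpq _))
  · exact (h1' (Cyl.map hq c) hc).trans (congrArg h' (hpq _))

/-- Pairs `(y, s)` of a simplex `y : Δ[n] → Y` and the graph `s` of a lift of `y` to `X`, defined on a
subcomplex of `Δ[n]`. -/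
def partialLifts {f : X → Y} (hf : IsSMap M f) : ISet M (Y × ISet M (Arr M × X)) :=
  ⟨fun z => (∀ a x, z.2 (a, x) → a.top ≤ dim M z.1 ∧ dim M x = a.dom ∧ f x = z.1 ⋆ a) ∧
    (∀ (a : Arr M) x (b : Arr M), z.2 (a, x) → b.top ≤ a.dom → z.2 (a.comp b, x ⋆ b)) ∧
    ∀ a x x', z.2 (a, x) → z.2 (a, x') → x = x', by
    have := hf.internal
    exact internal⟩

/-- The simplices of `Y` together with a partial lift to `X`. -/
def PLift {f : X → Y} (hf : IsSMap M f) : Type := Sub (partialLifts hf)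

namespace PLift

variable {f : X → Y} {hf : IsSMap M f}

instance : Coded M (PLift hf) := inferInstanceAs (Coded M (Sub (partialLifts hf)))

/-- The underlying simplex. -/
def base (z : PLift hf) : Y := (Sub.val z).1
/-- The partial lift. -/
def lift (z : PLift hf) : ISet M (Arr M × X) := (Sub.val z).2

@[ext] theorem ext {z z' : PLift hf} (h : z.base = z'.base) (h' : ∀ a x, z.lift (a, x) ↔ z'.lift (a, x)) :
    z = z' := Sub.ext (Prod.ext h (IFun.ext fun p => propext (h' p.1 p.2)))

theorem internal_val : Internal M fun z : PLift hf => Sub.val z :=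
  Internal.val' (S := partialLifts hf)
@[fun_prop] theorem internal_base : Internal M (base : PLift hf → Y) := internal_val.fst
@[fun_prop] theorem internal_lift : Internal M (lift : PLift hf → _) := internal_val.snd

theorem spec (z : PLift hf) {a : Arr M} {x : X} (h : z.lift (a, x)) :
    a.top ≤ dim M z.base ∧ dim M x = a.dom ∧ f x = z.base ⋆ a := (Sub.mem z).1 a x h
theorem lift_act (z : PLift hf) {a b : Arr M} {x : X} (h : z.lift (a, x)) (hb : b.top ≤ a.dom) :
    z.lift (a.comp b, x ⋆ b) := (Sub.mem z).2.1 a x b h hb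
theorem lift_func (z : PLift hf) {a : Arr M} {x x' : X} (h : z.lift (a, x)) (h' : z.lift (a, x')) :
    x = x' := (Sub.mem z).2.2 a x x' h h'

/-- The action of an arrow to `[dim z]`. -/
def restrict (z : PLift hf) (b : Arr M) (hb : b.top ≤ dim M z.base) : PLift hf :=
  ⟨(z.base ⋆ b, ⟨fun p => p.1.top ≤ b.dom ∧ z.lift (b.comp p.1, p.2), by fun_prop⟩),
    fun a x h => ⟨by rw [dim_act hb]; exact h.1, (z.spec h.2).2.1, by
      rw [act_act hb h.1]; exact (z.spec h.2).2.2⟩,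
    fun a x c h hc => ⟨Arr.comp_top_le.trans h.1, z.lift_act h.2 hc⟩,
    fun a x x' h h' => z.lift_func h.2 h'.2⟩

instance : SSet M (PLift hf) where
  dim z := dim M z.base
  act z b := z.restrict (b.trunc (dim M z.base)) Arr.trunc_top_le
  internal_dim := by fun_prop
  internal_act := by
    unfold restrict
    exact Internal.subMk (S := partialLifts hf) (by fun_prop) _
  dim_act z b hb := by
    change dim M (z.base ⋆ _) = _
    rw [Arr.trunc_eq hb, dim_act hb]
  act_id z := by
    have e : (Arr.id M (dim M z.base)).trunc (dim M z.base) = Arr.id M (dim M z.base) :=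
      Arr.trunc_eq (by simp)
    refine ext ?_ fun a x => ?_
    · change z.base ⋆ _ = _
      rw [e, act_id]
    · change _ ∧ z.lift (_, x) ↔ _
      simp only [e, Arr.id_dom]
      constructor
      · rintro ⟨h1, h2⟩
        rwa [Arr.id_comp h1] at h2
      · intro h
        have h1 := (z.spec h).1
        exact ⟨h1, by rwa [Arr.id_comp h1]⟩
  act_act z b c hb hc := by
    have hbc : (b.comp c).top ≤ dim M z.base := Arr.comp_top_le.trans hb
    have hc' : c.top ≤ dim M (z.base ⋆ b) := by rwa [dim_act hb]
    have e : ∀ b' : Arr M, b' = b → ∀ h', restrict (restrict z b' h')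
        (c.trunc (dim M (restrict z b' h').base)) Arr.trunc_top_le =
        restrict z (b.comp c) hbc := by
      rintro _ rfl h'
      have e : c.trunc (dim M (restrict z _ h').base) = c := Arr.trunc_eq hc'
      refine ext ?_ fun a x => ?_
      · change (z.base ⋆ _) ⋆ _ = _
        rw [e, act_act hb hc]
        rfl
      · change _ ∧ _ ∧ z.lift (Arr.comp _ (Arr.comp _ a), x) ↔ _ ∧ z.lift (_, x)
        simp only [e]
        refine and_congr_right fun ha => ?_
        rw [Arr.comp_assoc, and_iff_right]
        exact Arr.comp_top_le.trans hc
    refine (e _ (Arr.trunc_eq hb) _).trans ?_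
    simp only [Arr.trunc_eq hbc]

theorem act_base {z : PLift hf} {b : Arr M} (hb : b.top ≤ dim M z.base) :
    (z ⋆ b).base = z.base ⋆ b := congrArg (z.base ⋆ ·) (Arr.trunc_eq hb)

theorem act_lift {z : PLift hf} {b a : Arr M} {x : X} (hb : b.top ≤ dim M z.base) :
    (z ⋆ b).lift (a, x) ↔ a.top ≤ b.dom ∧ z.lift (b.comp a, x) := by
  change a.top ≤ (b.trunc _).dom ∧ z.lift ((b.trunc _).comp a, x) ↔ _
  rw [Arr.trunc_eq hb]

theorem isSMap_base : IsSMap M (base : PLift hf → Y) :=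
  ⟨by fun_prop, fun _ => rfl, fun _ _ h => act_base h⟩

/-- The partial lift defined by a simplex of `X`, which is defined everywhere. -/
def total (x : X) : PLift hf :=
  ⟨(f x, ⟨fun p => p.1.top ≤ dim M x ∧ p.2 = x ⋆ p.1, by fun_prop⟩), by
    rintro a x' ⟨h, h'⟩
    obtain rfl : x' = x ⋆ a := h'
    exact ⟨by rwa [hf.dim], dim_act h, hf.act _ _ h⟩, by
    rintro a x' b ⟨h, h'⟩ hb
    obtain rfl : x' = x ⋆ a := h'
    exact ⟨Arr.comp_top_le.trans h, act_act h hb⟩, by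
    rintro a x' x'' ⟨_, h⟩ ⟨_, h'⟩
    exact h.trans h'.symm⟩

theorem total_lift {x x' : X} {a : Arr M} :
    (total x : PLift hf).lift (a, x') ↔ a.top ≤ dim M x ∧ x' = x ⋆ a := Iff.rfl

theorem total_base {x : X} : (total x : PLift hf).base = f x := rfl

theorem isSMap_total : IsSMap M (total : X → PLift hf) where
  internal := by
    have := hf.internal
    exact Internal.subMk (S := partialLifts hf) (by fun_prop) _
  dim x := hf.dim x
  act x b hb := by
    have hb' : b.top ≤ dim M (total x : PLift hf).base := by rwa [total_base, hf.dim]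
    refine ext ?_ fun a x' => ?_
    · rw [act_base hb', total_base, total_base, hf.act _ _ hb]
    · rw [act_lift hb', total_lift, total_lift, dim_act hb]
      refine and_congr_right fun h => ?_
      rw [act_act hb h, and_iff_right (Arr.comp_top_le.trans hb)]

/-- The simplex is recovered as the value of the lift at the identity arrow. -/
theorem total_injective {x x' : X} (h : (total x : PLift hf) = total x') : x = x' := by
  have h1 : (total x : PLift hf).lift (Arr.id M (dim M x), x) := ⟨by simp, (act_id x).symm⟩
  rw [h] at h1
  have h2 : dim M x = dim M x' := by
    rw [← hf.dim, ← hf.dim, ← total_base (hf := hf), h, total_base]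
  have h3 := h1.2
  rwa [show Arr.id M (dim M x) = Arr.id M (dim M x') by rw [h2], act_id] at h3

/-- The partial lift that is nowhere defined. -/
def void (y : Y) : PLift hf :=
  ⟨(y, ⟨fun _ => False, by fun_prop⟩), fun _ _ h => h.elim, fun _ _ _ h => h.elim,
    fun _ _ _ h => h.elim⟩

theorem isSMap_void : IsSMap M (void : Y → PLift hf) where
  internal := Internal.subMk (S := partialLifts hf) (by fun_prop) _
  dim _ := rfl
  act y b hb := by
    refine ext ?_ fun a x' => ?_
    · rw [act_base hb]
      rfl
    · rw [act_lift hb]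
      exact ⟨fun h => h.elim, fun h => h.2⟩

/-- The restriction of a partial lift to a part of a standard simplex. -/
def contract (c : Cyl M (PLift hf)) : PLift hf :=
  -- The lift is kept on the arrows that land where `c.snd` has value `1`; these form a subcomplex
  -- of the simplex.
  ⟨(c.fst.base, ⟨fun p => c.fst.lift p ∧ ∀ i, c.snd (p.1 i) = 1, internal⟩),
    fun _ _ h => c.fst.spec h.1, fun _ _ _ h hb => ⟨c.fst.lift_act h.1 hb, fun _ => h.2 _⟩,
    fun _ _ _ h h' => c.fst.lift_func h.1 h'.1⟩

theorem contract_base {c : Cyl M (PLift hf)} : (contract c).base = c.fst.base := rfl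
theorem contract_lift {c : Cyl M (PLift hf)} {a : Arr M} {x : X} :
    (contract c).lift (a, x) ↔ c.fst.lift (a, x) ∧ ∀ i, c.snd (a i) = 1 := Iff.rfl

theorem isSMap_contract : IsSMap M (contract : Cyl M (PLift hf) → PLift hf) where
  internal := by
    refine Internal.subMk (S := partialLifts hf) (Internal.pair (by fun_prop)
      (Internal.mk ?_ _)) _
    exact internal
  dim _ := rfl
  act c b hb := by
    have hb' : b.top ≤ dim M (contract c).base := hb
    have hb'' : b.top ≤ dim M c.fst.base := hb
    refine ext ?_ fun a x' => ?_
    · rw [act_base hb', contract_base, contract_base, Cyl.act_fst hb, act_base hb'']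
    · rw [act_lift hb', contract_lift, contract_lift, Cyl.act_fst hb, act_lift hb'', Cyl.act_snd hb,
        and_assoc]
      rfl

/-- `contract` is a homotopy from `z ↦ void z.base`, since nothing of the lift survives at `0`, to
the identity, since all of it survives at `1`. -/
theorem isAcyc_base : IsAcyc M (base : PLift hf → Y) := by
  refine isAcyc_of_section isSMap_void (fun _ => rfl) ⟨contract, isSMap_contract,
    fun c hc => ext rfl fun a x => ?_, fun c hc => ext rfl fun a x => ?_⟩
  · rw [contract_lift]
    exact ⟨fun h => absurd ((hc _).symm.trans (h.2 0)) Nn.zero_ne_one, fun h => h.elim⟩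
  · rw [contract_lift]
    exact ⟨fun h => h.1, fun h => ⟨h, fun _ => hc _⟩⟩

/-- Partial lifts given on the faces of a horn agree on overlaps, so their union is a partial lift
on `Δ[n]`; it need not be defined outside the horn, and no filling in `X` is required. -/
theorem isKanFib_base : IsKanFib (M := M) (base : PLift hf → Y) := by
  intro n k G y hn hk hy hG hGy
  have := hf.internal
  have hd : ∀ {a z}, G (a, z) → dim M z.base = a.dom := fun h => hG.dim _ _ h
  have key : ∀ {a : Arr M} {z : PLift hf} {b : Arr M} {x : X}, G (a, z) → b.top ≤ a.dom →
      ((z ⋆ b).lift (Arr.id M b.dom, x) ↔ z.lift (b, x)) := fun hz hb => by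
    rw [act_lift (by rwa [hd hz]), Arr.comp_id, and_iff_right (by simp)]
  -- The value at `a` is the value of the partial lift over the face `a` at its identity arrow.
  let z : PLift hf := ⟨(y, ⟨fun p => ∃ ζ : PLift hf, G (p.1, ζ) ∧ ζ.lift (Arr.id M p.1.dom, p.2),
      by fun_prop⟩), ?_, ?_, ?_⟩
  · refine ⟨z, rfl, fun c ζ hζ => ?_⟩
    obtain ⟨hc, hc'⟩ := hG.horn _ _ hζ
    have hcz : c.top ≤ dim M z.base := by
      change c.top ≤ dim M y
      rwa [hy]
    refine ext ?_ fun a x => ?_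
    · rw [act_base hcz, hGy _ _ hζ]
      rfl
    · rw [act_lift hcz]
      constructor
      · rintro ⟨ha, ζ', h1, h2⟩
        rw [hG.func _ _ _ h1 (hG.act _ _ a hζ ha)] at h2
        exact (key hζ ha).1 h2
      · intro h
        have ha : a.top ≤ c.dom := by
          rw [← hd hζ]
          exact (ζ.spec h).1
        exact ⟨ha, _, hG.act _ _ a hζ ha, (key hζ ha).2 h⟩
  · rintro a x ⟨ζ, h1, h2⟩
    obtain ⟨-, h3, h4⟩ := ζ.spec h2
    refine ⟨?_, h3, ?_⟩
    · change a.top ≤ dim M y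
      rw [hy]
      exact (hG.horn _ _ h1).1
    · rw [← hd h1, act_id] at h4
      rw [h4, hGy _ _ h1]
  · rintro a x b ⟨ζ, h1, h2⟩ hb
    refine ⟨ζ ⋆ b, hG.act _ _ b h1 hb, (key h1 hb).2 ?_⟩
    have := ζ.lift_act h2 (b := b) hb
    rwa [Arr.id_comp hb] at this
  · rintro a x x' ⟨ζ, h1, h2⟩ ⟨ζ', h1', h2'⟩
    rw [hG.func _ _ _ h1' h1] at h2'
    exact ζ.lift_func h2 h2'

end PLift

/-- Every simplicial map is a monic map followed by an acyclic Kan fibration. -/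
theorem exists_factorization_acyclic_fibration {f : X → Y} (hf : IsSMap M f) :
    ∃ (Z : Type) (_ : Coded M Z) (_ : SSet M Z) (j : X → Z) (p : Z → Y), IsSMap M j ∧ IsSMap M p ∧
      (∀ x, p (j x) = f x) ∧ (∀ x x', j x = j x' → x = x') ∧ IsKanFib (M := M) p ∧ IsAcyc M p :=
  ⟨PLift hf, inferInstance, inferInstance, PLift.total, PLift.base, PLift.isSMap_total,
    PLift.isSMap_base, fun _ => rfl, fun _ _ => PLift.total_injective, PLift.isKanFib_base,
    PLift.isAcyc_base⟩

end

/-! ### Formulas about functions and arrows, interpreted in the model -/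

section

/-! ### Semantics of the set theoretic vocabulary -/

variable {M : Type} [MacModel M]

section

variable {n : ℕ} {v : ℕ → M} {a b c p r s x y z w k m : ℕ}

attribute [local simp] sat_all sat_ex sat_allIn sat_exIn sat_and sat_or sat_neg sat_imp sat_iff
  sat_mem sat_eq Function.update_self Function.update_of_ne

theorem sat_sub (hx : x < n) (hy : y < n) :
    Sat (sub x y) n v ↔ ∀ z, E z (v x) → E z (v y) := by
  simp (disch := omega) [sub]

theorem sat_isEmpty (hx : x < n) : Sat (isEmpty x) n v ↔ v x = emp M := by
  simp (disch := omega) [isEmpty]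
  exact ⟨fun h => ext' fun z => ⟨fun hz => absurd hz (h z), fun hz => absurd hz not_mem_emp⟩,
    fun h z => h ▸ not_mem_emp⟩

theorem sat_inhabited (hx : x < n) : Sat (inhabited x) n v ↔ ∃ z, E z (v x) := by
  simp (disch := omega) [inhabited]

theorem sat_isSucc (hs : s < n) (hx : x < n) :
    Sat (isSucc s x) n v ↔ ∀ z, E z (v s) ↔ E z (v x) ∨ z = v x := by
  simp (disch := omega) [isSucc]

theorem sat_isUPair (hp : p < n) (ha : a < n) (hb : b < n) :
    Sat (isUPair p a b) n v ↔ v p = upair (v a) (v b) := by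
  simp (disch := omega) [isUPair]
  exact ⟨fun h => ext' fun z => (h z).trans mem_upair.symm, fun h z => h ▸ mem_upair⟩

theorem sat_isPair (hp : p < n) (ha : a < n) (hb : b < n) :
    Sat (isPair p a b) n v ↔ v p = pr (v a) (v b) := by
  simp (disch := omega) [isPair, Fm.ex2, sat_isUPair, pr]

theorem sat_isTriple (hp : p < n) (ha : a < n) (hb : b < n) (hc : c < n) :
    Sat (isTriple p a b c) n v ↔ v p = pr (pr (v a) (v b)) (v c) := by
  simp (disch := omega) [isTriple, sat_isPair]

theorem sat_rel (hr : r < n) (ha : a < n) (hb : b < n) :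
    Sat (rel r a b) n v ↔ E (pr (v a) (v b)) (v r) := by
  simp (disch := omega) [rel, sat_isPair]

theorem sat_rel3 (hr : r < n) (ha : a < n) (hb : b < n) (hc : c < n) :
    Sat (rel3 r a b c) n v ↔ E (pr (pr (v a) (v b)) (v c)) (v r) := by
  simp (disch := omega) [rel3, sat_isTriple]

/-- `f` is a function from `a` to `b`. -/
def FunP (f a b : M) : Prop :=
  (∀ p, E p f → ∃ x, E x a ∧ ∃ y, E y b ∧ p = pr x y) ∧
    ∀ x, E x a → ∃ y, E y b ∧ E (pr x y) f ∧ ∀ z, E (pr x z) f → z = y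

theorem sat_isFun (hr : r < n) (ha : a < n) (hb : b < n) :
    Sat (isFun r a b) n v ↔ FunP (v r) (v a) (v b) := by
  simp (disch := omega) [isFun, sat_isPair, sat_rel, FunP]

/-- `c` is the composite `a ∘ b` of relations. -/
def CompP (c a b : M) : Prop :=
  ∀ p, E p c ↔ ∃ x y z, E (pr x y) b ∧ E (pr y z) a ∧ p = pr x z

theorem sat_isComp (hc : c < n) (ha : a < n) (hb : b < n) :
    Sat (isComp c a b) n v ↔ CompP (v c) (v a) (v b) := by
  simp (disch := omega) [isComp, Fm.ex3, Fm.ex2, sat_isPair, sat_rel, CompP]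

theorem sat_isId (hc : c < n) (ha : a < n) :
    Sat (isId c a) n v ↔ ∀ p, E p (v c) ↔ ∃ x, E x (v a) ∧ p = pr x x := by
  simp (disch := omega) [isId, sat_isPair]

theorem sat_isConst (hc : c < n) (ha : a < n) (hb : b < n) :
    Sat (isConst c a b) n v ↔ ∀ p, E p (v c) ↔ ∃ x, E x (v a) ∧ p = pr x (v b) := by
  simp (disch := omega) [isConst, sat_isPair]

end

/-! ### Arrows as sets -/

theorem exists_gr (a : Arr M) : ∃ s : M, ∀ m, E m s ↔
    ∃ p : Nn M × Nn M, (p.1 ≤ a.dom ∧ p.2 = a p.1) ∧ code M p = m :=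
  exists_sub ⟨fun p : Nn M × Nn M => p.1 ≤ a.dom ∧ p.2 = a p.1, by fun_prop⟩

/-- The graph of an arrow. -/
def gr (a : Arr M) : M := (exists_gr a).choose

theorem mem_gr {a : Arr M} {m : M} : E m (gr a) ↔ ∃ i ≤ a.dom, m = pr i.val (a i).val := by
  rw [gr, (exists_gr a).choose_spec]
  constructor
  · rintro ⟨⟨i, j⟩, ⟨h, h'⟩, rfl⟩
    obtain rfl : j = a i := h'
    exact ⟨i, h, rfl⟩
  · rintro ⟨i, h, rfl⟩
    exact ⟨(i, a i), ⟨h, rfl⟩, rfl⟩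

theorem pr_mem_gr {a : Arr M} {i j : Nn M} :
    E (pr i.val j.val) (gr a) ↔ i ≤ a.dom ∧ a i = j := by
  rw [mem_gr]
  simp only [pr_inj, Nn.val_inj]
  constructor
  · rintro ⟨i, h, rfl, rfl⟩
    exact ⟨h, rfl⟩
  · rintro ⟨h, rfl⟩
    exact ⟨i, h, rfl, rfl⟩

theorem gr_injective {a b : Arr M} (h : gr a = gr b) : a = b := by
  have key : ∀ i j, (i ≤ a.dom ∧ a i = j) ↔ (i ≤ b.dom ∧ b i = j) := fun i j => by
    rw [← pr_mem_gr, h, pr_mem_gr]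
  refine Arr.ext_le (le_antisymm ((key _ _).1 ⟨le_rfl, rfl⟩).1 ((key _ _).2 ⟨le_rfl, rfl⟩).1)
    fun i hi => ((key _ _).1 ⟨hi, rfl⟩).2.symm

variable (M) in
/-- The type of sets of pairs of natural numbers. -/
abbrev GrSet : Type := Mem (pow (cset M (Nn M × Nn M)))

/-- The graph of an arrow as an element of a coded type. -/
def grc (a : Arr M) : GrSet M := ⟨gr a, mem_pow.2 fun y hy => by
  obtain ⟨i, _, rfl⟩ := mem_gr.1 hy
  exact code_mem (M := M) (a := (i, a i))⟩

@[simp] theorem code_grc {a : Arr M} : code M (grc a) = gr a := rfl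

/-- The code of an arrow is a pair of a number and an eventually constant function, not the finite
graph used in the formulas; this lemma allows one to be exchanged for the other inside the model. -/
theorem internal_grc' : Internal M (grc : Arr M → GrSet M) := by
  refine .of_graph ?_
  have : (fun p : Arr M × GrSet M => grc p.1 = p.2) = fun p =>
      ∀ q : Nn M × Nn M, E (code M q) (code M p.2) ↔ q.1 ≤ p.1.dom ∧ p.1 q.1 = q.2 := by
    funext p
    refine propext ⟨fun h q => ?_, fun h => Mem.ext (ext' fun z => ?_)⟩
    · rw [← h, code_grc]
      exact pr_mem_gr
    · constructor
      · intro hz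
        obtain ⟨i, hi, rfl⟩ := mem_gr.1 hz
        exact (h (i, p.1 i)).2 ⟨hi, rfl⟩
      · intro hz
        obtain ⟨q, rfl⟩ := mem_cset.1 (mem_pow.1 p.2.mem z hz)
        exact pr_mem_gr.2 ((h q).1 hz)
  rw [this]
  have hE : ∀ {α : Type} [Coded M α] {f : α → Nn M × Nn M} {g : α → GrSet M}, Internal M f →
      Internal M g → Internal M fun x => E (code M (f x)) (code M (g x)) := fun hf hg =>
    (internal_mem (M := M) (α := Nn M × Nn M) (β := GrSet M)).comp (hf.pair hg)
  have := hE (f := fun p : (Arr M × GrSet M) × Nn M × Nn M => p.2) (g := fun p => p.1.2)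
    (by fun_prop) (by fun_prop)
  exact internal

@[fun_prop]
theorem internal_grc {α : Type} [Coded M α] {f : α → Arr M} (hf : Internal M f) :
    Internal M fun x => grc (f x) := internal_grc'.comp hf

/-- The object `[n]` of the simplex category. -/
def ob (n : Nn M) : M := n.succ.val

/-- The object `[n]` is the number `n + 1`, whereas `dim` has the value `n`; `ob` accounts for this
shift. -/
theorem mem_ob {n : Nn M} {x : M} : E x (ob n) ↔ ∃ i ≤ n, x = i.val := by
  constructor
  · intro h
    exact ⟨⟨x, Nn.mem_om_of_mem _ _ h⟩, Nn.lt_succ_iff.1 h, rfl⟩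
  · rintro ⟨i, h, rfl⟩
    exact Nn.lt_succ_iff.2 h

theorem ob_inj {n m : Nn M} : ob n = ob m ↔ n = m := by simp [ob]

/-- `a : k → m` is an arrow of the simplex category. -/
def HomP (a k m : M) : Prop :=
  ∃ (α : Arr M) (n : Nn M), a = gr α ∧ k = ob α.dom ∧ m = ob n ∧ α.top ≤ n

theorem homP_gr {α : Arr M} {k m : M} :
    HomP (gr α) k m ↔ k = ob α.dom ∧ ∃ n, m = ob n ∧ α.top ≤ n := by
  constructor
  · rintro ⟨β, n, h, rfl, rfl, h'⟩
    rw [gr_injective h]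
    exact ⟨rfl, n, rfl, h'⟩
  · rintro ⟨rfl, n, rfl, h⟩
    exact ⟨α, n, rfl, rfl, rfl, h⟩

theorem homP_gr_ob {α : Arr M} {k : M} {n : Nn M} :
    HomP (gr α) k (ob n) ↔ k = ob α.dom ∧ α.top ≤ n := by
  rw [homP_gr]
  simp only [ob_inj]
  grind

theorem funP_gr {α : Arr M} {n : Nn M} (h : α.top ≤ n) : FunP (gr α) (ob α.dom) (ob n) := by
  refine ⟨fun p hp => ?_, fun x hx => ?_⟩
  · obtain ⟨i, hi, rfl⟩ := mem_gr.1 hp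
    exact ⟨_, mem_ob.2 ⟨i, hi, rfl⟩, _, mem_ob.2 ⟨α i, (α.le_top i).trans h, rfl⟩, rfl⟩
  · obtain ⟨i, hi, rfl⟩ := mem_ob.1 hx
    refine ⟨_, mem_ob.2 ⟨α i, (α.le_top i).trans h, rfl⟩, pr_mem_gr.2 ⟨hi, rfl⟩, fun z hz => ?_⟩
    obtain ⟨j, _, e⟩ := mem_gr.1 hz
    obtain ⟨e1, rfl⟩ := pr_inj.1 e
    rw [Nn.val_inj.1 e1]

/-- The monotone function with graph `a` is extended beyond `k` by its value at `k`, that is,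
evaluated at `min i k`. -/
theorem exists_eq_gr {a : M} {k n : Nn M} (h : FunP a (ob k) (ob n))
    (hm : ∀ i i' j j', E (pr i i') a → E (pr j j') a → E i j → E i' j' ∨ i' = j') :
    ∃ α : Arr M, a = gr α ∧ α.dom = k ∧ α.top ≤ n := by
  have hE : Internal M fun p : Nn M × Nn M => E (code M p) a := internal_of_set fun _ => Iff.rfl
  have mem : ∀ p, E p a → ∃ i j : Nn M, i ≤ k ∧ j ≤ n ∧ p = pr i.val j.val := fun p hp => by
    obtain ⟨_, hx, _, hy, rfl⟩ := h.1 p hp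
    obtain ⟨i, hi, rfl⟩ := mem_ob.1 hx
    obtain ⟨j, hj, rfl⟩ := mem_ob.1 hy
    exact ⟨i, j, hi, hj, rfl⟩
  have val : ∀ i : Nn M, i ≤ k → ∃ j : Nn M, E (pr i.val j.val) a ∧
      ∀ j' : Nn M, E (pr i.val j'.val) a → j' = j := fun i hi => by
    obtain ⟨_, hy, h1, h2⟩ := h.2 i.val (mem_ob.2 ⟨i, hi, rfl⟩)
    obtain ⟨j, hj, rfl⟩ := mem_ob.1 hy
    exact ⟨j, h1, fun j' h' => Nn.val_inj.1 (h2 _ h')⟩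
  obtain ⟨f, hf⟩ := exists_ifun (M := M) (R := fun i j : Nn M => E (code M (min i k, j)) a)
    (hE.comp (g := fun p : Nn M × Nn M => (min p.1 k, p.2)) (by fun_prop))
    fun i => val _ (min_le_right i k)
  have hf' : ∀ i ≤ k, E (pr i.val (f i).val) a := fun i hi => by
    have := (hf i _).1 rfl
    rwa [min_eq_left hi] at this
  refine ⟨Arr.of k f f.int fun i j hij hj => ?_, ext' fun z => ⟨fun hz => ?_, fun hz => ?_⟩, rfl, ?_⟩
  · rcases hij.lt_or_eq with hlt | rfl
    · rcases hm _ _ _ _ (hf' i (hij.trans hj)) (hf' j hj) hlt with h' | h'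
      · exact le_of_lt (a := f i) h'
      · exact (Nn.val_inj.1 h').le
    · exact le_rfl
  · obtain ⟨i, j, hi, hj, rfl⟩ := mem z hz
    refine pr_mem_gr.2 ⟨hi, ?_⟩
    rw [Arr.of_apply hi]
    refine (hf i j).2 ?_
    rwa [min_eq_left hi]
  · obtain ⟨i, hi, rfl⟩ := mem_gr.1 hz
    rw [Arr.of_apply (k := k) hi]
    exact hf' i hi
  · rw [Arr.of_top]
    obtain ⟨i, j, hi, hj, e⟩ := mem _ (hf' k le_rfl)
    rw [Nn.val_inj.1 (pr_inj.1 e).2]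
    exact hj

theorem compP_gr {α β : Arr M} {c : M} (h : β.top ≤ α.dom) :
    CompP c (gr α) (gr β) ↔ c = gr (α.comp β) := by
  have key : ∀ p, (∃ x y z, E (pr x y) (gr β) ∧ E (pr y z) (gr α) ∧ p = pr x z) ↔
      E p (gr (α.comp β)) := fun p => by
    rw [mem_gr]
    constructor
    · rintro ⟨x, y, z, h1, h2, rfl⟩
      obtain ⟨i, hi, e1⟩ := mem_gr.1 h1
      obtain ⟨rfl, rfl⟩ := pr_inj.1 e1
      obtain ⟨j, hj, e2⟩ := mem_gr.1 h2
      obtain ⟨e3, rfl⟩ := pr_inj.1 e2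
      exact ⟨i, hi, by rw [Arr.comp_apply, Nn.val_inj.1 e3]⟩
    · rintro ⟨i, hi, rfl⟩
      exact ⟨_, (β i).val, _, pr_mem_gr.2 ⟨hi, rfl⟩, pr_mem_gr.2 ⟨(β.le_top i).trans h, rfl⟩, rfl⟩
  exact ⟨fun hc => ext' fun p => (hc p).trans (key p), fun hc p => hc ▸ (key p).symm⟩

theorem isId_iff {n : Nn M} {c : M} :
    (∀ p, E p c ↔ ∃ x, E x (ob n) ∧ p = pr x x) ↔ c = gr (Arr.id M n) := by
  have key : ∀ p, (∃ x, E x (ob n) ∧ p = pr x x) ↔ E p (gr (Arr.id M n)) := fun p => by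
    rw [mem_gr]
    constructor
    · rintro ⟨x, hx, rfl⟩
      obtain ⟨i, hi, rfl⟩ := mem_ob.1 hx
      exact ⟨i, hi, by rw [Arr.id_apply, min_eq_left hi]⟩
    · rintro ⟨i, (hi : i ≤ n), rfl⟩
      exact ⟨i.val, mem_ob.2 ⟨i, hi, rfl⟩, by rw [Arr.id_apply, min_eq_left hi]⟩
  exact ⟨fun hc => ext' fun p => (hc p).trans (key p), fun hc p => hc ▸ (key p).symm⟩

theorem isConst_iff {n j : Nn M} {c : M} :
    (∀ p, E p c ↔ ∃ x, E x (ob n) ∧ p = pr x j.val) ↔ c = gr (Arr.const n j) := by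
  have key : ∀ p, (∃ x, E x (ob n) ∧ p = pr x j.val) ↔ E p (gr (Arr.const n j)) := fun p => by
    rw [mem_gr]
    constructor
    · rintro ⟨x, hx, rfl⟩
      obtain ⟨i, hi, rfl⟩ := mem_ob.1 hx
      exact ⟨i, hi, rfl⟩
    · rintro ⟨i, hi, rfl⟩
      exact ⟨i.val, mem_ob.2 ⟨i, hi, rfl⟩, rfl⟩
  exact ⟨fun hc => ext' fun p => (hc p).trans (key p), fun hc p => hc ▸ (key p).symm⟩

section

variable {n : ℕ} {v : ℕ → M} {a w k m x : ℕ}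

attribute [local simp] sat_all sat_ex sat_allIn sat_exIn sat_and sat_or sat_neg sat_imp sat_iff
  sat_mem sat_eq Function.update_self Function.update_of_ne

theorem isOrd_iff {i : Nn M} {m : M} : (∀ z, E z m ↔ E z i.val ∨ z = i.val) ↔ m = ob i :=
  ⟨fun h => ext' fun z => (h z).trans Nn.mem_succ.symm, fun h _ => h ▸ Nn.mem_succ⟩

theorem exists_om {P : M → Prop} : (∃ x, E x MacModel.om ∧ P x) ↔ ∃ i : Nn M, P i.val :=
  ⟨fun ⟨x, hx, h⟩ => ⟨⟨x, hx⟩, h⟩, fun ⟨i, h⟩ => ⟨_, i.val_mem, h⟩⟩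

theorem sat_isObj (hw : w < n) (hm : m < n) (e : v w = MacModel.om) :
    Sat (isObj w m) n v ↔ ∃ i : Nn M, v m = ob i := by
  simp (disch := omega) [isObj, isOrd, sat_isSucc, e, exists_om, isOrd_iff]

theorem sat_isHom (hw : w < n) (ha : a < n) (hk : k < n) (hm : m < n) (e : v w = MacModel.om) :
    Sat (isHom w a k m) n v ↔ HomP (v a) (v k) (v m) := by
  simp (disch := omega) [isHom, sat_isObj, sat_isFun, sat_rel, e, Fm.all4, Fm.all3, Fm.all2]
  constructor
  · rintro ⟨⟨i, hi⟩, ⟨j, hj⟩, h1, h2⟩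
    rw [hi, hj] at h1
    obtain ⟨α, h3, rfl, h4⟩ := exists_eq_gr h1 h2
    exact ⟨α, j, h3, hi, hj, h4⟩
  · rintro ⟨α, j, h1, h2, h3, h4⟩
    rw [h1, h2, h3]
    refine ⟨⟨_, rfl⟩, ⟨_, rfl⟩, funP_gr h4, fun i i' j j' hi hj hij => ?_⟩
    obtain ⟨i, _, e⟩ := mem_gr.1 hi
    obtain ⟨rfl, rfl⟩ := pr_inj.1 e
    obtain ⟨j, _, e⟩ := mem_gr.1 hj
    obtain ⟨rfl, rfl⟩ := pr_inj.1 e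
    rcases (α.mono (le_of_lt (a := i) (b := j) hij)).lt_or_eq with h | h
    · exact Or.inl h
    · exact Or.inr (congrArg _ h)

end

end

/-! ### Translation between coded simplicial sets and sets of the model -/

section

/-! ### Simplicial sets as sets of the model -/

variable {M : Type} [MacModel M]

variable {X Y Z K N N' : Type} [Coded M X] [Coded M Y] [Coded M Z] [Coded M K] [Coded M N]
  [Coded M N'] [SSet M X] [SSet M Y] [SSet M Z] [SSet M K]

variable (M) in
/-- Three sets of the model, the constituents of a simplicial set. -/
structure Triple where
  carrier : M
  dim : M
  act : M

/-- The values of three variables. -/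
def SVar.at (X : SVar) (v : ℕ → M) : Triple M := ⟨v X.carrier, v X.dim, v X.act⟩

/-- The simplicial set `X` is represented by three sets, where `e x` is the set that represents the
simplex `x`. -/
structure Rep (e : X → N) (T : Triple M) : Prop where
  int : Internal M e
  inj : ∀ x y, e x = e y → x = y
  carrier : ∀ m, E m T.carrier ↔ ∃ x, m = code M (e x)
  dim : ∀ m, E m T.dim ↔ ∃ x, m = pr (code M (e x)) (ob (dim M x))
  act : ∀ m, E m T.act ↔ ∃ x, ∃ a : Arr M, a.top ≤ MacSet.dim M x ∧
    m = pr (pr (gr a) (code M (e x))) (code M (e (x ⋆ a)))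

theorem exists_set {β : Type} [Coded M β] {α : Type} [Coded M α] {f : α → β} (hf : Internal M f) :
    ∃ s : M, ∀ m, E m s ↔ ∃ x, m = code M (f x) := by
  obtain ⟨s, hs⟩ := exists_sub (⟨fun b => ∃ x, f x = b, by fun_prop⟩ : ISet M β)
  refine ⟨s, fun m => (hs m).trans ?_⟩
  constructor
  · rintro ⟨_, ⟨x, rfl⟩, rfl⟩
    exact ⟨x, rfl⟩
  · rintro ⟨x, rfl⟩
    exact ⟨_, ⟨x, rfl⟩, rfl⟩

theorem exists_rep {e : X → N} (he : Internal M e) (hi : ∀ x y, e x = e y → x = y) :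
    ∃ T : Triple M, Rep e T := by
  obtain ⟨s, hs⟩ := exists_set he
  obtain ⟨d, hd⟩ := exists_set (M := M) (f := fun x => (e x, (dim M x).succ)) (by fun_prop)
  obtain ⟨g, hg⟩ := exists_sub (M := M) (⟨fun t : (GrSet M × N) × N => ∃ x, ∃ a : Arr M,
    a.top ≤ dim M x ∧ t = ((grc a, e x), e (x ⋆ a)), by fun_prop⟩ : ISet M _)
  refine ⟨⟨s, d, g⟩, he, hi, hs, hd, fun m => (hg m).trans ?_⟩
  constructor
  · rintro ⟨_, ⟨x, a, ha, rfl⟩, rfl⟩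
    exact ⟨x, a, ha, rfl⟩
  · rintro ⟨x, a, ha, rfl⟩
    exact ⟨_, ⟨x, a, ha, rfl⟩, rfl⟩

section

variable {e : X → N} {e' : Y → N'} {T T' : Triple M}

theorem Rep.code_inj (h : Rep e T) {x y : X} : code M (e x) = code M (e y) ↔ x = y := by
  rw [MacSet.code_inj]
  exact ⟨h.inj x y, fun h => h ▸ rfl⟩

theorem Rep.dim_iff (h : Rep e T) {x : X} {m : M} :
    E (pr (code M (e x)) m) T.dim ↔ m = ob (MacSet.dim M x) := by
  rw [h.dim]
  simp only [pr_inj, h.code_inj]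
  exact ⟨fun ⟨y, h1, h2⟩ => h1 ▸ h2, fun h => ⟨x, rfl, h⟩⟩

theorem Rep.mem_carrier (h : Rep e T) {x : X} : E (code M (e x)) T.carrier :=
  (h.carrier _).2 ⟨x, rfl⟩

/-- `x` is a simplex hover `m`. -/
def OverP (T : Triple M) (x m : M) : Prop := E x T.carrier ∧ E (pr x m) T.dim

theorem Rep.overP_iff (h : Rep e T) {x m : M} :
    OverP T x m ↔ ∃ y, x = code M (e y) ∧ m = ob (MacSet.dim M y) := by
  constructor
  · rintro ⟨h1, h2⟩
    obtain ⟨y, rfl⟩ := (h.carrier _).1 h1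
    exact ⟨y, rfl, h.dim_iff.1 h2⟩
  · rintro ⟨y, rfl, rfl⟩
    exact ⟨h.mem_carrier, h.dim_iff.2 rfl⟩

theorem Rep.act_iff (h : Rep e T) {a x m : M} :
    E (pr (pr a x) m) T.act ↔ ∃ (y : X) (α : Arr M), α.top ≤ MacSet.dim M y ∧ a = gr α ∧
      x = code M (e y) ∧ m = code M (e (y ⋆ α)) := by
  rw [h.act]
  simp only [pr_inj, and_assoc]

theorem Rep.act_iff' (h : Rep e T) {α : Arr M} {x : X} {m : M} :
    E (pr (pr (gr α) (code M (e x))) m) T.act ↔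
      α.top ≤ MacSet.dim M x ∧ m = code M (e (x ⋆ α)) := by
  rw [h.act_iff]
  constructor
  · rintro ⟨y, β, h1, h2, h3, h4⟩
    rw [gr_injective h2, h.code_inj.1 h3]
    exact ⟨h1, h4⟩
  · rintro ⟨h1, h2⟩
    exact ⟨x, α, h1, rfl, rfl, h2⟩

/-- The axioms of simplicial sets. -/
def SSetP (T : Triple M) : Prop :=
  FunP T.dim T.carrier MacModel.om ∧
  (∀ x m, E (pr x m) T.dim → ∃ i : Nn M, m = ob i) ∧
  (∀ t, E t T.act → ∃ a x y k m, t = pr (pr a x) y ∧ HomP a k m ∧ OverP T x m ∧ OverP T y k) ∧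
  (∀ a k m x, HomP a k m → OverP T x m →
    ∃ y, E (pr (pr a x) y) T.act ∧ ∀ z, E (pr (pr a x) z) T.act → z = y) ∧
  (∀ x m i, OverP T x m → (∀ p, E p i ↔ ∃ x, E x m ∧ p = pr x x) → E (pr (pr i x) x) T.act) ∧
  (∀ a b c k l m x y z, HomP a k m → HomP b l k → CompP c a b → OverP T x m →
    E (pr (pr a x) y) T.act → E (pr (pr b y) z) T.act → E (pr (pr c x) z) T.act)

theorem Rep.ssetP (h : Rep e T) : SSetP T := by
  refine ⟨⟨fun p hp => ?_, fun x hx => ?_⟩, fun x m hm => ?_, fun t ht => ?_,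
    fun a k m x ha hx => ?_, fun x m i hx hi => ?_, fun a b c k l m x y z ha hb hc hx hy hz => ?_⟩
  · obtain ⟨x, rfl⟩ := (h.dim _).1 hp
    exact ⟨_, h.mem_carrier, _, (MacSet.dim M x).succ.val_mem, rfl⟩
  · obtain ⟨x, rfl⟩ := (h.carrier _).1 hx
    exact ⟨_, (MacSet.dim M x).succ.val_mem, h.dim_iff.2 rfl, fun z hz => h.dim_iff.1 hz⟩
  · obtain ⟨y, e⟩ := (h.dim _).1 hm
    exact ⟨_, (pr_inj.1 e).2⟩
  · obtain ⟨x, a, ha, rfl⟩ := (h.act _).1 ht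
    exact ⟨_, _, _, _, _, rfl, ⟨a, _, rfl, rfl, rfl, ha⟩, h.overP_iff.2 ⟨_, rfl, rfl⟩,
      h.overP_iff.2 ⟨_, rfl, by rw [dim_act ha]⟩⟩
  · obtain ⟨x, rfl, rfl⟩ := h.overP_iff.1 hx
    obtain ⟨α, n, rfl, rfl, e, hα⟩ := ha
    rw [← ob_inj.1 e] at hα
    exact ⟨_, h.act_iff'.2 ⟨hα, rfl⟩, fun z hz => (h.act_iff'.1 hz).2⟩
  · obtain ⟨x, rfl, rfl⟩ := h.overP_iff.1 hx
    rw [isId_iff] at hi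
    rw [hi, h.act_iff']
    exact ⟨by simp, by rw [act_id]⟩
  · obtain ⟨x, rfl, rfl⟩ := h.overP_iff.1 hx
    obtain ⟨α, n, rfl, rfl, e, hα⟩ := ha
    rw [← ob_inj.1 e] at hα
    obtain ⟨β, n', rfl, rfl, e', hβ⟩ := hb
    rw [← ob_inj.1 e'] at hβ
    rw [compP_gr hβ] at hc
    obtain ⟨-, rfl⟩ := h.act_iff'.1 hy
    obtain ⟨-, rfl⟩ := h.act_iff'.1 hz
    rw [hc, h.act_iff', act_act hα hβ]
    exact ⟨Arr.comp_top_le.trans hα, rfl⟩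

theorem internal_mem_const {α β : Type} [Coded M α] [Coded M β] {f : α → β} (hf : Internal M f)
    (s : M) : Internal M fun x => E (code M (f x)) s :=
  (internal_of_set (P := fun b : β => E (code M b) s) fun _ => Iff.rfl).comp hf

/-- Conversely to `Rep.ssetP`, a simplicial set in the sense of the formulas makes the type of
members of its carrier into an `SSet`, so all results about coded types apply to it. -/
theorem SSetP.exists_rep (h : SSetP T) :
    ∃ _ : SSet M (Mem T.carrier), Rep (fun x : Mem T.carrier => x) T := by
  obtain ⟨hf, hob, hact, hex, hid, hcomp⟩ := h
  obtain ⟨d, hd⟩ := exists_ifun (M := M) (R := fun (x : Mem T.carrier) (i : Nn M) =>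
    E (code M (x, i.succ)) T.dim) (internal_mem_const (by fun_prop) _) fun x => by
      obtain ⟨_, _, h1, h2⟩ := hf.2 x.val x.mem
      obtain ⟨i, rfl⟩ := hob _ _ h1
      exact ⟨i, h1, fun j hj => ob_inj.1 (h2 _ hj)⟩
  have hover : ∀ x m, OverP T x m ↔ ∃ y : Mem T.carrier, x = y.val ∧ m = ob (d y) := by
    intro x m
    constructor
    · rintro ⟨h1, h2⟩
      obtain ⟨i, rfl⟩ := hob _ _ h2
      refine ⟨⟨x, h1⟩, rfl, ?_⟩
      rw [(hd ⟨x, h1⟩ i).2 h2]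
    · rintro ⟨y, rfl, rfl⟩
      exact ⟨y.mem, (hd y _).1 rfl⟩
  have total : ∀ (x : Mem T.carrier) (a : Arr M), a.top ≤ d x → ∃ y : Mem T.carrier,
      d y = a.dom ∧ E (pr (pr (gr a) x.val) y.val) T.act ∧
      ∀ z, E (pr (pr (gr a) x.val) z) T.act → z = y.val := by
    intro x a ha
    obtain ⟨y, h1, h2⟩ := hex (gr a) _ _ x.val ⟨a, _, rfl, rfl, rfl, ha⟩ ((hover _ _).2 ⟨x, rfl, rfl⟩)
    obtain ⟨a', x', y', k, m, e1, ⟨α, n, rfl, rfl, rfl, hα⟩, h4, h5⟩ := hact _ h1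
    obtain ⟨⟨e2, rfl⟩, rfl⟩ : (gr a = gr α ∧ x.val = x') ∧ y = y' := by simpa using e1
    obtain ⟨y, rfl, e3⟩ := (hover _ _).1 h5
    exact ⟨y, (by rw [gr_injective e2, ob_inj.1 e3]), h1, h2⟩
  -- The action in the model is partial; `trunc` makes it total, and `hg'` recovers it for arrows to
  -- the right object.
  obtain ⟨g, hg⟩ := exists_ifun (M := M) (R := fun (p : Mem T.carrier × Arr M) (y : Mem T.carrier) =>
    E (code M ((grc (p.2.trunc (d p.1)), p.1), y)) T.act)
    (internal_mem_const (by fun_prop) _) fun p => by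
      obtain ⟨y, -, h1, h2⟩ := total p.1 (p.2.trunc (d p.1)) Arr.trunc_top_le
      exact ⟨y, h1, fun z hz => Mem.ext (h2 _ hz)⟩
  have hg' : ∀ (x : Mem T.carrier) (a : Arr M), a.top ≤ d x → ∀ y : Mem T.carrier, g (x, a) = y ↔
      E (pr (pr (gr a) x.val) y.val) T.act := by
    intro x a ha y
    rw [hg]
    simp only [Arr.trunc_eq ha]
    rfl
  have hdg : ∀ (x : Mem T.carrier) (a : Arr M), a.top ≤ d x → d (g (x, a)) = a.dom := by
    intro x a ha
    obtain ⟨y, h1, h2, -⟩ := total x a ha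
    rw [(hg' x a ha y).2 h2, h1]
  let inst : SSet M (Mem T.carrier) :=
    { dim := d
      act := fun x a => g (x, a)
      internal_dim := d.int
      internal_act := g.int
      dim_act := hdg
      act_id := fun x => (hg' _ _ (by simp) _).2 (hid _ _ _ ((hover _ _).2 ⟨x, rfl, rfl⟩)
        (isId_iff.2 rfl))
      act_act := fun x a b ha hb => by
        have h1 := (hg' x a ha _).1 rfl
        have h2 := (hg' (g (x, a)) b (by rwa [hdg x a ha]) _).1 rfl
        exact ((hg' x (a.comp b) (Arr.comp_top_le.trans ha) _).2 (hcomp _ _ _ _ _ _ _ _ _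
          ⟨a, _, rfl, rfl, rfl, ha⟩ ⟨b, a.dom, rfl, rfl, rfl, hb⟩ ((compP_gr hb).2 rfl)
          ((hover _ _).2 ⟨x, rfl, rfl⟩) h1 h2)).symm }
  refine ⟨inst, ⟨by fun_prop, fun _ _ h => h, fun m => ⟨fun hm => ⟨⟨m, hm⟩, rfl⟩, ?_⟩,
    fun m => ⟨fun hm => ?_, ?_⟩, fun m => ⟨fun hm => ?_, ?_⟩⟩⟩
  · rintro ⟨x, rfl⟩
    exact x.mem
  · obtain ⟨x, hx, y, hy, rfl⟩ := hf.1 m hm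
    obtain ⟨y', h1, h2⟩ := (hover x y).1 ⟨hx, hm⟩
    exact ⟨y', by rw [h1, h2]; rfl⟩
  · rintro ⟨x, rfl⟩
    exact ((hover _ _).2 ⟨x, rfl, rfl⟩).2
  · obtain ⟨a, x, y, k, m, rfl, ⟨α, n, rfl, rfl, rfl, hα⟩, h4, h5⟩ := hact _ hm
    obtain ⟨x, rfl, e3⟩ := (hover _ _).1 h4
    obtain ⟨y, rfl, e4⟩ := (hover _ _).1 h5
    rw [ob_inj.1 e3] at hα
    refine ⟨x, α, hα, ?_⟩
    have := (hg' x α hα y).2 hm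
    rw [← this]
    rfl
  · rintro ⟨x, a, ha, rfl⟩
    exact (hg' x a ha _).1 rfl

/-- The set `f` is the graph of the function `F`. -/
def Gr (e : X → N) (e' : Y → N') (F : X → Y) (f : M) : Prop :=
  ∀ m, E m f ↔ ∃ x, m = pr (code M (e x)) (code M (e' (F x)))

theorem exists_gr_map (h : Rep e T) (h' : Rep e' T') {F : X → Y} (hF : IsSMap M F) :
    ∃ f : M, Gr e e' F f := by
  have i1 := h.int
  have i2 := h'.int
  have i3 := hF.internal
  exact exists_set (M := M) (f := fun x => (e x, e' (F x))) (by fun_prop)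

theorem Gr.pr_iff {F : X → Y} {f : M} (hf : Gr e e' F f) (h : Rep e T) {x : X} {m : M} :
    E (pr (code M (e x)) m) f ↔ m = code M (e' (F x)) := by
  rw [hf]
  simp only [pr_inj, h.code_inj]
  exact ⟨fun ⟨y, h1, h2⟩ => h1 ▸ h2, fun h => ⟨x, rfl, h⟩⟩

theorem Gr.rel_iff {F : X → Y} {f : M} (hf : Gr e e' F f) {x y : M} :
    E (pr x y) f ↔ ∃ z, x = code M (e z) ∧ y = code M (e' (F z)) := by
  rw [hf]
  simp only [pr_inj]

/-- Simplicial maps. -/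
def MapP (T T' : Triple M) (f : M) : Prop :=
  FunP f T.carrier T'.carrier ∧
  (∀ x y m, E (pr x y) f → E (pr x m) T.dim → E (pr y m) T'.dim) ∧
  ∀ a x x' y y', E (pr (pr a x) x') T.act → E (pr x y) f → E (pr x' y') f →
    E (pr (pr a y) y') T'.act

theorem Gr.mapP (h : Rep e T) (h' : Rep e' T') {F : X → Y} (hF : IsSMap M F) {f : M}
    (hf : Gr e e' F f) : MapP T T' f := by
  refine ⟨⟨fun p hp => ?_, fun x hx => ?_⟩, fun x y m h1 h2 => ?_, fun a x x' y y' h1 h2 h3 => ?_⟩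
  · obtain ⟨x, rfl⟩ := (hf _).1 hp
    exact ⟨_, h.mem_carrier, _, h'.mem_carrier, rfl⟩
  · obtain ⟨x, rfl⟩ := (h.carrier _).1 hx
    exact ⟨_, h'.mem_carrier, (hf.pr_iff h).2 rfl, fun z hz => (hf.pr_iff h).1 hz⟩
  · obtain ⟨x, rfl, rfl⟩ := hf.rel_iff.1 h1
    rw [h.dim_iff] at h2
    rw [h'.dim_iff, hF.dim, h2]
  · obtain ⟨z, α, hα, rfl, rfl, rfl⟩ := h.act_iff.1 h1
    rw [hf.pr_iff h] at h2 h3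
    rw [h2, h3, h'.act_iff', hF.dim, hF.act _ _ hα]
    exact ⟨hα, rfl⟩

theorem MapP.exists_gr (h : Rep e T) (h' : Rep e' T') {f : M} (hf : MapP T T' f) :
    ∃ F : X → Y, IsSMap M F ∧ Gr e e' F f := by
  obtain ⟨h1, h2, h3⟩ := hf
  have i1 := h.int
  have i2 := h'.int
  obtain ⟨F, hF⟩ := exists_ifun (M := M) (R := fun x y => E (code M (e x, e' y)) f)
    (internal_mem_const (by fun_prop) _) fun x => by
      obtain ⟨_, hy, h4, h5⟩ := h1.2 _ (h.mem_carrier (x := x))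
      obtain ⟨y, rfl⟩ := (h'.carrier _).1 hy
      exact ⟨y, h4, fun z hz => h'.code_inj.1 (h5 _ hz)⟩
  have hF' : ∀ x, E (pr (code M (e x)) (code M (e' (F x)))) f := fun x => (hF _ _).1 rfl
  refine ⟨F, ⟨F.int, fun x => ?_, fun x a ha => ?_⟩, fun m => ⟨fun hm => ?_, ?_⟩⟩
  · have := h2 _ _ _ (hF' x) (h.dim_iff.2 rfl)
    rw [h'.dim_iff, ob_inj] at this
    exact this.symm
  · have := h3 _ _ _ _ _ (h.act_iff'.2 ⟨ha, rfl⟩) (hF' x) (hF' _)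
    rw [h'.act_iff', h'.code_inj] at this
    exact this.2
  · obtain ⟨x, hx, y, hy, rfl⟩ := h1.1 m hm
    obtain ⟨x, rfl⟩ := (h.carrier _).1 hx
    obtain ⟨y, rfl⟩ := (h'.carrier _).1 hy
    exact ⟨x, by rw [(hF x y).2 hm]⟩
  · rintro ⟨x, rfl⟩
    exact hF' x

theorem Gr.compP {N'' : Type} [Coded M N''] {e'' : Z → N''} {F : X → Y} {G : Y → Z} {f g h : M} (hT' : Rep e' T')
    (hf : Gr e e' F f) (hg : Gr e' e'' G g) :
    CompP h g f ↔ Gr e e'' (fun x => G (F x)) h := by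
  refine forall_congr' fun p => iff_congr Iff.rfl ?_
  constructor
  · rintro ⟨x, y, z, h1, h2, rfl⟩
    obtain ⟨x, rfl, rfl⟩ := hf.rel_iff.1 h1
    rw [(hg.pr_iff hT').1 h2]
    exact ⟨x, rfl⟩
  · rintro ⟨x, rfl⟩
    exact ⟨_, _, _, (hf _).2 ⟨x, rfl⟩, (hg _).2 ⟨F x, rfl⟩, rfl⟩

/-- `f` is injective. -/
def MonicP (f : M) : Prop := ∀ x x' y, E (pr x y) f → E (pr x' y) f → x = x'

theorem Gr.monicP {F : X → Y} {f : M} (h' : Rep e' T') (hf : Gr e e' F f)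
    (hF : ∀ x x', F x = F x' → x = x') : MonicP f := by
  intro x x' y h1 h2
  obtain ⟨x, rfl, rfl⟩ := hf.rel_iff.1 h1
  obtain ⟨x', rfl, h3⟩ := hf.rel_iff.1 h2
  rw [hF _ _ (h'.code_inj.1 h3)]

end

end

/-! ### Formulas about simplicial sets, interpreted in the model -/

section

/-! ### Semantics of the vocabulary of simplicial sets -/

variable {M : Type} [MacModel M]

/-- `D` is the subcomplex of the standard simplex with vertices in `m` given by the arrows with
property `P`. -/
def SubStdP (m : M) (P : M → Prop) (D : Triple M) : Prop :=
  (∀ a, E a D.carrier ↔ (∃ k, HomP a k m) ∧ P a) ∧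
  (∀ p, E p D.dim ↔ ∃ a k, E a D.carrier ∧ HomP a k m ∧ p = pr a k) ∧
  ∀ t, E t D.act ↔ ∃ a k b l c, E a D.carrier ∧ HomP a k m ∧ HomP b l k ∧ CompP c a b ∧
    t = pr (pr b a) c

/-- `P` is the product of `X` and `Y`. -/
def ProdP (X Y P : Triple M) : Prop :=
  (∀ p, E p P.carrier ↔ ∃ x y m, OverP X x m ∧ OverP Y y m ∧ p = pr x y) ∧
  (∀ q, E q P.dim ↔ ∃ x y m p, OverP X x m ∧ OverP Y y m ∧ p = pr x y ∧ q = pr p m) ∧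
  ∀ t, E t P.act ↔ ∃ a p p' x y x' y', E p P.carrier ∧ p = pr x y ∧ p' = pr x' y' ∧
    E (pr (pr a x) x') X.act ∧ E (pr (pr a y) y') Y.act ∧ t = pr (pr a p) p'

section

variable {n : ℕ} {v : ℕ → M} {w f m k p g : ℕ} {X Y K P L D : SVar}

theorem svar_at_update (hX : X.carrier < n ∧ X.dim < n ∧ X.act < n) {b : M} :
    X.at (Function.update v n b) = X.at v := by
  simp (disch := omega) [SVar.at, Function.update_of_ne]

theorem svar_at_mk {a b c : ℕ} : (SVar.mk a b c).at v = ⟨v a, v b, v c⟩ := rfl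

attribute [local simp] sat_all sat_ex sat_allIn sat_exIn sat_and sat_or sat_neg sat_imp sat_iff
  sat_mem sat_eq Function.update_self Function.update_of_ne sat_rel sat_rel3 sat_isPair
  sat_isTriple sat_isFun sat_isComp sat_isId sat_isConst sat_isHom sat_sub sat_isEmpty
  sat_inhabited sat_isObj Fm.all2 Fm.all3 Fm.all4 Fm.ex2 Fm.ex3 Fm.ex4

theorem sat_simplexOver {x m : ℕ} (hX : X.carrier < n ∧ X.dim < n ∧ X.act < n) (hx : x < n)
    (hm : m < n) : Sat (simplexOver X x m) n v ↔ OverP (X.at v) (v x) (v m) := by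
  simp (disch := omega) [simplexOver, OverP, SVar.at]

attribute [local simp] sat_simplexOver

theorem sat_isSSet (hw : w < n) (hX : X.carrier < n ∧ X.dim < n ∧ X.act < n)
    (e : v w = MacModel.om) : Sat (isSSet w X) n v ↔ SSetP (X.at v) := by
  simp (disch := first | omega | (simp (disch := omega); assumption)) [isSSet, SSetP, svar_at_update]
  simp [SVar.at]
  intros
  rw [e]

theorem sat_isMap (hX : X.carrier < n ∧ X.dim < n ∧ X.act < n)
    (hY : Y.carrier < n ∧ Y.dim < n ∧ Y.act < n) (hf : f < n) :
    Sat (isMap X Y f) n v ↔ MapP (X.at v) (Y.at v) (v f) := by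
  simp (disch := omega) [isMap, MapP, SVar.at]

theorem sat_isMonic (hf : f < n) : Sat (isMonic f) n v ↔ MonicP (v f) := by
  simp (disch := omega) [isMonic, MonicP]

theorem sat_isSubStd {S : ℕ → Fm} {Q : M → Prop} (hw : w < n) (hm : m < n)
    (hD : D.carrier < n ∧ D.dim < n ∧ D.act < n) (e : v w = MacModel.om)
    (hS : ∀ a, Sat (S n) (n + 1) (Function.update v n a) ↔ Q a) :
    Sat (isSubStd w m S D) n v ↔ SubStdP (v m) Q (D.at v) := by
  simp (disch := first | omega | (simp (disch := omega); assumption))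
    [isSubStd, SubStdP, SVar.at, hS]

theorem sat_isProd (hX : X.carrier < n ∧ X.dim < n ∧ X.act < n)
    (hY : Y.carrier < n ∧ Y.dim < n ∧ Y.act < n) (hP : P.carrier < n ∧ P.dim < n ∧ P.act < n) :
    Sat (isProd X Y P) n v ↔ ProdP (X.at v) (Y.at v) (P.at v) := by
  simp (disch := omega) [isProd, ProdP, svar_at_update]
  simp [SVar.at]

end

end

section

variable {M : Type} [MacModel M]

/-- `s = x ∪ {x}`. -/
def SuccP (s x : M) : Prop := ∀ z, E z s ↔ E z x ∨ z = x

/-- The arrow with graph `a` omits a vertex of `m` other than `k`. -/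
def OmitP (m k a : M) : Prop := ∃ i, E i m ∧ i ≠ k ∧ ∀ j, ¬ E (pr j i) a

/-- `c` is the constant function on `m` with value `o`. -/
def ConstP (c m o : M) : Prop := ∀ p, E p c ↔ ∃ x, E x m ∧ p = pr x o

/-- `L` is a horn in the simplex `D`. -/
def HornP (L D : Triple M) : Prop :=
  ∃ i, E i MacModel.om ∧ (∃ z, E z i) ∧ ∃ m, SuccP m i ∧ SubStdP m (fun _ => True) D ∧
    ∃ k, E k m ∧ SubStdP m (OmitP m k) L

/-- Kan complexes. -/
def KanP (K : Triple M) : Prop := ∀ L D, HornP L D → ∀ h, MapP L K h →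
  ∃ l, MapP D K l ∧ ∀ z, E z h → E z l

/-- Kan fibrations. -/
def FibP (Z Y : Triple M) (p : M) : Prop := ∀ L D, HornP L D → ∀ h b, MapP L Z h → MapP D Y b →
  (∀ a z y, E (pr a z) h → E (pr z y) p → E (pr a y) b) →
  ∃ l, MapP D Z l ∧ (∀ z, E z h → E z l) ∧ CompP b p l

/-- Homotopic maps. -/
def HomotopicP (X K : Triple M) (f g : M) : Prop :=
  ∃ i t, SuccP i (emp M) ∧ SuccP t i ∧ ∃ I P, SubStdP t (fun _ => True) I ∧ ProdP X I P ∧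
    ∃ H, MapP P K H ∧ ∀ x m c, OverP X x m →
      (ConstP c m (emp M) → ∀ y, E (pr x y) f → E (pr (pr x c) y) H) ∧
      (ConstP c m i → ∀ y, E (pr x y) g → E (pr (pr x c) y) H)

/-- Acyclic maps. -/
def AcycP (X Y : Triple M) (f : M) : Prop := ∀ K, SSetP K → KanP K →
  (∀ g, MapP X K g → ∃ h c, MapP Y K h ∧ CompP c h f ∧ HomotopicP X K c g) ∧
  ∀ h h' c c', MapP Y K h → MapP Y K h' → CompP c h f → CompP c' h' f →
    HomotopicP X K c c' → HomotopicP Y K h h'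

section

variable {n : ℕ} {v : ℕ → M} {w f m k p g j : ℕ} {X Y Z K P L D : SVar}

theorem sat_allS {F : SVar → Fm} : Sat (allS F) n v ↔ ∀ T : Triple M,
    Sat (F ⟨n, n + 1, n + 2⟩) (n + 3) (Function.update (Function.update
      (Function.update v n T.carrier) (n + 1) T.dim) (n + 2) T.act) := by
  simp only [allS, Fm.all3, Fm.all2, sat_all]
  exact ⟨fun h T => h _ _ _, fun h s d g => h ⟨s, d, g⟩⟩

theorem sat_exS {F : SVar → Fm} : Sat (exS F) n v ↔ ∃ T : Triple M,
    Sat (F ⟨n, n + 1, n + 2⟩) (n + 3) (Function.update (Function.update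
      (Function.update v n T.carrier) (n + 1) T.dim) (n + 2) T.act) := by
  simp only [exS, Fm.ex3, Fm.ex2, sat_ex]
  exact ⟨fun ⟨s, d, g, h⟩ => ⟨⟨s, d, g⟩, h⟩, fun ⟨T, h⟩ => ⟨_, _, _, h⟩⟩

theorem triple_eta {T : Triple M} : Triple.mk T.carrier T.dim T.act = T := rfl

theorem sat_isSucc' {s x : ℕ} (hs : s < n) (hx : x < n) :
    Sat (isSucc s x) n v ↔ SuccP (v s) (v x) := sat_isSucc hs hx

theorem sat_isConst' {a b c : ℕ} (hc : c < n) (ha : a < n) (hb : b < n) :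
    Sat (isConst c a b) n v ↔ ConstP (v c) (v a) (v b) := sat_isConst hc ha hb

attribute [local simp] sat_all sat_ex sat_allIn sat_exIn sat_and sat_or sat_neg sat_imp sat_iff
  sat_mem sat_eq Function.update_self Function.update_of_ne sat_rel sat_rel3 sat_isPair
  sat_isTriple sat_isFun sat_isComp sat_isId sat_isConst' sat_isHom sat_sub sat_isEmpty
  sat_inhabited sat_isObj Fm.all2 Fm.all3 Fm.all4 Fm.ex2 Fm.ex3 Fm.ex4 sat_simplexOver sat_isMap
  sat_isMonic sat_isProd sat_isSSet sat_allS sat_exS svar_at_update svar_at_mk triple_eta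
  sat_isSucc'

theorem sat_isStd (hw : w < n) (hm : m < n)
    (hD : D.carrier < n ∧ D.dim < n ∧ D.act < n) (e : v w = MacModel.om) :
    Sat (isStd w m D) n v ↔ SubStdP (v m) (fun _ => True) (D.at v) :=
  sat_isSubStd hw hm hD e fun a => by simp (disch := omega)

theorem sat_isHorn (hw : w < n) (hm : m < n) (hk : k < n)
    (hD : D.carrier < n ∧ D.dim < n ∧ D.act < n) (e : v w = MacModel.om) :
    Sat (isHorn w m k D) n v ↔ SubStdP (v m) (OmitP (v m) (v k)) (D.at v) :=
  sat_isSubStd hw hm hD e fun a => by simp (disch := omega) [OmitP]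

attribute [local simp] sat_isStd sat_isHorn

theorem sat_isHornInSimplex (hw : w < n) (hL : L.carrier < n ∧ L.dim < n ∧ L.act < n)
    (hD : D.carrier < n ∧ D.dim < n ∧ D.act < n) (e : v w = MacModel.om) :
    Sat (isHornInSimplex w L D) n v ↔ HornP (L.at v) (D.at v) := by
  simp (disch := first | omega | (simp (disch := omega); assumption))
    [isHornInSimplex, HornP, isOrd, e]

attribute [local simp] sat_isHornInSimplex

theorem sat_isKanComplex (hw : w < n) (hK : K.carrier < n ∧ K.dim < n ∧ K.act < n)
    (e : v w = MacModel.om) : Sat (isKanComplex w K) n v ↔ KanP (K.at v) := by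
  simp (disch := first | omega | (dsimp only; omega) | (simp (disch := omega); assumption))
    [isKanComplex, KanP]

theorem sat_isKanFibration (hw : w < n) (hZ : Z.carrier < n ∧ Z.dim < n ∧ Z.act < n)
    (hY : Y.carrier < n ∧ Y.dim < n ∧ Y.act < n) (hp : p < n)
    (e : v w = MacModel.om) : Sat (isKanFibration w Z Y p) n v ↔ FibP (Z.at v) (Y.at v) (v p) := by
  simp (disch := first | omega | (dsimp only; omega) | (simp (disch := omega); assumption))
    [isKanFibration, FibP]

theorem sat_isHomotopic (hw : w < n) (hX : X.carrier < n ∧ X.dim < n ∧ X.act < n)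
    (hK : K.carrier < n ∧ K.dim < n ∧ K.act < n) (hf : f < n) (hg : g < n)
    (e : v w = MacModel.om) :
    Sat (isHomotopic w X K f g) n v ↔ HomotopicP (X.at v) (K.at v) (v f) (v g) := by
  simp (disch := first | omega | (dsimp only; omega) | (simp (disch := omega); assumption))
    [isHomotopic, HomotopicP]

end

end

section

variable {M : Type} [MacModel M]

/-- The triple `Z` with the maps `j` and `p` is a factorization of `f`. -/
def FactorP (X Y : Triple M) (f : M) (Z : Triple M) (j p : M) : Prop :=
  SSetP Z ∧ MapP X Z j ∧ MapP Z Y p ∧ CompP f p j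

section

variable {n : ℕ} {v : ℕ → M} {w f m k p g j : ℕ} {X Y Z K P L D : SVar}

attribute [local simp] sat_all sat_ex sat_and sat_imp
  Function.update_self Function.update_of_ne
  sat_isComp Fm.all2 Fm.all3 Fm.all4 Fm.ex2 sat_isMap
  sat_isMonic sat_isSSet sat_allS sat_exS svar_at_update svar_at_mk triple_eta
  sat_isKanComplex sat_isKanFibration sat_isHomotopic

theorem sat_isAcyclic (hw : w < n) (hX : X.carrier < n ∧ X.dim < n ∧ X.act < n)
    (hY : Y.carrier < n ∧ Y.dim < n ∧ Y.act < n) (hf : f < n) (e : v w = MacModel.om) :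
    Sat (isAcyclic w X Y f) n v ↔ AcycP (X.at v) (Y.at v) (v f) := by
  simp (disch := first | omega | (dsimp only; omega) | (simp (disch := omega); assumption))
    [isAcyclic, AcycP]

theorem sat_isFactorization (hw : w < n) (hX : X.carrier < n ∧ X.dim < n ∧ X.act < n)
    (hY : Y.carrier < n ∧ Y.dim < n ∧ Y.act < n) (hZ : Z.carrier < n ∧ Z.dim < n ∧ Z.act < n)
    (hf : f < n) (hj : j < n) (hp : p < n) (e : v w = MacModel.om) :
    Sat (isFactorization w X Y f Z j p) n v ↔
      FactorP (X.at v) (Y.at v) (v f) (Z.at v) (v j) (v p) := by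
  simp (disch := first | omega | (dsimp only; omega) | (simp (disch := omega); assumption))
    [isFactorization, FactorP]

attribute [local simp] sat_isAcyclic sat_isFactorization

/-- The body of the factorization sentence. -/
def factorizationBody (w : ℕ) : Fm := allS fun X => allS fun Y => Fm.all fun f =>
    ((isSSet w X).and <| (isSSet w Y).and <| isMap X Y f).imp <|
    (exS fun Z => Fm.ex2 fun j p => (isFactorization w X Y f Z j p).and <|
        (isMonic j).and <| (isAcyclic w X Z j).and <| isKanFibration w Z Y p).and
     (exS fun Z => Fm.ex2 fun j p => (isFactorization w X Y f Z j p).and <|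
        (isMonic j).and <| (isKanFibration w Z Y p).and <| isAcyclic w Z Y p)

theorem sat_factorizationBody (hw : w < n) (e : v w = MacModel.om) :
    Sat (factorizationBody w) n v ↔ ∀ (X Y : Triple M) (f : M), SSetP X → SSetP Y → MapP X Y f →
      (∃ Z j p, FactorP X Y f Z j p ∧ MonicP j ∧ AcycP X Z j ∧ FibP Z Y p) ∧
      ∃ Z j p, FactorP X Y f Z j p ∧ MonicP j ∧ FibP Z Y p ∧ AcycP Z Y p := by
  simp (disch := first | omega | (dsimp only; omega) | (simp (disch := omega); assumption))
    [factorizationBody]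

end

end

/-! ### Transfer of homotopies, Kan conditions and acyclicity -/

section

/-! ### Comparison of simplicial sets in the model with internal simplicial sets -/

variable {M : Type} [MacModel M]

variable {X Y Z K N N' N'' : Type} [Coded M X] [Coded M Y] [Coded M Z] [Coded M K] [Coded M N]
  [Coded M N'] [Coded M N''] [SSet M X] [SSet M Y] [SSet M Z] [SSet M K]

/-- The embedding of a subcomplex of a standard simplex into sets. -/
def Sieve.emb {n : Nn M} (σ : Sieve M n) (x : σ.El) : GrSet M := grc x.arr

/-- A single comparison for both `Δ[n]` and its horns; the simplices are represented by the graphs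
of arrows. -/
theorem subStdP_iff {n : Nn M} (σ : Sieve M n) {P : M → Prop} {D : Triple M}
    (hσ : ∀ α : Arr M, α.top ≤ n → (P (gr α) ↔ σ.set α)) :
    SubStdP (ob n) P D ↔ Rep σ.emb D := by
  have h1 : ∀ a, ((∃ k, HomP a k (ob n)) ∧ P a) ↔ ∃ x : σ.El, a = code M (σ.emb x) := by
    intro a
    constructor
    · rintro ⟨⟨k, α, m, rfl, rfl, h, hα⟩, hP⟩
      rw [← ob_inj.1 h] at hα
      exact ⟨⟨α, (hσ α hα).1 hP⟩, rfl⟩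
    · rintro ⟨x, rfl⟩
      have hx := σ.top_le _ x.arr_mem
      exact ⟨⟨_, x.arr, n, rfl, rfl, rfl, hx⟩, (hσ _ hx).2 x.arr_mem⟩
  have h2 : (∀ a, E a D.carrier ↔ ∃ x : σ.El, a = code M (σ.emb x)) →
      ∀ p, (∃ a k, E a D.carrier ∧ HomP a k (ob n) ∧ p = pr a k) ↔
        ∃ x : σ.El, p = pr (code M (σ.emb x)) (ob (dim M x)) := by
    intro hc p
    constructor
    · rintro ⟨a, k, ha, hk, rfl⟩
      obtain ⟨x, rfl⟩ := (hc a).1 ha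
      exact ⟨x, by rw [(homP_gr_ob.1 hk).1]; rfl⟩
    · rintro ⟨x, rfl⟩
      exact ⟨_, _, (hc _).2 ⟨x, rfl⟩, homP_gr_ob.2 ⟨rfl, σ.top_le _ x.arr_mem⟩, rfl⟩
  have h3 : (∀ a, E a D.carrier ↔ ∃ x : σ.El, a = code M (σ.emb x)) →
      ∀ t, (∃ a k b l c, E a D.carrier ∧ HomP a k (ob n) ∧ HomP b l k ∧ CompP c a b ∧
        t = pr (pr b a) c) ↔ ∃ x : σ.El, ∃ b : Arr M, b.top ≤ dim M x ∧
        t = pr (pr (gr b) (code M (σ.emb x))) (code M (σ.emb (x ⋆ b))) := by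
    intro hc t
    constructor
    · rintro ⟨a, k, b, l, c, ha, hk, ⟨β, m, rfl, rfl, h, hβ⟩, hcomp, rfl⟩
      obtain ⟨x, rfl⟩ := (hc a).1 ha
      rw [(homP_gr_ob.1 hk).1, ob_inj] at h
      have hx : β.top ≤ x.arr.dom := by rwa [h]
      refine ⟨x, β, hx, ?_⟩
      have := (compP_gr hx).1 hcomp
      rw [this, Sieve.emb, Sieve.emb, code_grc, code_grc, Sieve.act_arr _ hx]
    · rintro ⟨x, b, hb, rfl⟩
      refine ⟨_, _, gr b, _, _, (hc _).2 ⟨x, rfl⟩, homP_gr_ob.2 ⟨rfl, σ.top_le _ x.arr_mem⟩,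
        homP_gr_ob.2 ⟨rfl, hb⟩, ?_, rfl⟩
      refine (compP_gr hb).2 ?_
      rw [Sieve.emb, code_grc, Sieve.act_arr _ hb]
  constructor
  · rintro ⟨a1, a2, a3⟩
    have hc := fun a => (a1 a).trans (h1 a)
    exact ⟨by unfold Sieve.emb; fun_prop, fun x y h => Sieve.El.ext (gr_injective (congrArg Mem.val h)),
      hc, fun p => (a2 p).trans (h2 hc p), fun t => (a3 t).trans (h3 hc t)⟩
  · intro h
    exact ⟨fun a => (h.carrier a).trans (h1 a).symm, fun p => (h.dim p).trans (h2 h.carrier p).symm,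
      fun t => (h.act t).trans (h3 h.carrier t).symm⟩

theorem std_iff {n : Nn M} {D : Triple M} :
    SubStdP (ob n) (fun _ => True) D ↔ Rep (std n).emb D :=
  subStdP_iff _ fun _ h => ⟨fun _ => h, fun _ => trivial⟩

theorem horn_iff {n k : Nn M} {L : Triple M} :
    SubStdP (ob n) (OmitP (ob n) k.val) L ↔ Rep (horn n k).emb L := by
  refine subStdP_iff _ fun α h => ⟨?_, ?_⟩
  · rintro ⟨i, hi, hk, ha⟩
    obtain ⟨i, hi', rfl⟩ := mem_ob.1 hi
    refine ⟨h, i, hi', fun h => hk (congrArg _ h), fun j hj => ha (min j α.dom).val ?_⟩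
    exact pr_mem_gr.2 ⟨min_le_right _ _, by rw [← α.stable, hj]⟩
  · rintro ⟨-, i, hi, hk, ha⟩
    refine ⟨i.val, mem_ob.2 ⟨i, hi, rfl⟩, fun h => hk (Nn.val_inj.1 h), fun j hj => ?_⟩
    obtain ⟨l, hl, e⟩ := mem_gr.1 hj
    exact ha l (Nn.val_inj.1 (pr_inj.1 e).2).symm

theorem succP_iff {s : M} {i : Nn M} : SuccP s i.val ↔ s = ob i := isOrd_iff

theorem hornP_iff {L D : Triple M} : HornP L D ↔ ∃ n k : Nn M, 0 < n ∧ k ≤ n ∧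
    Rep (horn n k).emb L ∧ Rep (std n).emb D := by
  constructor
  · rintro ⟨i, hi, ⟨z, hz⟩, m, hm, hD, k, hk, hL⟩
    obtain ⟨n, rfl⟩ : ∃ n : Nn M, n.val = i := ⟨⟨i, hi⟩, rfl⟩
    obtain rfl := succP_iff.1 hm
    obtain ⟨k, hk', rfl⟩ := mem_ob.1 hk
    let z' : Nn M := ⟨z, Nn.mem_om_of_mem _ _ hz⟩
    have hz' : z' < n := hz
    exact ⟨n, k, lt_of_le_of_lt (Nn.zero_le _) hz', hk', horn_iff.1 hL, std_iff.1 hD⟩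
  · rintro ⟨n, k, hn, hk, hL, hD⟩
    exact ⟨n.val, n.val_mem, ⟨_, hn⟩, _, succP_iff.2 rfl, std_iff.2 hD, _, mem_ob.2 ⟨k, hk, rfl⟩,
      horn_iff.2 hL⟩

theorem prodP_iff {e : X → N} {T I P : Triple M} (h : Rep e T) (hI : Rep (std (1 : Nn M)).emb I) :
    ProdP T I P ↔ Rep (fun c : Cyl M X => (e c.fst, grc c.snd)) P := by
  have i1 := h.int
  have h0 : ∀ x y m, (OverP T x m ∧ OverP I y m) ↔ ∃ c : Cyl M X, x = code M (e c.fst) ∧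
      y = gr c.snd ∧ m = ob (dim M c) := by
    intro x y m
    rw [h.overP_iff, hI.overP_iff]
    constructor
    · rintro ⟨⟨x, rfl, rfl⟩, y, rfl, h2⟩
      exact ⟨Cyl.mk x y.arr (ob_inj.1 h2).symm y.arr_mem, rfl, rfl, rfl⟩
    · rintro ⟨c, rfl, rfl, rfl⟩
      exact ⟨⟨_, rfl, rfl⟩, ⟨c.snd, c.snd_top_le⟩, rfl, congrArg ob c.snd_dom.symm⟩
  have h1 : ∀ p, (∃ x y m, OverP T x m ∧ OverP I y m ∧ p = pr x y) ↔
      ∃ c : Cyl M X, p = code M (e c.fst, grc c.snd) := by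
    intro p
    constructor
    · rintro ⟨x, y, m, h1, h2, rfl⟩
      obtain ⟨c, rfl, rfl, rfl⟩ := (h0 _ _ _).1 ⟨h1, h2⟩
      exact ⟨c, rfl⟩
    · rintro ⟨c, rfl⟩
      obtain ⟨h1, h2⟩ := (h0 _ _ _).2 ⟨c, rfl, rfl, rfl⟩
      exact ⟨_, _, _, h1, h2, rfl⟩
  have h2 : ∀ q, (∃ x y m p, OverP T x m ∧ OverP I y m ∧ p = pr x y ∧ q = pr p m) ↔
      ∃ c : Cyl M X, q = pr (code M (e c.fst, grc c.snd)) (ob (dim M c)) := by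
    intro q
    constructor
    · rintro ⟨x, y, m, _, h1, h2, rfl, rfl⟩
      obtain ⟨c, rfl, rfl, rfl⟩ := (h0 _ _ _).1 ⟨h1, h2⟩
      exact ⟨c, rfl⟩
    · rintro ⟨c, rfl⟩
      obtain ⟨h1, h2⟩ := (h0 _ _ _).2 ⟨c, rfl, rfl, rfl⟩
      exact ⟨_, _, _, _, h1, h2, rfl, rfl⟩
  have h3 : (∀ p, E p P.carrier ↔ ∃ c : Cyl M X, p = code M (e c.fst, grc c.snd)) →
      ∀ t, (∃ a p p' x y x' y', E p P.carrier ∧ p = pr x y ∧ p' = pr x' y' ∧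
        E (pr (pr a x) x') T.act ∧ E (pr (pr a y) y') I.act ∧ t = pr (pr a p) p') ↔
      ∃ (c : Cyl M X) (a : Arr M), a.top ≤ dim M c ∧ t = pr (pr (gr a)
        (code M (e c.fst, grc c.snd))) (code M (e (c ⋆ a).fst, grc (c ⋆ a).snd)) := by
    intro hc t
    constructor
    · rintro ⟨a, _, _, x, y, x', y', hp, rfl, rfl, h4, h5, rfl⟩
      obtain ⟨c, hc'⟩ := (hc _).1 hp
      obtain ⟨rfl, rfl⟩ := pr_inj.1 hc'
      obtain ⟨z, α, hα, rfl, h6, rfl⟩ := h.act_iff.1 h4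
      obtain rfl := h.code_inj.1 h6
      let y : (std (1 : Nn M)).El := ⟨c.snd, c.snd_top_le⟩
      have hy : (code M (grc c.snd) : M) = code M ((std (1 : Nn M)).emb y) := rfl
      rw [hy, hI.act_iff'] at h5
      refine ⟨c, α, hα, ?_⟩
      rw [h5.2, Cyl.act_fst hα, Cyl.act_snd hα, Sieve.emb, Sieve.act_arr _ h5.1]
      rfl
    · rintro ⟨c, a, ha, rfl⟩
      let y : (std (1 : Nn M)).El := ⟨c.snd, c.snd_top_le⟩
      have ha' : a.top ≤ dim M y := by
        change a.top ≤ c.snd.dom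
        rwa [c.snd_dom]
      refine ⟨gr a, _, _, code M (e c.fst), gr c.snd, _, _, (hc _).2 ⟨c, rfl⟩, rfl, rfl,
        h.act_iff'.2 ⟨ha, by rw [Cyl.act_fst ha]⟩, (hI.act_iff' (x := y)).2 ⟨ha', ?_⟩, rfl⟩
      rw [Sieve.emb, Sieve.act_arr _ ha', Cyl.act_snd ha]
      rfl
  constructor
  · rintro ⟨a1, a2, a3⟩
    have hc := fun a => (a1 a).trans (h1 a)
    refine ⟨by fun_prop, fun x y hxy => Cyl.ext (h.inj _ _ (congrArg Prod.fst hxy))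
      (gr_injective (congrArg Mem.val (congrArg Prod.snd hxy))),
      hc, fun p => (a2 p).trans (h2 p), fun t => (a3 t).trans (h3 hc t)⟩
  · intro h
    exact ⟨fun a => (h.carrier a).trans (h1 a).symm, fun p => (h.dim p).trans (h2 p).symm,
      fun t => (h.act t).trans (h3 h.carrier t).symm⟩

section

variable {e : X → N} {e' : Y → N'} {e'' : K → N''} {T T' T'' : Triple M}

theorem exists_rep_std (n : Nn M) : ∃ D : Triple M, Rep (std n).emb D :=
  exists_rep (by unfold Sieve.emb; fun_prop) fun _ _ h =>
    Sieve.El.ext (gr_injective (congrArg Mem.val h))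

theorem constP_iff {x : X} {c : M} {j : Nn M} :
    ConstP c (ob (dim M x)) j.val ↔ c = gr (Arr.const (dim M x) j) := isConst_iff

theorem homotopicP_iff (h : Rep e T) (h'' : Rep e'' T'') {F G : X → K} {f g : M}
    (hf : Gr e e'' F f) (hg : Gr e e'' G g) : HomotopicP T T'' f g ↔ Homotopic M F G := by
  have h1 : ob (0 : Nn M) = (1 : Nn M).val := rfl
  have hend : ∀ (x : X) (j : Nn M) (hj : j ≤ 1), pr (code M (e x)) (gr (Arr.const (dim M x) j)) =
      code M (e (Cyl.endAt hj x).fst, grc (Cyl.endAt hj x).snd) := fun _ _ _ => rfl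
  constructor
  · rintro ⟨i, t, hi, ht, I, P, hI, hP, H, hH, hH'⟩
    obtain rfl := (succP_iff (i := 0)).1 hi
    rw [h1] at ht
    obtain rfl := succP_iff.1 ht
    rw [std_iff] at hI
    rw [prodP_iff h hI] at hP
    obtain ⟨Γ, hΓ, hΓH⟩ := hH.exists_gr hP h''
    refine ⟨Γ, hΓ, fun c hc => ?_, fun c hc => ?_⟩
    · have := (hH' _ _ (gr (Arr.const (dim M c.fst) 0)) (h.overP_iff.2 ⟨c.fst, rfl, rfl⟩)).1
        (constP_iff.2 rfl) _ ((hf.pr_iff h).2 rfl)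
      rw [hend _ _ (Nn.zero_le _), ← Cyl.eq_endAt hc, hΓH.pr_iff hP] at this
      exact (h''.code_inj.1 this).symm
    · have := (hH' _ _ (gr (Arr.const (dim M c.fst) 1)) (h.overP_iff.2 ⟨c.fst, rfl, rfl⟩)).2
        (constP_iff.2 rfl) _ ((hg.pr_iff h).2 rfl)
      rw [hend _ _ le_rfl, ← Cyl.eq_endAt hc, hΓH.pr_iff hP] at this
      exact (h''.code_inj.1 this).symm
  · rintro ⟨Γ, hΓ, hΓ0, hΓ1⟩
    obtain ⟨I, hI⟩ := exists_rep_std (1 : Nn M)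
    have i1 := h.int
    obtain ⟨P, hP⟩ := exists_rep (M := M) (e := fun c : Cyl M X => (e c.fst, grc c.snd))
      (by fun_prop) fun x y hxy => Cyl.ext (h.inj _ _ (congrArg Prod.fst hxy))
      (gr_injective (congrArg Mem.val (congrArg Prod.snd hxy)))
    obtain ⟨H, hH⟩ := exists_gr_map hP h'' hΓ
    refine ⟨_, _, (succP_iff (i := 0)).2 rfl, (succP_iff (i := 1)).2 rfl, I, P, std_iff.2 hI,
      (prodP_iff h hI).2 hP, H, hH.mapP hP h'' hΓ, fun x m c hx => ?_⟩
    obtain ⟨x, rfl, rfl⟩ := h.overP_iff.1 hx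
    refine ⟨fun hc y hy => ?_, fun hc y hy => ?_⟩
    · obtain rfl := (constP_iff (j := 0)).1 hc
      rw [hend _ _ (Nn.zero_le _), hH.pr_iff hP, hΓ0 _ fun _ => rfl]
      exact (hf.pr_iff h).1 hy
    · obtain rfl := (constP_iff (j := 1)).1 hc
      rw [hend _ _ le_rfl, hH.pr_iff hP, hΓ1 _ fun _ => rfl]
      exact (hg.pr_iff h).1 hy

/-- The simplicial map with the given graph on a horn. -/
theorem IsHornMap.exists_map {n k : Nn M} {G : ISet M (Arr M × K)} (hG : IsHornMap n k G) :
    ∃ H : (MacSet.horn n k).El → K, IsSMap M H ∧ ∀ x κ, H x = κ ↔ G (x.arr, κ) := by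
  obtain ⟨H, hH⟩ := exists_ifun (M := M) (R := fun (x : (MacSet.horn n k).El) κ => G (x.arr, κ))
    (by fun_prop) fun x => by
      obtain ⟨κ, hκ⟩ := hG.ex _ x.arr_mem.1 x.arr_mem.2
      exact ⟨κ, hκ, fun κ' h => hG.func _ _ _ h hκ⟩
  refine ⟨H, ⟨H.int, fun x => hG.dim _ _ ((hH x _).1 rfl), fun x a ha => (hH _ _).2 ?_⟩, hH⟩
  rw [Sieve.act_arr x ha]
  exact hG.act _ _ _ ((hH x _).1 rfl) ha

theorem IsSMap.exists_hornMap {n k : Nn M} {H : (horn n k).El → K} (hH : IsSMap M H) :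
    ∃ G : ISet M (Arr M × K), IsHornMap n k G ∧ ∀ c κ, G (c, κ) ↔ ∃ x, x.arr = c ∧ H x = κ := by
  have i1 := hH.internal
  refine ⟨⟨fun p => ∃ x : (horn n k).El, x.arr = p.1 ∧ H x = p.2, by fun_prop⟩, ⟨?_, ?_, ?_, ?_, ?_⟩,
    fun c κ => Iff.rfl⟩
  · rintro _ _ ⟨x, rfl, rfl⟩
    exact x.arr_mem
  · exact fun c h h' => ⟨H ⟨c, h, h'⟩, ⟨c, h, h'⟩, rfl, rfl⟩
  · rintro _ _ _ ⟨x, rfl, rfl⟩ ⟨x', h, rfl⟩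
    rw [Sieve.El.ext h]
  · rintro _ _ ⟨x, rfl, rfl⟩
    exact hH.dim x
  · rintro _ _ b ⟨x, rfl, rfl⟩ hb
    exact ⟨x ⋆ b, Sieve.act_arr x hb, hH.act x b hb⟩

theorem Gr.sub_iff {n k : Nn M} {D : Triple M} (hD : Rep (std n).emb D) (h'' : Rep e'' T'') {H : (horn n k).El → K} {l : (std n).El → K}
    {h f : M} (hH : Gr (horn n k).emb e'' H h) (hl : Gr (std n).emb e'' l f) :
    (∀ z, E z h → E z f) ↔ ∀ x y, x.arr = y.arr → l y = H x := by
  constructor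
  · intro hs x y hxy
    have := hs _ ((hH _).2 ⟨x, rfl⟩)
    have e : code M ((horn n k).emb x) = code M ((std n).emb y) := by
      rw [Sieve.emb, Sieve.emb, hxy]
    rw [e, hl.pr_iff hD] at this
    exact (h''.code_inj.1 this).symm
  · intro hs z hz
    obtain ⟨x, rfl⟩ := (hH z).1 hz
    let y : (std n).El := ⟨x.arr, x.arr_mem.1⟩
    refine (hl _).2 ⟨y, ?_⟩
    rw [hs x y rfl]
    rfl

/-- This direction is the one needed, because Kan complexes occur only as test objects in the
definition of acyclic maps. The filling simplex is the value of the extension at the identity of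
`[n]`. -/
theorem KanP.isKan (h'' : Rep e'' T'') (hK : KanP T'') : IsKan M K := by
  intro n k G hn hk hG
  obtain ⟨H, hH, hHG⟩ := hG.exists_map
  obtain ⟨D, hD⟩ := exists_rep_std n
  obtain ⟨L, hL⟩ := exists_rep (M := M) (e := (horn n k).emb) (by unfold Sieve.emb; fun_prop)
    fun _ _ h => Sieve.El.ext (gr_injective (congrArg Mem.val h))
  obtain ⟨h, hh⟩ := exists_gr_map hL h'' hH
  obtain ⟨l, hl, hs⟩ := hK L D (hornP_iff.2 ⟨n, k, hn, hk, hL, hD⟩) h (hh.mapP hL h'' hH)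
  obtain ⟨f, hf, hfl⟩ := hl.exists_gr hD h''
  rw [Gr.sub_iff hD h'' hh hfl] at hs
  have hid : (Arr.id M n).top ≤ n := by simp
  let ι : (std n).El := ⟨Arr.id M n, hid⟩
  refine ⟨f ι, hf.dim _, fun c κ hc => ?_⟩
  obtain ⟨h1, h2⟩ := hG.horn _ _ hc
  have h3 : c.top ≤ dim M ι := h1
  rw [← hf.act _ _ h3, hs ⟨c, h1, h2⟩ _ ?_]
  · exact (hHG _ _).2 hc
  · rw [Sieve.act_arr _ h3]
    exact (Arr.id_comp h1).symm

/-- A map `B` from `Δ[n]` is determined by its value at the identity; the lift of that simplex gives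
the lift of the map by Yoneda. -/
theorem IsKanFib.fibP (h : Rep e T) (h' : Rep e' T') {p : X → Y} {q : M} (hp : IsSMap M p)
    (hq : Gr e e' p q) (hK : IsKanFib (M := M) p) : FibP T T' q := by
  intro L D hLD g b hg hb hcomm
  obtain ⟨n, k, hn, hk, hL, hD⟩ := hornP_iff.1 hLD
  obtain ⟨H, hH, hHg⟩ := hg.exists_gr hL h
  obtain ⟨B, hB, hBb⟩ := hb.exists_gr hD h'
  obtain ⟨G, hG, hGH⟩ := hH.exists_hornMap
  have hid : (Arr.id M n).top ≤ n := by simp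
  let ι : (std n).El := ⟨Arr.id M n, hid⟩
  have hι : ∀ y : (std n).El, ι ⋆ y.arr = y := fun y => Sieve.El.ext (by
    rw [Sieve.act_arr ι y.arr_mem]
    exact Arr.id_comp y.arr_mem)
  have hBy : ∀ y : (std n).El, B y = B ι ⋆ y.arr := fun y => by
    rw [← hB.act ι y.arr y.arr_mem, hι]
  obtain ⟨z, hz, hzG⟩ := hK n k G (B ι) hn hk (hB.dim _) hG fun c z hc => by
    obtain ⟨x, rfl, rfl⟩ := (hGH _ _).1 hc
    have h1 := hcomm _ _ _ ((hHg _).2 ⟨x, rfl⟩) ((hq.pr_iff h).2 rfl)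
    let y : (std n).El := ⟨x.arr, x.arr_mem.1⟩
    have e : (code M ((horn n k).emb x) : M) = code M ((std n).emb y) := rfl
    rw [e, hBb.pr_iff hD, h'.code_inj] at h1
    exact h1.trans (hBy y)
  have hdz : dim M z = n := by
    rw [← hp.dim, hz, hB.dim]
    rfl
  have hl := isSMap_yoneda z hdz
  obtain ⟨l, hll⟩ := exists_gr_map hD h hl
  refine ⟨l, hll.mapP hD h hl, (Gr.sub_iff hD h hHg hll).2 fun x y hxy => ?_,
    (Gr.compP h hll hq).2 ?_⟩
  · exact hzG _ _ ((hGH _ _).2 ⟨x, hxy, rfl⟩)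
  · have : (fun y : (std n).El => p (z ⋆ y.arr)) = B := by
      funext y
      rw [hBy, ← hz, hp.act]
      rw [hdz]
      exact y.arr_mem
    rwa [this]

/-- `IsAcyc` ranges over all coded Kan complexes, among which are those given by sets of the model.
-/
theorem IsAcyc.acycP (h : Rep e T) (h' : Rep e' T') {p : X → Y} {q : M}
    (hp : IsSMap M p) (hq : Gr e e' p q) (hK : IsAcyc M p) : AcycP T T' q := by
  intro W hW hWK
  obtain ⟨inst, hr⟩ := hW.exists_rep
  obtain ⟨h1, h2⟩ := hK (Mem W.carrier) (hWK.isKan hr)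
  constructor
  · intro g hg
    obtain ⟨G, hG, hGg⟩ := hg.exists_gr h hr
    obtain ⟨F, hF, hFG⟩ := h1 G hG
    obtain ⟨f, hf⟩ := exists_gr_map h' hr hF
    obtain ⟨c, hc⟩ := exists_gr_map h hr (hF.comp hp)
    exact ⟨f, c, hf.mapP h' hr hF, (Gr.compP h' hq hf).2 hc, (homotopicP_iff h hr hc hGg).2 hFG⟩
  · intro f f' c c' hf hf' hc hc' hcc
    obtain ⟨F, hF, hFf⟩ := hf.exists_gr h' hr
    obtain ⟨F', hF', hFf'⟩ := hf'.exists_gr h' hr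
    rw [Gr.compP h' hq hFf] at hc
    rw [Gr.compP h' hq hFf'] at hc'
    rw [homotopicP_iff h hr hc hc'] at hcc
    exact (homotopicP_iff h' hr hFf hFf').2 (h2 F F' hF hF' hcc)

end

theorem factorization {T T' : Triple M} {f : M} (hT : SSetP T) (hT' : SSetP T')
    (hf : MapP T T' f) :
    (∃ Z j p, FactorP T T' f Z j p ∧ MonicP j ∧ AcycP T Z j ∧ FibP Z T' p) ∧
      ∃ Z j p, FactorP T T' f Z j p ∧ MonicP j ∧ FibP Z T' p ∧ AcycP Z T' p := by
  obtain ⟨_, h⟩ := hT.exists_rep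
  obtain ⟨_, h'⟩ := hT'.exists_rep
  obtain ⟨F, hF, hFf⟩ := hf.exists_gr h h'
  constructor
  · obtain ⟨Z, _, _, j, p, hj, hp, hjp, hinj, ha, hfib⟩ := exists_factorization_acyclic_monic hF
    obtain ⟨W, hW⟩ := exists_rep (M := M) (e := fun z : Z => z) (by fun_prop) fun _ _ h => h
    obtain ⟨j', hj'⟩ := exists_gr_map h hW hj
    obtain ⟨p', hp'⟩ := exists_gr_map hW h' hp
    refine ⟨W, j', p', ⟨hW.ssetP, hj'.mapP h hW hj, hp'.mapP hW h' hp, (Gr.compP hW hj' hp').2 ?_⟩,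
      hj'.monicP hW hinj, ha.acycP h hW hj hj', hfib.fibP hW h' hp hp'⟩
    simpa only [hjp] using hFf
  · obtain ⟨Z, _, _, j, p, hj, hp, hjp, hinj, hfib, ha⟩ :=
      exists_factorization_acyclic_fibration hF
    obtain ⟨W, hW⟩ := exists_rep (M := M) (e := fun z : Z => z) (by fun_prop) fun _ _ h => h
    obtain ⟨j', hj'⟩ := exists_gr_map h hW hj
    obtain ⟨p', hp'⟩ := exists_gr_map hW h' hp
    refine ⟨W, j', p', ⟨hW.ssetP, hj'.mapP h hW hj, hp'.mapP hW h' hp, (Gr.compP hW hj' hp').2 ?_⟩,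
      hj'.monicP hW hinj, hfib.fibP hW h' hp hp', ha.acycP hW h' hp hp'⟩
    simpa only [hjp] using hFf

end

/-! ### From models of the theory to the factorization sentence -/

section

/-! ### Models of the theory -/

section

variable {M : Type} [lang.Structure M] {n : ℕ} {v : ℕ → M}

attribute [local simp] sat_all sat_ex sat_allIn sat_exIn sat_and sat_or sat_neg sat_imp sat_iff
  sat_mem sat_eq Function.update_self Function.update_of_ne Fm.all2

theorem sat_isInductive {x : ℕ} (hx : x < n) : Sat (isInductive x) n v ↔
    (∃ e, E e (v x) ∧ ∀ z, ¬ E z e) ∧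
      ∀ y, E y (v x) → ∃ s, E s (v x) ∧ ∀ z, E z s ↔ E z y ∨ z = y := by
  simp (disch := omega) [isInductive, isEmpty, isSucc]

theorem sat_isOmega {x : ℕ} (hx : x < n) : Sat (isOmega x) n v ↔
    ((∃ e, E e (v x) ∧ ∀ z, ¬ E z e) ∧
      ∀ y, E y (v x) → ∃ s, E s (v x) ∧ ∀ z, E z s ↔ E z y ∨ z = y) ∧
    ∀ u, (∃ e, E e u ∧ ∀ z, ¬ E z e) → (∀ y, E y u → ∃ s, E s u ∧ ∀ z, E z s ↔ E z y ∨ z = y) →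
      ∀ z, E z (v x) → E z u := by
  simp (disch := omega) [isOmega, sat_isInductive, sub]

theorem realize_extensionality (h : Sentence.Realize M extensionality) (x y : M)
    (hxy : ∀ z, E z x ↔ E z y) : x = y := by
  rw [extensionality, realize_close (v := fun _ => x)] at h
  simp (disch := omega) at h
  exact h x y hxy

theorem realize_pairing (h : Sentence.Realize M pairing) (x y : M) :
    ∃ p, ∀ z, E z p ↔ z = x ∨ z = y := by
  rw [pairing, realize_close (v := fun _ => x)] at h
  simp (disch := omega) [isUPair] at h
  exact h x y

theorem realize_union (h : Sentence.Realize M union) (x : M) :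
    ∃ u, ∀ z, E z u ↔ ∃ y, E y x ∧ E z y := by
  rw [union, realize_close (v := fun _ => x)] at h
  simp (disch := omega) at h
  exact h x

theorem realize_powerSet (h : Sentence.Realize M powerSet) (x : M) :
    ∃ p, ∀ z, E z p ↔ ∀ y, E y z → E y x := by
  rw [powerSet, realize_close (v := fun _ => x)] at h
  simp (disch := omega) [sub] at h
  exact h x

theorem realize_choice (h : Sentence.Realize M choice) (x : M) (h1 : ∀ y, E y x → ∃ z, E z y)
    (h2 : ∀ y, E y x → ∀ z, E z x → (∃ u, E u y ∧ E u z) → y = z) :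
    ∃ c, ∀ y, E y x → ∃ u, E u y ∧ E u c ∧ ∀ v, E v y → E v c → v = u := by
  rw [choice, realize_close (v := fun _ => x)] at h
  simp (disch := omega) [inhabited] at h
  exact h x h1 fun y hy z hz u hu hu' => h2 y hy z hz ⟨u, hu, hu'⟩

theorem realize_separation {φ : Form (n + 1)} (h : Sentence.Realize M (separation n φ))
    (v : ℕ → M) (a : M) : ∃ b, ∀ x, E x b ↔ E x a ∧
      φ.Realize (default : Empty → M) fun i : Fin (n + 1) => Function.update v n x i := by
  have h' := (BoundedFormula.realize_alls.1 h) fun i => v i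
  obtain ⟨b, hb⟩ := BoundedFormula.realize_ex.1 (BoundedFormula.realize_all.1 h' a)
  refine ⟨b, fun x => ?_⟩
  have hx := BoundedFormula.realize_all.1 hb x
  rw [BoundedFormula.realize_iff, BoundedFormula.realize_inf, realize_memForm, realize_memForm,
    BoundedFormula.realize_liftAt (Nat.le_succ n)] at hx
  simp only [snoc_eq_update] at hx
  -- Lifting moves the last variable from place `n` to place `n + 2`, past the places of `a` and
  -- `b`; this identity of valuations says that the moved formula still speaks about `x` and the
  -- same parameters.
  have e : (fun i : Fin (n + 1) => Function.update v n x i) =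
      (fun i : Fin (n + 1 + 2) => Function.update (Function.update (Function.update v n a)
        n.succ b) n.succ.succ x i) ∘ fun i : Fin (n + 1) =>
          if (i : ℕ) < n then Fin.castAdd 2 i else Fin.addNat i 2 := by
    funext i
    by_cases hi : (i : ℕ) < n
    · have h1 : (i : ℕ) ≠ n := hi.ne
      have h2 : (i : ℕ) ≠ n + 1 := by omega
      have h3 : (i : ℕ) ≠ n + 1 + 1 := by omega
      simp [hi, h1, h2, h3]
    · have h1 : (i : ℕ) = n := by omega
      simp [h1]
  have e' : Function.update (Function.update (Function.update v n a) n.succ b) n.succ.succ x n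
      = a := by simp (disch := omega) [Function.update_of_ne]
  rw [e]
  rw [e'] at hx
  simpa using hx

end

/-- A model of MAC with its set of natural numbers. -/
abbrev macModel (M : Type) [S : lang.Structure M] (hM : M ⊨ MAC) (w : M)
    (hw : Sat (isOmega 0) 1 fun _ => w) : MacModel M :=
  { S with
    ext := realize_extensionality (hM.realize_of_mem _ (by simp [MAC]))
    pairing := realize_pairing (hM.realize_of_mem _ (by simp [MAC]))
    union := realize_union (hM.realize_of_mem _ (by simp [MAC]))
    power := realize_powerSet (hM.realize_of_mem _ (by simp [MAC]))
    choice := realize_choice (hM.realize_of_mem _ (by simp [MAC]))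
    sep := by
      rintro φ n ⟨ψ, hψ, eψ⟩ v a
      obtain ⟨b, hb⟩ := realize_separation (φ := ψ)
        (hM.realize_of_mem _ (Or.inr ⟨n, ψ, hψ, rfl⟩)) v a
      exact ⟨b, fun x => (hb x).trans (and_congr_right fun _ => (eψ M _ _).symm)⟩
    om := w
    om_zero := ((sat_isOmega one_pos).1 hw).1.1
    om_succ := ((sat_isOmega one_pos).1 hw).1.2
    om_ind := ((sat_isOmega one_pos).1 hw).2 }

theorem realize_factorizationSentence (M : Type) [S : lang.Structure M] (hM : M ⊨ MAC) :
    Sentence.Realize M factorizationSentence := by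
  -- An element is needed only to have some valuation of all variables; in an empty structure the
  -- universal sentence holds vacuously.
  rcases isEmpty_or_nonempty M with hE | ⟨⟨x⟩⟩
  · exact fun w => (hE.false w).elim
  have e : factorizationSentence =
    Fm.close (Fm.all fun w => (isOmega w).imp (factorizationBody w)) := rfl
  rw [e, realize_close (v := fun _ => x), sat_all]
  intro w
  rw [sat_imp]
  intro hw
  let _ := macModel M hM w (by simpa [sat_isOmega] using hw)
  exact (sat_factorizationBody one_pos (by simp; rfl)).2 fun X Y f hX hY hf =>
    factorization hX hY hf

end

end MacSet

end

/-- `⊨ᵇ` is truth in all models, which by Gödel's completeness theorem amounts to provability. -/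
theorem theoremT : MacSet.MAC ⊨ᵇ MacSet.factorizationSentence := by
  intro M v xs
  have h := MacSet.realize_factorizationSentence M M.is_model
  rwa [Sentence.Realize, Formula.Realize, Subsingleton.elim default v,
    Subsingleton.elim default xs] at h
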